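/- Let $l\in\{1,2\}$, $\xi\in\{1,2\}$ and $\kappa\in\mathbb{R}$. In the complex Hilbert space $L^2(0,\infty)$ let $T_{l\xi\kappa}^3$ be the operator acting by the differential expression $$T_l^3=\Bigl(-\frac{d^2}{dr^2}+\frac{l(l+1)}{r^2}\Bigr)^3$$ on the domain of all $u\in H^6(0,\infty)$ (that is, $u\in L^2(0,\infty)$ is $C^5$ on $[0,\infty)$ with $u^{(5)}$ locally absolutely continuous and $u^{(6)}\in L^2(0,\infty)$) such that $T_l^3u\in L^2(0,\infty)$ and the following boundary conditions hold: - if $\xi=1$: $u(0)=u'(0)=0$ and $\kappa u''(0)=u'''(0)$; - if $\xi=2$, $l=1$: $u(0)=u^{(4)}(0)=0$ and $\kappa u''(0)=u'''(0)$; - if $\xi=2$, $l=2$: $u'(0)=u'''(0)=u^{(4)}(0)=0$ and $\kappa^5u(0)=u^{(5)}(0)$. Then $T_{l\xi\kappa}^3$ is essentially self-adjoint, i.e. it is densely defined and symmetric, and its closure is self-adjoint. Moreover, for every $\rho>0$ and either choice of sign, $\ker\bigl(T_{l\xi\kappa}^3\pm i\rho^6\bigr)^*=\{0\}$. In particular,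 put $$D_lw(r)=r^{l+1}\Bigl(\frac1r\frac{d}{dr}\Bigr)^l\frac{w(r)}{r},$$ $$q^1_{l\pm}=D_l\Bigl(e^{e^{\mp 3\pi i/4}\rho r}+e^{\mp 2\pi i/3}e^{-e^{\mp \pi i/12}\rho r}+e^{\pm 2\pi i/3}e^{-e^{\mp 5\pi i/12}\rho r}\Bigr),$$ $$q^2_{l\pm}=D_l\Bigl(e^{\mp 5\pi i/6}e^{e^{\mp 3\pi i/4}\rho r}+\sqrt3\,e^{-e^{\mp \pi i/12}\rho r}+e^{\pm 5\pi i/6}e^{-e^{\mp 5\pi i/12}\rho r}\Bigr).$$ Then for all $(\alpha,\beta)\in\mathbb{C}^2\setminus\{(0,0)\}$ the function $\alpha q^1_{l\pm}+\beta q^2_{l\pm}$ does not belong to $\ker\bigl(T_{l\xi\kappa}^3\pm i\rho^6\bigr)^*$. -/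

import Mathlib

open MeasureTheory Set Filter Topology

noncomputable section

/-- Lebesgue measure on the half-line `(0, ∞)`. -/
abbrev halfLine : Measure ℝ := volume.restrict (Ioi (0 : ℝ))

/-- The Hilbert space `L²((0, ∞); ℂ)`. -/
abbrev HalfLineL2 : Type := Lp ℂ 2 halfLine

/-- The differential operation `T_l = -d²/dr² + l(l+1)/r²`, acting pointwise. -/
def radialOp (l : ℕ) (f : ℝ → ℂ) : ℝ → ℂ :=
  fun r => -deriv (deriv f) r + ((l : ℂ) * ((l : ℂ) + 1) / (r : ℂ) ^ 2) * f r

/-- The differential operation `T_l³`. -/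
def radialOpCube (l : ℕ) (f : ℝ → ℂ) : ℝ → ℂ := (radialOp l)^[3] f

/-- The vector `(u(0), u'(0), …, u⁽⁵⁾(0))` of one-sided derivatives at the origin. -/
def boundaryJet (f : ℝ → ℂ) : Fin 6 → ℂ :=
  fun j => iteratedDerivWithin (j : ℕ) f (Ici 0) 0

/-- `f` is a `C⁵` representative on `[0, ∞)` of an element of the Sobolev space `H⁶(0, ∞)`:
`f` is square integrable, five times continuously differentiable up to the boundary, and its fifth
derivative is an indefinite integral of a square integrable function (the sixth derivative). -/
structure IsSobolevSix (f : ℝ → ℂ) : Prop where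
  memLp : MemLp f 2 halfLine
  contDiffOn : ContDiffOn ℝ 5 f (Ici 0)
  exists_sixth : ∃ h : ℝ → ℂ, MemLp h 2 halfLine ∧ ∀ r : ℝ, 0 ≤ r →
    iteratedDerivWithin 5 f (Ici 0) r = iteratedDerivWithin 5 f (Ici 0) 0 + ∫ s in (0 : ℝ)..r, h s

/-- `u(0) = u'(0) = 0`, `κ u''(0) = u'''(0)`. -/
def boundaryOne (κ : ℝ) : Submodule ℂ (Fin 6 → ℂ) where
  carrier := {c | c 0 = 0 ∧ c 1 = 0 ∧ (κ : ℂ) * c 2 = c 3}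
  zero_mem' := by simp
  add_mem' := by
    rintro a b ⟨h1, h2, h3⟩ ⟨k1, k2, k3⟩
    exact ⟨by simp [h1, k1], by simp [h2, k2], by simp [← h3, ← k3, mul_add]⟩
  smul_mem' := by
    rintro t a ⟨h1, h2, h3⟩
    exact ⟨by simp [h1], by simp [h2], by simp [← h3, mul_left_comm]⟩

/-- `u(0) = u⁽⁴⁾(0) = 0`, `κ u''(0) = u'''(0)`. -/
def boundaryTwoOne (κ : ℝ) : Submodule ℂ (Fin 6 → ℂ) where
  carrier := {c | c 0 = 0 ∧ c 4 = 0 ∧ (κ : ℂ) * c 2 = c 3}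
  zero_mem' := by simp
  add_mem' := by
    rintro a b ⟨h1, h2, h3⟩ ⟨k1, k2, k3⟩
    exact ⟨by simp [h1, k1], by simp [h2, k2], by simp [← h3, ← k3, mul_add]⟩
  smul_mem' := by
    rintro t a ⟨h1, h2, h3⟩
    exact ⟨by simp [h1], by simp [h2], by simp [← h3, mul_left_comm]⟩

/-- `u'(0) = u'''(0) = u⁽⁴⁾(0) = 0`, `κ⁵ u(0) = u⁽⁵⁾(0)`. -/
def boundaryTwoTwo (κ : ℝ) : Submodule ℂ (Fin 6 → ℂ) where
  carrier := {c | c 1 = 0 ∧ c 3 = 0 ∧ c 4 = 0 ∧ (κ : ℂ) ^ 5 * c 0 = c 5}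
  zero_mem' := by simp
  add_mem' := by
    rintro a b ⟨h1, h2, h3, h4⟩ ⟨k1, k2, k3, k4⟩
    exact ⟨by simp [h1, k1], by simp [h2, k2], by simp [h3, k3],
      by simp [← h4, ← k4, mul_add]⟩
  smul_mem' := by
    rintro t a ⟨h1, h2, h3, h4⟩
    exact ⟨by simp [h1], by simp [h2], by simp [h3], by simp [← h4, mul_left_comm]⟩

/-- The boundary conditions with label `ξ ∈ {1, 2}` for angular momentum `l ∈ {1, 2}`. -/
def boundarySpace (l ξ : ℕ) (κ : ℝ) : Submodule ℂ (Fin 6 → ℂ) :=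
  if ξ = 1 then boundaryOne κ else if l = 1 then boundaryTwoOne κ else boundaryTwoTwo κ

section Helpers

/-- `f` is `C^n` on `(0, ∞)` and its `n`-th derivative is differentiable almost everywhere. -/
def AERegular (n : ℕ) (f : ℝ → ℂ) : Prop :=
  ContDiffOn ℝ n f (Ioi 0) ∧ ∀ᵐ r ∂halfLine, DifferentiableAt ℝ (iteratedDeriv n f) r

lemma radialOp_congr {l : ℕ} {f g : ℝ → ℂ} (h : EqOn f g (Ioi 0)) :
    EqOn (radialOp l f) (radialOp l g) (Ioi 0) := by
  intro r hr
  have h1 : f =ᶠ[𝓝 r] g := h.eventuallyEq_of_mem (Ioi_mem_nhds hr)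
  simp only [radialOp, h1.deriv.deriv_eq, h hr]

lemma radialOpCube_congr {l : ℕ} {f g : ℝ → ℂ} (h : EqOn f g (Ioi 0)) :
    EqOn (radialOpCube l f) (radialOpCube l g) (Ioi 0) :=
  radialOp_congr (radialOp_congr (radialOp_congr h))

lemma radialOp_zero (l : ℕ) : radialOp l 0 = 0 := by
  have : deriv (0 : ℝ → ℂ) = 0 := by ext; simp
  ext r
  simp [radialOp, this]

lemma radialOpCube_zero (l : ℕ) : radialOpCube l 0 = 0 := by
  simp [radialOpCube, radialOp_zero]

lemma radialOp_lin_apply {l : ℕ} {f g : ℝ → ℂ} (c : ℂ) {r : ℝ}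
    (hf : ∀ᶠ s in 𝓝 r, DifferentiableAt ℝ f s) (hg : ∀ᶠ s in 𝓝 r, DifferentiableAt ℝ g s)
    (hf2 : DifferentiableAt ℝ (deriv f) r) (hg2 : DifferentiableAt ℝ (deriv g) r) :
    radialOp l (c • f + g) r = (c • radialOp l f + radialOp l g) r := by
  have h1 : deriv (c • f + g) =ᶠ[𝓝 r] c • deriv f + deriv g := by
    filter_upwards [hf, hg] with s hs ks
    rw [deriv_add (hs.const_smul c) ks, deriv_const_smul c hs]
    rfl
  have h2 : deriv (c • deriv f + deriv g) r = c • deriv (deriv f) r + deriv (deriv g) r := by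
    rw [deriv_add (hf2.const_smul c) hg2, deriv_const_smul c hf2]
  simp only [radialOp, h1.deriv_eq, h2, Pi.add_apply, Pi.smul_apply, smul_eq_mul]
  ring

lemma AERegular.differentiableAt {n : ℕ} {f : ℝ → ℂ} (h : AERegular (n + 1) f) {r : ℝ}
    (hr : 0 < r) : DifferentiableAt ℝ f r :=
  ((h.1.contDiffAt (Ioi_mem_nhds hr)).differentiableAt (by simp))

lemma contDiffOn_deriv_Ioi {n : ℕ} {f : ℝ → ℂ} (h : ContDiffOn ℝ (n + 1 : ℕ) f (Ioi 0)) :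
    ContDiffOn ℝ n (deriv f) (Ioi 0) :=
  ((contDiffOn_succ_iff_deriv_of_isOpen (n := (n : WithTop ℕ∞)) isOpen_Ioi).1
    (by exact_mod_cast h)).2.2

lemma AERegular.radialOp {l n : ℕ} {f : ℝ → ℂ} (h : AERegular (n + 2) f) :
    AERegular n (radialOp l f) := by
  have hd : ContDiffOn ℝ n (deriv (deriv f)) (Ioi 0) :=
    contDiffOn_deriv_Ioi (contDiffOn_deriv_Ioi h.1)
  have hv : ContDiffOn ℝ (n + 1 : ℕ)
      (fun r : ℝ => ((l : ℂ) * ((l : ℂ) + 1) / (r : ℂ) ^ 2) * f r) (Ioi 0) := by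
    have hc : ContDiffOn ℝ (n + 1 : ℕ) (fun r : ℝ => (r : ℂ) ^ 2) (Ioi 0) :=
      (Complex.ofRealCLM.contDiff.contDiffOn).pow 2
    have hi := hc.inv fun r (hr : 0 < r) => pow_ne_zero 2 (Complex.ofReal_ne_zero.2 hr.ne')
    simp only [div_eq_mul_inv]
    exact (contDiffOn_const.mul hi).mul (h.1.of_le (by exact_mod_cast Nat.le_succ _))
  refine ⟨hd.neg.add (hv.of_le (by exact_mod_cast Nat.le_succ _)), ?_⟩
  filter_upwards [h.2, ae_restrict_mem measurableSet_Ioi] with r hr hr0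
  have e : iteratedDeriv n (_root_.radialOp l f) =ᶠ[𝓝 r]
      -iteratedDeriv (n + 2) f +
        iteratedDeriv n (fun r : ℝ => ((l : ℂ) * ((l : ℂ) + 1) / (r : ℂ) ^ 2) * f r) := by
    filter_upwards [Ioi_mem_nhds hr0] with s hs
    have a1 := hd.contDiffAt (Ioi_mem_nhds hs)
    have a2 := (hv.of_le (by exact_mod_cast Nat.le_succ n :
      ((n : ℕ) : WithTop ℕ∞) ≤ (n + 1 : ℕ))).contDiffAt (Ioi_mem_nhds hs)
    have e0 : _root_.radialOp l f = -deriv (deriv f) +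
        (fun r : ℝ => ((l : ℂ) * ((l : ℂ) + 1) / (r : ℂ) ^ 2) * f r) := rfl
    have a1' : ContDiffAt ℝ n (-deriv (deriv f)) s := a1.neg
    rw [e0, iteratedDeriv_add a1' a2, iteratedDeriv_neg, Pi.add_apply, Pi.neg_apply,
      iteratedDeriv_succ', iteratedDeriv_succ']
  refine DifferentiableAt.congr_of_eventuallyEq (DifferentiableAt.add hr.neg ?_) e
  have a3 : ContDiffOn ℝ (n + 1 : ℕ)
      (fun r : ℝ => ((l : ℂ) * ((l : ℂ) + 1) / (r : ℂ) ^ 2) * f r) (Ioi 0) := hv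
  have a4 := a3.differentiableOn_iteratedDerivWithin (m := n)
    (by exact_mod_cast Nat.lt_succ_self n) isOpen_Ioi.uniqueDiffOn
  refine ((a4 r hr0).differentiableAt (Ioi_mem_nhds hr0)).congr_of_eventuallyEq ?_
  filter_upwards [Ioi_mem_nhds hr0] with s hs
  exact (iteratedDerivWithin_of_isOpen isOpen_Ioi hs).symm

lemma radialOp_lin_eqOn {l n : ℕ} {f g : ℝ → ℂ} (c : ℂ) (hf : AERegular (n + 2) f)
    (hg : AERegular (n + 2) g) :
    EqOn (radialOp l (c • f + g)) (c • radialOp l f + radialOp l g) (Ioi 0) := by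
  intro r hr
  have aux : ∀ {k : ℝ → ℂ}, AERegular (n + 2) k → DifferentiableAt ℝ (deriv k) r := by
    intro k hk
    have h1 : ContDiffOn ℝ (n + 1 : ℕ) (deriv k) (Ioi 0) := contDiffOn_deriv_Ioi hk.1
    exact (h1.contDiffAt (Ioi_mem_nhds hr)).differentiableAt (by simp)
  refine radialOp_lin_apply c ?_ ?_ (aux hf) (aux hg)
  · filter_upwards [Ioi_mem_nhds hr] with s hs using hf.differentiableAt hs
  · filter_upwards [Ioi_mem_nhds hr] with s hs using hg.differentiableAt hs

lemma radialOpCube_lin {l : ℕ} {f g : ℝ → ℂ} (c : ℂ) (hf : AERegular 5 f) (hg : AERegular 5 g) :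
    radialOpCube l (c • f + g) =ᵐ[halfLine] c • radialOpCube l f + radialOpCube l g := by
  have hf1 : AERegular 3 (radialOp l f) := hf.radialOp
  have hg1 : AERegular 3 (radialOp l g) := hg.radialOp
  have hf2 : AERegular 1 (radialOp l (radialOp l f)) := hf1.radialOp
  have hg2 : AERegular 1 (radialOp l (radialOp l g)) := hg1.radialOp
  have e1 := radialOp_lin_eqOn (l := l) (n := 3) c hf hg
  have e2 := (radialOp_congr (l := l) e1).trans (radialOp_lin_eqOn (l := l) (n := 1) c hf1 hg1)
  have e3 := radialOp_congr (l := l) e2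
  have hf3 := hf2.2
  have hg3 := hg2.2
  rw [iteratedDeriv_one] at hf3 hg3
  filter_upwards [hf3, hg3, ae_restrict_mem measurableSet_Ioi] with r hr kr hr0
  refine (e3 hr0).trans (radialOp_lin_apply c ?_ ?_ hr kr)
  · filter_upwards [Ioi_mem_nhds hr0] with s hs using hf2.differentiableAt hs
  · filter_upwards [Ioi_mem_nhds hr0] with s hs using hg2.differentiableAt hs

lemma intervalIntegrable_of_memLp_halfLine {h : ℝ → ℂ} (hh : MemLp h 2 halfLine) {r : ℝ}
    (hr : 0 ≤ r) : IntervalIntegrable h volume 0 r := by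
  rw [intervalIntegrable_iff_integrableOn_Ioc_of_le hr]
  have h1 : MemLp h 2 (volume.restrict (Ioc 0 r)) :=
    hh.mono_measure (Measure.restrict_mono (fun x hx => hx.1) le_rfl)
  exact h1.integrable (by norm_num)

lemma IsSobolevSix.aeRegular {f : ℝ → ℂ} (hf : IsSobolevSix f) : AERegular 5 f := by
  refine ⟨hf.contDiffOn.mono Ioi_subset_Ici_self, ?_⟩
  obtain ⟨h, hh, hint⟩ := hf.exists_sixth
  have key : ∀ n : ℕ, ∀ᵐ r : ℝ, r ∈ Ioo (0 : ℝ) n → DifferentiableAt ℝ (iteratedDeriv 5 f) r := by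
    intro n
    have h1 := (intervalIntegrable_of_memLp_halfLine hh (Nat.cast_nonneg n)).ae_hasDerivAt_integral
    filter_upwards [h1] with r hr hrn
    have hu : r ∈ uIcc (0 : ℝ) n := by
      rw [uIcc_of_le (Nat.cast_nonneg n)]; exact Ioo_subset_Icc_self hrn
    have h2 := hr hu 0 (by simp)
    have h3 : iteratedDeriv 5 f =ᶠ[𝓝 r]
        fun s => iteratedDerivWithin 5 f (Ici 0) 0 + ∫ t in (0 : ℝ)..s, h t := by
      filter_upwards [Ioi_mem_nhds hrn.1] with s hs
      rw [← hint s hs.le, iteratedDerivWithin_eq_iteratedDeriv (uniqueDiffOn_Ici 0)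
        (hf.contDiffOn.contDiffAt (Ici_mem_nhds hs)) (mem_Ici.2 (le_of_lt hs))]
    exact (h2.differentiableAt.const_add _).congr_of_eventuallyEq h3
  have key2 := ae_all_iff.2 key
  filter_upwards [ae_restrict_of_ae key2, ae_restrict_mem measurableSet_Ioi] with r hr hr0
  obtain ⟨n, hn⟩ := exists_nat_gt r
  exact hr n ⟨hr0, hn⟩

lemma IsSobolevSix.zero : IsSobolevSix 0 := by
  refine ⟨MemLp.zero, contDiffOn_const, 0, MemLp.zero, fun r _ => ?_⟩
  have (x : ℝ) : iteratedDerivWithin 5 (0 : ℝ → ℂ) (Ici 0) x = 0 :=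
    iteratedDerivWithin_const_zero
  simp [this]

lemma iteratedDerivWithin_lin {f g : ℝ → ℂ} (hf : IsSobolevSix f) (hg : IsSobolevSix g) (c : ℂ)
    {j : ℕ} (hj : j ≤ 5) {r : ℝ} (hr : 0 ≤ r) :
    iteratedDerivWithin j (c • f + g) (Ici 0) r =
      c * iteratedDerivWithin j f (Ici 0) r + iteratedDerivWithin j g (Ici 0) r := by
  have hj' : ((j : ℕ) : WithTop ℕ∞) ≤ 5 := by exact_mod_cast hj
  have a := (hf.contDiffOn.of_le hj').contDiffWithinAt (mem_Ici.2 hr)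
  have b := (hg.contDiffOn.of_le hj').contDiffWithinAt (mem_Ici.2 hr)
  have a' : ContDiffWithinAt ℝ j (c • f) (Ici 0) r := a.const_smul c
  rw [iteratedDerivWithin_add (mem_Ici.2 hr) (uniqueDiffOn_Ici 0) a' b,
    iteratedDerivWithin_const_smul (mem_Ici.2 hr) (uniqueDiffOn_Ici 0) c a, smul_eq_mul]

lemma IsSobolevSix.lin {f g : ℝ → ℂ} (hf : IsSobolevSix f) (hg : IsSobolevSix g) (c : ℂ) :
    IsSobolevSix (c • f + g) := by
  obtain ⟨h, hh, hint⟩ := hf.exists_sixth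
  obtain ⟨k, hk, kint⟩ := hg.exists_sixth
  refine ⟨(hf.memLp.const_smul c).add hg.memLp, (contDiffOn_const.smul hf.contDiffOn).add
    hg.contDiffOn, c • h + k, (hh.const_smul c).add hk, fun r hr => ?_⟩
  have i1 := intervalIntegrable_of_memLp_halfLine hh hr
  have i2 := intervalIntegrable_of_memLp_halfLine hk hr
  rw [iteratedDerivWithin_lin hf hg c le_rfl hr, iteratedDerivWithin_lin hf hg c le_rfl le_rfl,
    hint r hr, kint r hr]
  simp only [Pi.add_apply, Pi.smul_apply]
  have i1' : IntervalIntegrable (fun s => c • h s) volume 0 r := i1.smul c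
  rw [intervalIntegral.integral_add i1' i2, intervalIntegral.integral_smul, smul_eq_mul]
  ring

lemma boundaryJet_lin {f g : ℝ → ℂ} (hf : IsSobolevSix f) (hg : IsSobolevSix g) (c : ℂ) :
    boundaryJet (c • f + g) = c • boundaryJet f + boundaryJet g := by
  ext j
  exact iteratedDerivWithin_lin hf hg c (by omega) le_rfl

lemma boundaryJet_zero : boundaryJet 0 = 0 := by
  ext j
  exact iteratedDerivWithin_const_zero

end Helpers

/-- The set of pairs `(u, T_l³ u)`, where `u ∈ H⁶(0, ∞)` satisfies the boundary conditions at the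
origin and `T_l³ u` is square integrable. -/
def IsRadialPair (l ξ : ℕ) (κ : ℝ) (u v : HalfLineL2) : Prop :=
  ∃ f : ℝ → ℂ, IsSobolevSix f ∧ boundaryJet f ∈ boundarySpace l ξ κ ∧
    u =ᵐ[halfLine] f ∧ v =ᵐ[halfLine] radialOpCube l f

lemma IsRadialPair.lin {l ξ : ℕ} {κ : ℝ} {u v u' v' : HalfLineL2} (c : ℂ)
    (h : IsRadialPair l ξ κ u v) (h' : IsRadialPair l ξ κ u' v') :
    IsRadialPair l ξ κ (c • u + u') (c • v + v') := by
  obtain ⟨f, hf, bf, uf, vf⟩ := h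
  obtain ⟨g, hg, bg, ug, vg⟩ := h'
  refine ⟨c • f + g, hf.lin hg c, ?_, ?_, ?_⟩
  · rw [boundaryJet_lin hf hg]
    exact Submodule.add_mem _ (Submodule.smul_mem _ c bf) bg
  · filter_upwards [Lp.coeFn_add (c • u) u', Lp.coeFn_smul c u, uf, ug] with r h1 h2 h3 h4
    rw [h1, Pi.add_apply, h2, Pi.smul_apply, h3, h4]
    rfl
  · filter_upwards [Lp.coeFn_add (c • v) v', Lp.coeFn_smul c v, vf, vg,
      radialOpCube_lin (l := l) c hf.aeRegular hg.aeRegular] with r h1 h2 h3 h4 h5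
    rw [h1, Pi.add_apply, h2, Pi.smul_apply, h3, h4, h5]
    rfl

lemma IsRadialPair.zero (l ξ : ℕ) (κ : ℝ) : IsRadialPair l ξ κ 0 0 := by
  refine ⟨0, IsSobolevSix.zero, ?_, Lp.coeFn_zero _ _ _, ?_⟩
  · rw [boundaryJet_zero]; exact Submodule.zero_mem _
  · rw [radialOpCube_zero]; exact Lp.coeFn_zero _ _ _

/-- The graph of the operator `T_{lξκ}³` in `L²(0, ∞)`. -/
def radialGraph (l ξ : ℕ) (κ : ℝ) : Submodule ℂ (HalfLineL2 × HalfLineL2) where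
  carrier := {p | IsRadialPair l ξ κ p.1 p.2}
  zero_mem' := IsRadialPair.zero l ξ κ
  add_mem' := by
    intro a b ha hb
    simpa using IsRadialPair.lin 1 ha hb
  smul_mem' := by
    intro c a ha
    simpa using IsRadialPair.lin c ha (IsRadialPair.zero l ξ κ)

/-- The operator `T_{lξκ}³`: it has the graph `radialGraph l ξ κ`, see
`radialCubeOperator_graph`. -/
def radialCubeOperator (l ξ : ℕ) (κ : ℝ) : HalfLineL2 →ₗ.[ℂ] HalfLineL2 :=
  (radialGraph l ξ κ).toLinearPMap

lemma radialGraph_functional (l ξ : ℕ) (κ : ℝ) (p : HalfLineL2 × HalfLineL2)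
    (hp : p ∈ radialGraph l ξ κ) (h0 : p.1 = 0) : p.2 = 0 := by
  obtain ⟨f, hf, -, uf, vf⟩ := hp
  rw [h0] at uf
  have h1 : f =ᵐ[halfLine] 0 := uf.symm.trans (Lp.coeFn_zero _ _ _)
  have h2 : EqOn f 0 (Ioi 0) :=
    Measure.eqOn_open_of_ae_eq h1 isOpen_Ioi
      (hf.contDiffOn.continuousOn.mono Ioi_subset_Ici_self) continuousOn_const
  have h3 := radialOpCube_congr (l := l) h2
  rw [radialOpCube_zero] at h3
  refine Lp.ext ?_
  filter_upwards [vf, Lp.coeFn_zero ℂ 2 halfLine, ae_restrict_mem measurableSet_Ioi]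
    with r a b c
  rw [a, b, h3 c]

lemma radialCubeOperator_graph (l ξ : ℕ) (κ : ℝ) :
    (radialCubeOperator l ξ κ).graph = radialGraph l ξ κ :=
  Submodule.toLinearPMap_graph_eq _ (radialGraph_functional l ξ κ)

/-- The operator `A + c`, with the domain of `A`. -/
def shiftOperator {H : Type*} [AddCommGroup H] [Module ℂ H] (A : H →ₗ.[ℂ] H) (c : ℂ) :
    H →ₗ.[ℂ] H where
  domain := A.domain
  toFun := A.toFun + c • A.domain.subtype

/-- A densely defined, symmetric operator whose closure is self-adjoint. -/
structure IsEssentiallySelfAdjoint {H : Type*} [NormedAddCommGroup H] [InnerProductSpace ℂ H]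
    [CompleteSpace H] (A : H →ₗ.[ℂ] H) : Prop where
  dense_domain : Dense (A.domain : Set H)
  symmetric : ∀ x y : A.domain, inner ℂ (A x) (y : H) = inner ℂ (x : H) (A y)
  closable : A.IsClosable
  selfAdjoint_closure : IsSelfAdjoint A.closure

/-- The differential operation `D_l w(r) = r^{l+1} ((1/r) d/dr)^l (w/r)`. -/
def besselD (l : ℕ) (w : ℝ → ℂ) : ℝ → ℂ :=
  fun r => (r : ℂ) ^ (l + 1) *
    ((fun (f : ℝ → ℂ) (t : ℝ) => (1 / (t : ℂ)) * deriv f t)^[l] (fun t => w t / (t : ℂ))) r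

/-- The unimodular number `e^{iθ}`. -/
def phase (θ : ℝ) : ℂ := Complex.exp (Complex.I * (θ : ℂ))

/-- The function `D_l (a e^{e^{∓3πi/4} ρ r} + b e^{-e^{∓πi/12} ρ r} + c e^{-e^{∓5πi/12} ρ r})`,
where the upper sign is `σ = 1` and the lower sign is `σ = -1`. -/
def deficiencyCombination (l : ℕ) (σ ρ : ℝ) (a b c : ℂ) : ℝ → ℂ :=
  besselD l fun r =>
    a * Complex.exp (phase (-σ * (3 * Real.pi / 4)) * ρ * r) +
    b * Complex.exp (-phase (-σ * (Real.pi / 12)) * ρ * r) +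
    c * Complex.exp (-phase (-σ * (5 * Real.pi / 12)) * ρ * r)

/-- The function `q¹_{l±}`. -/
def deficiencyOne (l : ℕ) (σ ρ : ℝ) : ℝ → ℂ :=
  deficiencyCombination l σ ρ 1 (phase (-σ * (2 * Real.pi / 3))) (phase (σ * (2 * Real.pi / 3)))

/-- The function `q²_{l±}`. -/
def deficiencyTwo (l : ℕ) (σ ρ : ℝ) : ℝ → ℂ :=
  deficiencyCombination l σ ρ (phase (-σ * (5 * Real.pi / 6))) (Real.sqrt 3 : ℂ)
    (phase (σ * (5 * Real.pi / 6)))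

end

/-! Write T for the differential operation `radialOp l`, A for the operator, c for a non-real number
of the form ±iρ⁶. Everything reduces to two facts: A is symmetric, and the range of A + c has
trivial orthogonal complement. The basic criterion (with c = ±i) then gives essential
self-adjointness, and the complement of the range is the kernel of the adjoint of A + c, so that
kernel is zero for every ρ. A combination of q¹ and q² in the kernel would vanish almost everywhere,
which their linear independence forbids.

Symmetry is Green's formula. A bilinear boundary form `cubeForm` has derivative (T³f)g − f(T³g)
almost everywhere. It tends to zero at infinity because the derivatives of an H⁶ function do
(`IsSobolevSix.tendsto_atTop`). At the origin its coefficients are singular, up to r⁻⁵, but it may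
be evaluated on Taylor polynomials (`tendsto_cubeForm_zero`), and the boundary conditions remove
every term of order at most 0 (`tendsto_cubeForm_of_boundarySpace`).

Density of the range uses the intertwining operator D = `darboux l`, for which T D = D(−d²/dr²). To
solve (T³ + c)f = Dg with g a test function, put f = Dw, where −w⁽⁶⁾ + cw = g. Then w is a Duhamel
integral plus a combination of six exponentials. Its six coefficients are subject to six linear
equations: one for smoothness of Dw at 0, two boundary conditions, three for decay at infinity. The
homogeneous system has only the trivial solution, since any solution gives an element f of the
domain with A f = −c f, and A is symmetric while c is not real
(`IsSixthRoots.boundaryMap_injective`). Hence the system is solvable and the range contains every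
Dg.

Finally, T³g = Dg₀ for every test function g, with g₀ again a test function. A vector y orthogonal
to the range is therefore orthogonal to T³g and to T³g + cg, hence to g, and so y = 0. -/

noncomputable section

/-! ### The basic criterion for essential self-adjointness. -/

section Abstract

variable {H : Type*} [NormedAddCommGroup H] [InnerProductSpace ℂ H]

lemma im_inner_symmetric {A : H →ₗ.[ℂ] H}
    (hs : ∀ x y : A.domain, inner ℂ (A x) (y : H) = inner ℂ (x : H) (A y)) (x : A.domain) :
    (inner ℂ (x : H) (A x)).im = 0 := by
  have h := hs x x
  rw [← inner_conj_symm] at h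
  exact Complex.conj_eq_iff_im.1 h

/-- The lower bound `|Im c| ‖x‖ ≤ ‖(A + c) x‖` for a symmetric operator `A`. -/
lemma abs_im_mul_norm_le_of_symmetric {A : H →ₗ.[ℂ] H}
    (hs : ∀ x y : A.domain, inner ℂ (A x) (y : H) = inner ℂ (x : H) (A y)) (c : ℂ) (x : A.domain) :
    |c.im| * ‖(x : H)‖ ≤ ‖A x + c • (x : H)‖ := by
  by_cases hx : ‖(x : H)‖ = 0
  · rw [hx, mul_zero]; exact norm_nonneg _
  have h1 : (inner ℂ (x : H) (A x + c • (x : H))).im = c.im * ‖(x : H)‖ ^ 2 := by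
    rw [inner_add_right, inner_smul_right, inner_self_eq_norm_sq_to_K, Complex.add_im,
      im_inner_symmetric hs x, zero_add]
    simp [← Complex.ofReal_pow]
  have h2 : |c.im| * ‖(x : H)‖ ^ 2 ≤ ‖(x : H)‖ * ‖A x + c • (x : H)‖ := by
    have h3 : |(inner ℂ (x : H) (A x + c • (x : H))).im| = |c.im| * ‖(x : H)‖ ^ 2 := by
      rw [h1, abs_mul, abs_of_nonneg (sq_nonneg ‖(x : H)‖)]
    rw [← h3]
    exact (Complex.abs_im_le_norm _).trans (norm_inner_le_norm _ _)
  have h4 : 0 < ‖(x : H)‖ := lt_of_le_of_ne (norm_nonneg _) (Ne.symm hx)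
  refine le_of_mul_le_mul_left ?_ h4
  linarith [h2, sq ‖(x : H)‖, mul_left_comm ‖(x : H)‖ |c.im| ‖(x : H)‖]

variable [CompleteSpace H]

lemma inner_shift_eq_zero {A : H →ₗ.[ℂ] H} (hd : Dense (A.domain : Set H)) (c : ℂ)
    (y : (shiftOperator A c).adjoint.domain) (hy : (shiftOperator A c).adjoint y = 0)
    (x : A.domain) : inner ℂ (y : H) (A x + c • (x : H)) = 0 := by
  have h := LinearPMap.adjoint_isFormalAdjoint (T := shiftOperator A c) hd y x
  rw [hy, inner_zero_left] at h
  exact h.symm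

/-- A bounded-below shift of `A` whose range has trivial orthogonal complement maps the closure of
the graph onto the whole space. -/
lemma exists_mem_closure_graph {A : H →ₗ.[ℂ] H}
    (hs : ∀ x y : A.domain, inner ℂ (A x) (y : H) = inner ℂ (x : H) (A y)) {c : ℂ} (hc : c.im ≠ 0)
    (hr : ∀ y : H, (∀ x : A.domain, inner ℂ y (A x + c • (x : H)) = 0) → y = 0) (z : H) :
    ∃ x : H, (x, z - c • x) ∈ A.graph.topologicalClosure := by
  let L : A.domain →ₗ[ℂ] H := A.toFun + c • A.domain.subtype
  have hL : ∀ x : A.domain, L x = A x + c • (x : H) := fun x => rfl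
  have hdense : (LinearMap.range L).topologicalClosure = ⊤ := by
    rw [Submodule.topologicalClosure_eq_top_iff, Submodule.eq_bot_iff]
    intro y hy
    refine hr y fun x => ?_
    rw [Submodule.mem_orthogonal'] at hy
    exact hy _ ⟨x, rfl⟩
  have hz : z ∈ closure (LinearMap.range L : Set H) := by
    rw [← Submodule.topologicalClosure_coe, hdense]; trivial
  obtain ⟨s, hs1, hs2⟩ := mem_closure_iff_seq_limit.1 hz
  choose u hu using hs1
  -- The lower bound |Im c| ‖x‖ ≤ ‖(A + c)x‖ turns convergence of the images into a Cauchy condition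
  -- on the preimages.
  have hcau : CauchySeq fun n => (u n : H) := by
    have h1 := hs2.cauchySeq
    rw [Metric.cauchySeq_iff'] at h1 ⊢
    intro ε hε
    obtain ⟨N, hN⟩ := h1 (|c.im| * ε) (mul_pos (abs_pos.2 hc) hε)
    refine ⟨N, fun n hn => ?_⟩
    have h2 := hN n hn
    rw [dist_eq_norm, ← hu, ← hu, ← map_sub, hL] at h2
    have h3 := (abs_im_mul_norm_le_of_symmetric hs c (u n - u N)).trans_lt h2
    rw [dist_eq_norm]
    exact lt_of_mul_lt_mul_left h3 (abs_nonneg _)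
  obtain ⟨x, hx⟩ := cauchySeq_tendsto_of_complete hcau
  refine ⟨x, ?_⟩
  have h1 : Tendsto (fun n => ((u n : H), A (u n))) atTop (𝓝 (x, z - c • x)) := by
    refine hx.prodMk_nhds ?_
    have h2 : (fun n => A (u n)) = fun n => s n - c • (u n : H) := by
      funext n
      rw [← hu, hL]; simp
    rw [h2]
    exact hs2.sub (hx.const_smul c)
  exact mem_closure_of_tendsto h1 (Eventually.of_forall fun n => A.mem_graph (u n))

/-- The basic criterion for essential self-adjointness. -/
theorem isEssentiallySelfAdjoint_of_range {A : H →ₗ.[ℂ] H} (hd : Dense (A.domain : Set H))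
    (hs : ∀ x y : A.domain, inner ℂ (A x) (y : H) = inner ℂ (x : H) (A y))
    (hp : ∀ y : H, (∀ x : A.domain, inner ℂ y (A x + Complex.I • (x : H)) = 0) → y = 0)
    (hm : ∀ y : H, (∀ x : A.domain, inner ℂ y (A x + (-Complex.I) • (x : H)) = 0) → y = 0) :
    IsEssentiallySelfAdjoint A := by
  have hfa : A.IsFormalAdjoint A := hs
  have hle : A ≤ A.adjoint := hfa.le_adjoint hd
  have hcl : A.adjoint.IsClosed := LinearPMap.adjoint_isClosed hd
  have hclosable : A.IsClosable := hcl.isClosable.leIsClosable hle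
  have hgraph := hclosable.graph_closure_eq_closure_graph
  have hle' : A.closure ≤ A.adjoint := by
    refine LinearPMap.le_of_le_graph ?_
    rw [← hgraph]
    exact Submodule.topologicalClosure_minimal _ (LinearPMap.le_graph_of_le hle) hcl
  have hge : A.adjoint ≤ A.closure := by
    refine LinearPMap.le_of_le_graph ?_
    rintro ⟨y, y'⟩ hy
    obtain ⟨x, hx⟩ := exists_mem_closure_graph hs (c := Complex.I) (by simp) hp
      (y' + Complex.I • y)
    have hx' : (x, y' + Complex.I • y - Complex.I • x) ∈ A.adjoint.graph := by
      refine LinearPMap.le_graph_of_le hle' ?_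
      rwa [← hgraph]
    have hdiff := Submodule.sub_mem _ hy hx'
    -- The difference satisfies A*(y − x) = −i(y − x), so it is orthogonal to the range of A − i.
    have hzero : y - x = 0 := by
      refine hm _ fun v => ?_
      rw [LinearPMap.adjoint_graph_eq_graph_adjoint hd, Submodule.mem_adjoint_iff] at hdiff
      have h1 := hdiff v (A v) (A.mem_graph v)
      simp only [Prod.fst_sub, Prod.snd_sub] at h1
      have h2 : y' - (y' + Complex.I • y - Complex.I • x) = -(Complex.I • (y - x)) := by
        rw [smul_sub]; abel
      rw [h2, inner_neg_right, inner_smul_right, sub_neg_eq_add] at h1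
      have h3 := congrArg (starRingEnd ℂ) h1
      rw [map_add, map_mul, inner_conj_symm, inner_conj_symm, Complex.conj_I, map_zero] at h3
      rw [inner_add_right, inner_smul_right]
      exact h3
    obtain rfl := sub_eq_zero.1 hzero
    rw [← hgraph]
    simpa using hx
  have heq : A.closure = A.adjoint := le_antisymm hle' hge
  refine ⟨hd, hs, hclosable, ?_⟩
  rw [LinearPMap.isSelfAdjoint_def]
  have hdc : Dense (A.closure.domain : Set H) := hd.mono A.le_closure.1
  refine le_antisymm ?_ ?_
  -- Taking adjoints reverses inclusion, so the adjoint of the closure lies below A*, which is the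
  -- closure.
  · refine le_trans ?_ hge
    have hf : A.IsFormalAdjoint A.closure.adjoint := by
      intro x y
      have hx : (x : H) ∈ A.closure.domain := A.le_closure.1 x.2
      have h1 := (LinearPMap.adjoint_isFormalAdjoint hdc).symm ⟨x, hx⟩ y
      rwa [show A.closure ⟨x, hx⟩ = A x from (A.le_closure.2 rfl).symm] at h1
    exact hf.le_adjoint hd
  · have hf : A.closure.IsFormalAdjoint A.closure := by
      intro x y
      -- Symmetry is a closed condition in each variable, so it extends from the graph to its
      -- closure one variable at a time.
      have key : ∀ p ∈ A.graph.topologicalClosure, ∀ q ∈ A.graph.topologicalClosure,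
          inner ℂ p.2 q.1 = inner ℂ p.1 q.2 := by
        have k1 : ∀ p ∈ A.graph.topologicalClosure, ∀ q ∈ A.graph,
            inner ℂ p.2 q.1 = inner ℂ p.1 q.2 := by
          intro p hp q hq
          have hcl1 : IsClosed {p : H × H | inner ℂ p.2 q.1 = inner ℂ p.1 q.2} :=
            isClosed_eq (by fun_prop) (by fun_prop)
          refine closure_minimal ?_ hcl1 hp
          intro p hp
          obtain ⟨u, hu1, hu2⟩ := (LinearPMap.mem_graph_iff A).1 hp
          obtain ⟨v, hv1, hv2⟩ := (LinearPMap.mem_graph_iff A).1 hq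
          change inner ℂ p.2 q.1 = inner ℂ p.1 q.2
          rw [← hu1, ← hu2, ← hv1, ← hv2, hs]
        intro p hp q hq
        have hcl1 : IsClosed {q : H × H | inner ℂ p.2 q.1 = inner ℂ p.1 q.2} :=
          isClosed_eq (by fun_prop) (by fun_prop)
        exact closure_minimal (fun q hq => k1 p hp q hq) hcl1 hq
      have hx := A.closure.mem_graph x
      have hy := A.closure.mem_graph y
      rw [← hgraph] at hx hy
      exact key _ hx _ hy
    exact hf.le_adjoint hdc

end Abstract

/-! ### Absolutely continuous complex functions and the fundamental theorem of calculus. -/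

section AbsolutelyContinuous

lemma AbsolutelyContinuousOnInterval.congr_eqOn {X : Type*} [PseudoMetricSpace X] {f g : ℝ → X}
    {a b : ℝ} (hf : AbsolutelyContinuousOnInterval f a b) (h : EqOn f g (uIcc a b)) :
    AbsolutelyContinuousOnInterval g a b := by
  rw [absolutelyContinuousOnInterval_iff] at hf ⊢
  intro ε hε
  obtain ⟨δ, hδ, H⟩ := hf ε hε
  refine ⟨δ, hδ, fun E hE hs => ?_⟩
  refine lt_of_eq_of_lt (Finset.sum_congr rfl fun i hi => ?_) (H E hE hs)
  have h1 := hE.1 i hi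
  rw [h h1.1, h h1.2]

lemma absolutelyContinuousOnInterval_primitive {h : ℝ → ℂ} {a b : ℝ}
    (hh : IntervalIntegrable h volume a b) :
    AbsolutelyContinuousOnInterval (fun x => ∫ s in a..x, h s) a b := by
  have hre : IntervalIntegrable (fun s => (h s).re) volume a b :=
    ⟨hh.1.re, hh.2.re⟩
  have him : IntervalIntegrable (fun s => (h s).im) volume a b :=
    ⟨hh.1.im, hh.2.im⟩
  have a1 := hre.absolutelyContinuousOnInterval_intervalIntegral (c := a) (by simp)
  have a2 := him.absolutelyContinuousOnInterval_intervalIntegral (c := a) (by simp)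
  have hc : ∀ z : ℂ, AbsolutelyContinuousOnInterval (fun _ : ℝ => z) a b := fun z =>
    (contDiffOn_const (c := z)).absolutelyContinuousOnInterval
  have a3 := (a1.smul (hc 1)).add (a2.smul (hc Complex.I))
  have key : EqOn ((fun x => ∫ s in a..x, (h s).re) • (fun _ : ℝ => (1 : ℂ)) +
      (fun x => ∫ s in a..x, (h s).im) • (fun _ : ℝ => Complex.I))
      (fun x => ∫ s in a..x, h s) (uIcc a b) := by
    intro x hx
    have hi : IntervalIntegrable h volume a x :=
      hh.mono_set (uIcc_subset_uIcc left_mem_uIcc hx)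
    have e1 := Complex.reCLM.intervalIntegral_comp_comm hi
    have e2 := Complex.imCLM.intervalIntegral_comp_comm hi
    simp only [Complex.reCLM_apply, Complex.imCLM_apply] at e1 e2
    simp only [Pi.add_apply, Pi.smul_apply', e1, e2]
    simp [Complex.re_add_im]
  exact a3.congr_eqOn key

/-- The fundamental theorem of calculus for absolutely continuous complex functions. -/
lemma integral_eq_sub_of_absolutelyContinuous {F f : ℝ → ℂ} {a b : ℝ} (hab : a ≤ b)
    (hF : AbsolutelyContinuousOnInterval F a b)
    (hd : ∀ᵐ x, x ∈ Icc a b → HasDerivAt F (f x) x) (hf : IntervalIntegrable f volume a b) :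
    ∫ x in a..b, f x = F b - F a := by
  -- F minus the primitive of f is absolutely continuous with derivative zero almost everywhere,
  -- hence constant.
  have hac := hF.sub (absolutelyContinuousOnInterval_primitive hf)
  obtain ⟨C, hC⟩ := hac.const_of_ae_hasDerivAt_zero (by
    filter_upwards [hd, hf.ae_hasDerivAt_integral] with x h1 h2 hx
    have h3 := (h1 (by rwa [uIcc_of_le hab] at hx)).sub (h2 hx a left_mem_uIcc)
    simpa using h3)
  have e1 := hC a left_mem_uIcc
  have e2 := hC b right_mem_uIcc
  simp only [Pi.sub_apply, intervalIntegral.integral_same, sub_zero] at e1 e2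
  rw [e1, ← e2]
  ring

end AbsolutelyContinuous

/-! ### Taylor expansion at the origin and decay at infinity of H⁶ functions. -/

section Sobolev

lemma IsSobolevSix.hasDerivWithinAt {f : ℝ → ℂ} (hf : IsSobolevSix f) {j : ℕ} (hj : j < 5) {r : ℝ}
    (hr : 0 ≤ r) : HasDerivWithinAt (iteratedDerivWithin j f (Ici 0))
      (iteratedDerivWithin (j + 1) f (Ici 0) r) (Ici 0) r := by
  have h := hf.contDiffOn.differentiableOn_iteratedDerivWithin (m := j) (by exact_mod_cast hj)
    (uniqueDiffOn_Ici 0) r hr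
  rw [iteratedDerivWithin_succ]
  exact h.hasDerivWithinAt

lemma IsSobolevSix.hasDerivAt {f : ℝ → ℂ} (hf : IsSobolevSix f) {j : ℕ} (hj : j < 5) {r : ℝ}
    (hr : 0 < r) : HasDerivAt (iteratedDerivWithin j f (Ici 0))
      (iteratedDerivWithin (j + 1) f (Ici 0) r) r :=
  (hf.hasDerivWithinAt hj hr.le).hasDerivAt (Ici_mem_nhds hr)

lemma IsSobolevSix.continuousOn {f : ℝ → ℂ} (hf : IsSobolevSix f) {j : ℕ} (hj : j ≤ 5) :
    ContinuousOn (iteratedDerivWithin j f (Ici 0)) (Ici 0) :=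
  hf.contDiffOn.continuousOn_iteratedDerivWithin (by exact_mod_cast hj) (uniqueDiffOn_Ici 0)

/-- The polynomial `∑_{i < n} c_i t^i / i!`. -/
def jetPoly (c : ℕ → ℂ) (n : ℕ) (t : ℝ) : ℂ :=
  ∑ i ∈ Finset.range n, c i * (t : ℂ) ^ i / (i.factorial : ℂ)

lemma jetPoly_zero_arg (c : ℕ → ℂ) (n : ℕ) : jetPoly c (n + 1) 0 = c 0 := by
  rw [jetPoly, Finset.sum_range_succ']
  simp

lemma hasDerivAt_jetPoly (c : ℕ → ℂ) (n : ℕ) (t : ℝ) :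
    HasDerivAt (jetPoly c (n + 1)) (jetPoly (fun i => c (i + 1)) n t) t := by
  have h : ∀ i ∈ Finset.range (n + 1),
      HasDerivAt (fun t : ℝ => c i * (t : ℂ) ^ i / (i.factorial : ℂ))
        (c i * ((i : ℂ) * (t : ℂ) ^ (i - 1)) / (i.factorial : ℂ)) t := by
    intro i _
    have h1 : HasDerivAt (fun t : ℝ => (t : ℂ) ^ i) ((i : ℂ) * (t : ℂ) ^ (i - 1)) t :=
      (hasDerivAt_pow i (t : ℂ)).comp_ofReal
    exact (h1.const_mul (c i)).div_const _
  have h2 := HasDerivAt.fun_sum h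
  refine h2.congr_deriv ?_
  rw [Finset.sum_range_succ', jetPoly]
  simp only [Nat.cast_zero, zero_mul, mul_zero, zero_div, add_zero, Nat.add_sub_cancel]
  refine Finset.sum_congr rfl fun i _ => ?_
  have h3 : ((i.factorial : ℕ) : ℂ) ≠ 0 := by exact_mod_cast i.factorial_ne_zero
  have h4 : ((i + 1 : ℕ) : ℂ) ≠ 0 := by exact_mod_cast i.succ_ne_zero
  rw [Nat.factorial_succ, Nat.cast_mul]
  field_simp

open Asymptotics in
-- The mean value inequality on [0, r] gains one power of r. This is the induction step for the
-- Taylor expansion, which descends from the fifth derivative.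
lemma isLittleO_pow_succ {e e' : ℝ → ℂ} {n : ℕ} (h0 : e 0 = 0)
    (hd : ∀ r, 0 ≤ r → HasDerivWithinAt e (e' r) (Ici 0) r)
    (h : e' =o[𝓝[≥] 0] fun r : ℝ => r ^ n) : e =o[𝓝[≥] 0] fun r : ℝ => r ^ (n + 1) := by
  rw [isLittleO_iff] at h ⊢
  intro ε hε
  have h1 := h hε
  obtain ⟨δ, hδ, H⟩ := (mem_nhdsGE_iff_exists_Ico_subset).1 h1
  refine mem_nhdsGE_iff_exists_Ico_subset.2 ⟨δ, hδ, fun r hr => ?_⟩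
  have h2 := Convex.norm_image_sub_le_of_norm_hasDerivWithin_le (f := e) (f' := e')
    (s := Icc 0 r) (C := ε * r ^ n) (x := 0) (y := r)
    (fun x hx => (hd x hx.1).mono Icc_subset_Ici_self)
    (fun x hx => by
      have h3 : ‖e' x‖ ≤ ε * ‖x ^ n‖ := H ⟨hx.1, hx.2.trans_lt hr.2⟩
      rw [Real.norm_of_nonneg (pow_nonneg hx.1 n)] at h3
      exact h3.trans (mul_le_mul_of_nonneg_left (pow_le_pow_left₀ hx.1 hx.2 n) hε.le))
    (convex_Icc 0 r) ⟨le_rfl, hr.1⟩ ⟨hr.1, le_rfl⟩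
  rw [h0, sub_zero, sub_zero, Real.norm_of_nonneg hr.1] at h2
  change ‖e r‖ ≤ ε * ‖r ^ (n + 1)‖
  rw [Real.norm_of_nonneg (pow_nonneg hr.1 _), pow_succ, ← mul_assoc]
  exact h2

open Asymptotics in
/-- Taylor expansion at the origin of the derivatives of a Sobolev function. -/
lemma IsSobolevSix.taylor_zero {f : ℝ → ℂ} (hf : IsSobolevSix f) {n j : ℕ} (hn : n + j = 5) :
    (fun r => iteratedDerivWithin j f (Ici 0) r -
      jetPoly (fun i => iteratedDerivWithin (j + i) f (Ici 0) 0) (n + 1) r) =o[𝓝[≥] 0]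
        fun r : ℝ => r ^ n := by
  induction n generalizing j with
  | zero =>
    have hc := hf.continuousOn (j := j) (by omega) 0 (mem_Ici.2 le_rfl)
    simp only [pow_zero, isLittleO_one_iff]
    have h1 : ∀ r, jetPoly (fun i => iteratedDerivWithin (j + i) f (Ici 0) 0) (0 + 1) r =
        iteratedDerivWithin j f (Ici 0) 0 := by
      intro r; simp [jetPoly]
    simp only [h1]
    simpa using (hc.tendsto.sub_const (iteratedDerivWithin j f (Ici 0) 0))
  | succ n ih =>
    have h1 := ih (j := j + 1) (by omega)
    refine isLittleO_pow_succ ?_ (fun r hr => ?_) h1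
    · simp [jetPoly_zero_arg]
    · refine (hf.hasDerivWithinAt (by omega) hr).sub ?_
      have h2 := (hasDerivAt_jetPoly (fun i => iteratedDerivWithin (j + i) f (Ici 0) 0) (n + 1)
        r).hasDerivWithinAt (s := Ici 0)
      refine h2.congr_deriv ?_
      congr 1
      funext i
      congr 1
      omega

lemma tendsto_integral_unit_interval {φ : ℝ → ℝ} (h : IntegrableOn φ (Ioi 0)) :
    Tendsto (fun R => ∫ s in R..(R + 1), φ s) atTop (𝓝 0) := by
  have h1 := intervalIntegral_tendsto_integral_Ioi 0 h tendsto_id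
  have h2 := intervalIntegral_tendsto_integral_Ioi 0 h
    (tendsto_atTop_add_const_right atTop (1 : ℝ) tendsto_id)
  have h3 := h2.sub h1
  rw [sub_self] at h3
  refine h3.congr' ?_
  filter_upwards [eventually_ge_atTop (0 : ℝ)] with R hR
  have hi : ∀ x, 0 ≤ x → IntervalIntegrable φ volume 0 x := fun x hx => by
    rw [intervalIntegrable_iff_integrableOn_Ioc_of_le hx]
    exact h.mono_set Ioc_subset_Ioi_self
  exact intervalIntegral.integral_interval_sub_left (hi _ (by simp; linarith)) (hi _ hR)

lemma MemLp.tendsto_integral_norm {h : ℝ → ℂ} (hh : MemLp h 2 halfLine) :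
    Tendsto (fun R => ∫ s in R..(R + 1), ‖h s‖) atTop (𝓝 0) := by
  have h2 : IntegrableOn (fun s => ‖h s‖ ^ 2) (Ioi 0) :=
    (memLp_two_iff_integrable_sq_norm hh.1).1 hh
  have h3 := tendsto_integral_unit_interval h2
  have hi : ∀ R, 0 ≤ R → IntervalIntegrable h volume R (R + 1) := fun R hR =>
    (intervalIntegrable_of_memLp_halfLine hh hR).symm.trans
      (intervalIntegrable_of_memLp_halfLine hh (by linarith))
  rw [Metric.tendsto_atTop] at h3 ⊢
  intro ε hε
  obtain ⟨N, hN⟩ := h3 (ε / 4 * (ε / 4)) (by positivity)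
  refine ⟨max N 0, fun R hR => ?_⟩
  have hR0 : 0 ≤ R := (le_max_right _ _).trans hR
  have h4 := hN R ((le_max_left _ _).trans hR)
  have i2 : IntervalIntegrable (fun s => ‖h s‖ ^ 2) volume R (R + 1) := by
    rw [intervalIntegrable_iff_integrableOn_Ioc_of_le (by linarith)]
    exact h2.mono_set fun x hx => hR0.trans_lt hx.1
  -- On an interval of length one the L¹ norm is controlled by the L² norm; the elementary
  -- inequality t ≤ δ + t²/δ with δ = ε/4 replaces Cauchy–Schwarz.
  have h5 : ∫ s in R..(R + 1), ‖h s‖ ≤ ∫ s in R..(R + 1), (ε / 4 + (ε / 4)⁻¹ * ‖h s‖ ^ 2) := by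
    refine intervalIntegral.integral_mono_on (by linarith) (hi R hR0).norm
      (intervalIntegrable_const.add (i2.const_mul _)) fun x _ => ?_
    have h6 : 0 < ε / 4 := by positivity
    have h7 : ‖h x‖ * (ε / 4) ≤ (ε / 4) ^ 2 + ‖h x‖ ^ 2 := by
      nlinarith [sq_nonneg (‖h x‖ - ε / 4), sq_nonneg ‖h x‖, sq_nonneg (ε / 4)]
    have h8 : ε / 4 + (ε / 4)⁻¹ * ‖h x‖ ^ 2 = ((ε / 4) ^ 2 + ‖h x‖ ^ 2) / (ε / 4) := by
      field_simp
    rw [h8, le_div_iff₀ h6]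
    exact h7
  rw [intervalIntegral.integral_add intervalIntegrable_const (i2.const_mul _),
    intervalIntegral.integral_const_mul, intervalIntegral.integral_const] at h5
  rw [Real.dist_eq, sub_zero] at h4 ⊢
  have h9 := (abs_lt.1 h4).2
  have h10 : (ε / 4)⁻¹ * ∫ s in R..(R + 1), ‖h s‖ ^ 2 ≤ ε / 4 := by
    rw [inv_mul_le_iff₀ (by positivity)]
    exact h9.le
  rw [abs_of_nonneg (intervalIntegral.integral_nonneg (by linarith) fun x _ => norm_nonneg _)]
  simp only [add_sub_cancel_left, one_smul] at h5
  linarith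

/-- For the fifth derivative the remainder is an integral of h. Each further integration runs over a
length at most 1 and so does not enlarge the bound. -/
lemma IsSobolevSix.taylor_remainder {f h : ℝ → ℂ} (hf : IsSobolevSix f) (hh : MemLp h 2 halfLine)
    (hint : ∀ r : ℝ, 0 ≤ r → iteratedDerivWithin 5 f (Ici 0) r =
      iteratedDerivWithin 5 f (Ici 0) 0 + ∫ s in (0 : ℝ)..r, h s) {R : ℝ} (hR : 0 < R)
    {n j : ℕ} (hn : n + j = 5) {t : ℝ} (ht : t ∈ Icc (0 : ℝ) 1) :
    ‖iteratedDerivWithin j f (Ici 0) (R + t) -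
      jetPoly (fun i => iteratedDerivWithin (j + i) f (Ici 0) R) (n + 1) t‖ ≤
        ∫ s in R..(R + 1), ‖h s‖ := by
  have hi : ∀ x, 0 ≤ x → IntervalIntegrable h volume 0 x := fun x hx =>
    intervalIntegrable_of_memLp_halfLine hh hx
  induction n generalizing j t with
  | zero =>
    obtain rfl : j = 5 := by omega
    have h1 : jetPoly (fun i => iteratedDerivWithin (5 + i) f (Ici 0) R) (0 + 1) t =
        iteratedDerivWithin 5 f (Ici 0) R := by simp [jetPoly]
    have hRt : 0 ≤ R + t := by linarith [ht.1]
    rw [h1, hint _ hRt, hint _ hR.le, add_sub_add_left_eq_sub,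
      intervalIntegral.integral_interval_sub_left (hi _ hRt) (hi _ hR.le)]
    have h2 : ∀ u v, 0 ≤ u → 0 ≤ v → IntervalIntegrable (fun s => ‖h s‖) volume u v :=
      fun u v hu hv => ((hi u hu).symm.trans (hi v hv)).norm
    refine (intervalIntegral.norm_integral_le_integral_norm (by linarith [ht.1])).trans ?_
    have h3 := intervalIntegral.integral_add_adjacent_intervals (h2 R (R + t) hR.le hRt)
      (h2 (R + t) (R + 1) hRt (by linarith))
    have h4 : 0 ≤ ∫ s in (R + t)..(R + 1), ‖h s‖ :=
      intervalIntegral.integral_nonneg (by linarith [ht.2]) fun x _ => norm_nonneg _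
    linarith
  | succ n ih =>
    let e : ℝ → ℂ := fun t => iteratedDerivWithin j f (Ici 0) (R + t) -
      jetPoly (fun i => iteratedDerivWithin (j + i) f (Ici 0) R) (n + 1 + 1) t
    let e' : ℝ → ℂ := fun t => iteratedDerivWithin (j + 1) f (Ici 0) (R + t) -
      jetPoly (fun i => iteratedDerivWithin (j + 1 + i) f (Ici 0) R) (n + 1) t
    have hd : ∀ t ∈ Icc (0 : ℝ) 1, HasDerivWithinAt e (e' t) (Icc 0 1) t := by
      intro t ht
      have hRt : 0 < R + t := by linarith [ht.1]
      have d1 : HasDerivAt (fun t => iteratedDerivWithin j f (Ici 0) (R + t))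
          (iteratedDerivWithin (j + 1) f (Ici 0) (R + t)) t :=
        (hf.hasDerivAt (j := j) (by omega) hRt).comp_const_add R t
      have d2 := hasDerivAt_jetPoly (fun i => iteratedDerivWithin (j + i) f (Ici 0) R) (n + 1) t
      have d3 := d1.sub d2
      refine HasDerivAt.hasDerivWithinAt (d3.congr_deriv ?_)
      simp only [e']
      congr 2
      funext i
      congr 1
      omega
    have h0 : e 0 = 0 := by simp [e, jetPoly_zero_arg]
    have h2 := Convex.norm_image_sub_le_of_norm_hasDerivWithin_le hd
      (fun x hx => ih (j := j + 1) (by omega) hx) (convex_Icc 0 1) ⟨le_rfl, zero_le_one⟩ ht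
    rw [h0, sub_zero, sub_zero, Real.norm_of_nonneg ht.1] at h2
    refine h2.trans (mul_le_of_le_one_right ?_ ht.2)
    exact intervalIntegral.integral_nonneg (by linarith) fun x _ => norm_nonneg _

lemma integral_jetPoly_mul_pow (c : ℕ → ℂ) (m : ℕ) :
    ∫ t in (0 : ℝ)..1, jetPoly c 6 t * (t : ℂ) ^ m =
      ∑ i ∈ Finset.range 6, c i / (i.factorial : ℂ) * (1 / ((i + m + 1 : ℕ) : ℂ)) := by
  have h1 : ∀ t : ℝ, jetPoly c 6 t * (t : ℂ) ^ m =
      ∑ i ∈ Finset.range 6, c i / (i.factorial : ℂ) * ((t ^ (i + m) : ℝ) : ℂ) := by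
    intro t
    rw [jetPoly, Finset.sum_mul]
    refine Finset.sum_congr rfl fun i _ => ?_
    push_cast
    rw [pow_add]
    ring
  simp only [h1]
  rw [intervalIntegral.integral_finsetSum fun i _ => by
    apply Continuous.intervalIntegrable; fun_prop]
  refine Finset.sum_congr rfl fun i _ => ?_
  rw [intervalIntegral.integral_const_mul, intervalIntegral.integral_ofReal, integral_pow]
  push_cast
  simp

lemma norm_integral_jetPoly_mul_pow_le (c : ℕ → ℂ) (m : ℕ) :
    ‖∫ t in (0 : ℝ)..1, jetPoly c 6 t * (t : ℂ) ^ m‖ ≤ ∫ t in (0 : ℝ)..1, ‖jetPoly c 6 t‖ := by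
  have hc : Continuous (jetPoly c 6) := by unfold jetPoly; fun_prop
  refine (intervalIntegral.norm_integral_le_integral_norm zero_le_one).trans ?_
  refine intervalIntegral.integral_mono_on zero_le_one
    (Continuous.intervalIntegrable (by fun_prop) _ _)
    (Continuous.intervalIntegrable (by fun_prop) _ _) fun t ht => ?_
  rw [norm_mul, norm_pow, Complex.norm_real, Real.norm_of_nonneg ht.1]
  exact mul_le_of_le_one_right (norm_nonneg _) (pow_le_one₀ ht.1 ht.2)

/-- The derivatives of a Sobolev function vanish at infinity. -/
lemma IsSobolevSix.tendsto_atTop {f : ℝ → ℂ} (hf : IsSobolevSix f) {j : ℕ} (hj : j ≤ 5) :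
    Tendsto (iteratedDerivWithin j f (Ici 0)) atTop (𝓝 0) := by
  obtain ⟨h, hh, hint⟩ := hf.exists_sixth
  -- The coefficients of the Taylor polynomial at R are the derivatives in question. On [R, R + 1]
  -- this polynomial is close to f, so its L¹ norm there tends to 0, hence so do its moments, and
  -- six moments determine the coefficients.
  let c : ℝ → ℕ → ℂ := fun R i => iteratedDerivWithin i f (Ici 0) R
  have hN : Tendsto (fun R => ∫ t in (0 : ℝ)..1, ‖jetPoly (c R) 6 t‖) atTop (𝓝 0) := by
    have h1 := (MemLp.tendsto_integral_norm hf.memLp).add (MemLp.tendsto_integral_norm hh)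
    rw [add_zero] at h1
    refine squeeze_zero' (Eventually.of_forall fun R =>
      intervalIntegral.integral_nonneg zero_le_one fun x _ => norm_nonneg _) ?_ h1
    filter_upwards [eventually_gt_atTop 0] with R hR
    have hc : Continuous (jetPoly (c R) 6) := by unfold jetPoly; fun_prop
    have h2 : ∫ s in R..(R + 1), ‖f s‖ = ∫ t in (0 : ℝ)..1, ‖f (R + t)‖ := by
      rw [intervalIntegral.integral_comp_add_left (fun s => ‖f s‖)]
      simp
    have hfi : IntervalIntegrable (fun t => ‖f (R + t)‖) volume 0 1 := by
      refine ContinuousOn.intervalIntegrable ?_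
      refine (hf.contDiffOn.continuousOn.comp (by fun_prop) fun t ht => ?_).norm
      rw [uIcc_of_le zero_le_one] at ht
      exact mem_Ici.2 (by linarith [ht.1])
    rw [h2]
    have h3 : ∫ t in (0 : ℝ)..1, (‖f (R + t)‖ + ∫ s in R..(R + 1), ‖h s‖) =
        (∫ t in (0 : ℝ)..1, ‖f (R + t)‖) + ∫ s in R..(R + 1), ‖h s‖ := by
      rw [intervalIntegral.integral_add hfi intervalIntegrable_const]
      simp
    rw [← h3]
    refine intervalIntegral.integral_mono_on zero_le_one
      (Continuous.intervalIntegrable (by fun_prop) _ _) (hfi.add intervalIntegrable_const)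
      fun t ht => ?_
    have h4 := hf.taylor_remainder hh hint hR (n := 5) (j := 0) rfl ht
    simp only [iteratedDerivWithin_zero, zero_add] at h4
    have h5 := norm_sub_norm_le (jetPoly (c R) 6 t) (f (R + t))
    rw [norm_sub_rev] at h5
    change ‖f (R + t) - jetPoly (c R) 6 t‖ ≤ _ at h4
    linarith
  have hM : ∀ m : ℕ, Tendsto (fun R => ∑ i ∈ Finset.range 6,
      c R i / (i.factorial : ℂ) * (1 / ((i + m + 1 : ℕ) : ℂ))) atTop (𝓝 0) := by
    intro m
    refine squeeze_zero_norm (fun R => ?_) hN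
    rw [← integral_jetPoly_mul_pow]
    exact norm_integral_jetPoly_mul_pow_le _ m
  -- The moments are the 6 × 6 Hilbert matrix (1/(i + m + 1)) applied to the numbers c_i / i!. The
  -- witnesses are row j of the inverse Hilbert matrix, multiplied by j!.
  have key : ∃ a : ℕ → ℂ, ∀ R, c R j = ∑ m ∈ Finset.range 6, a m * ∑ i ∈ Finset.range 6,
      c R i / (i.factorial : ℂ) * (1 / ((i + m + 1 : ℕ) : ℂ)) := by
    interval_cases j
    · refine ⟨fun m => ![36, -630, 3360, -7560, 7560, -2772] (Fin.ofNat 6 m), fun R => ?_⟩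
      simp [Finset.sum_range_succ, Nat.factorial, Fin.ofNat]
      ring
    · refine ⟨fun m => ![-630, 14700, -88200, 211680, -220500, 83160] (Fin.ofNat 6 m), fun R => ?_⟩
      simp [Finset.sum_range_succ, Nat.factorial, Fin.ofNat]
      ring
    · refine ⟨fun m => ![6720, -176400, 1128960, -2822400, 3024000, -1164240] (Fin.ofNat 6 m), fun R => ?_⟩
      simp [Finset.sum_range_succ, Nat.factorial, Fin.ofNat]
      ring
    · refine ⟨fun m => ![-45360, 1270080, -8467200, 21772800, -23814000, 9313920] (Fin.ofNat 6 m), fun R => ?_⟩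
      simp [Finset.sum_range_succ, Nat.factorial, Fin.ofNat]
      ring
    · refine ⟨fun m => ![181440, -5292000, 36288000, -95256000, 105840000, -41912640] (Fin.ofNat 6 m), fun R => ?_⟩
      simp [Finset.sum_range_succ, Nat.factorial, Fin.ofNat]
      ring
    · refine ⟨fun m => ![-332640, 9979200, -69854400, 186278400, -209563200, 83825280] (Fin.ofNat 6 m), fun R => ?_⟩
      simp [Finset.sum_range_succ, Nat.factorial, Fin.ofNat]
      ring
  obtain ⟨a, ha⟩ := key
  have h1 := tendsto_finsetSum (Finset.range 6) fun m _ => (hM m).const_mul (a m)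
  simp only [mul_zero, Finset.sum_const_zero] at h1
  refine h1.congr fun R => ?_
  rw [← ha]

end Sobolev

/-! ### The boundary form and Green's formula. -/

section BoundaryForm

/-! Quasi-derivatives of `-d²/dr² + m/r²` in terms of the vector `x` of ordinary derivatives. -/

def quasiOne (m r : ℂ) (x : ℕ → ℂ) : ℂ := -x 2 + m / r ^ 2 * x 0

def quasiOneDeriv (m r : ℂ) (x : ℕ → ℂ) : ℂ := -x 3 + m / r ^ 2 * x 1 - 2 * m / r ^ 3 * x 0

/-- Here x n stands for the n-th derivative of f and m for l(l + 1). Expanding Tf, T²f, T³f by the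
product rule gives `quasiOne`, `quasiTwo`, `quasiThree`; each suffix `Deriv` is one formal
derivative in r. -/
def quasiTwo (m r : ℂ) (x : ℕ → ℂ) : ℂ :=
  x 4 - 2 * m / r ^ 2 * x 2 + 4 * m / r ^ 3 * x 1 + (m ^ 2 - 6 * m) / r ^ 4 * x 0

def quasiTwoDeriv (m r : ℂ) (x : ℕ → ℂ) : ℂ :=
  x 5 - 2 * m / r ^ 2 * x 3 + 8 * m / r ^ 3 * x 2 + (m ^ 2 - 18 * m) / r ^ 4 * x 1 -
    4 * (m ^ 2 - 6 * m) / r ^ 5 * x 0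

def quasiTwoDerivDeriv (m r : ℂ) (x : ℕ → ℂ) : ℂ :=
  x 6 - 2 * m / r ^ 2 * x 4 + 12 * m / r ^ 3 * x 3 + (m ^ 2 - 42 * m) / r ^ 4 * x 2 -
    (8 * m ^ 2 - 96 * m) / r ^ 5 * x 1 + 20 * (m ^ 2 - 6 * m) / r ^ 6 * x 0

def quasiThree (m r : ℂ) (x : ℕ → ℂ) : ℂ :=
  -quasiTwoDerivDeriv m r x + m / r ^ 2 * quasiTwo m r x

/-- The boundary form of the third power of `-d²/dr² + m/r²`. -/
def cubeForm (m r : ℂ) (x y : ℕ → ℂ) : ℂ :=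
  -quasiTwoDeriv m r x * y 0 + quasiTwo m r x * y 1 - quasiOneDeriv m r x * quasiOne m r y +
    quasiOne m r x * quasiOneDeriv m r y - x 1 * quasiTwo m r y + x 0 * quasiTwoDeriv m r y

lemma hasDerivAt_div_pow_mul {F : ℝ → ℂ} {F' : ℂ} {r : ℝ} (hr : r ≠ 0) (a : ℂ) (n : ℕ)
    (h : HasDerivAt F F' r) :
    HasDerivAt (fun r : ℝ => a / (r : ℂ) ^ n * F r)
      (a / (r : ℂ) ^ n * F' - n * a / (r : ℂ) ^ (n + 1) * F r) r := by
  have hr' : (r : ℂ) ≠ 0 := Complex.ofReal_ne_zero.2 hr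
  have h1 : HasDerivAt (fun t : ℝ => (t : ℂ) ^ n) ((n : ℂ) * (r : ℂ) ^ (n - 1)) r :=
    (hasDerivAt_pow n (r : ℂ)).comp_ofReal
  have h2 := ((hasDerivAt_const r a).fun_div h1 (pow_ne_zero n hr')).mul h
  refine h2.congr_deriv ?_
  rcases n with _ | n
  · simp
  · simp only [Nat.add_sub_cancel]
    field_simp
    ring

variable {F : ℕ → ℝ → ℂ} {m : ℂ} {r : ℝ}

lemma hasDerivAt_quasiOne (hr : r ≠ 0) (h : ∀ j ≤ 2, HasDerivAt (F j) (F (j + 1) r) r) :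
    HasDerivAt (fun r : ℝ => quasiOne m r (F · r)) (quasiOneDeriv m r (F · r)) r := by
  have hr' : (r : ℂ) ≠ 0 := Complex.ofReal_ne_zero.2 hr
  refine ((h 2 (by omega)).neg.add
    (hasDerivAt_div_pow_mul hr m 2 (h 0 (by omega)))).congr_deriv ?_
  simp only [quasiOneDeriv]
  push_cast
  ring

lemma hasDerivAt_quasiOneDeriv (hr : r ≠ 0) (h : ∀ j ≤ 3, HasDerivAt (F j) (F (j + 1) r) r) :
    HasDerivAt (fun r : ℝ => quasiOneDeriv m r (F · r))
      (m / r ^ 2 * quasiOne m r (F · r) - quasiTwo m r (F · r)) r := by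
  have hr' : (r : ℂ) ≠ 0 := Complex.ofReal_ne_zero.2 hr
  refine (((h 3 (by omega)).neg.add
    (hasDerivAt_div_pow_mul hr m 2 (h 1 (by omega)))).sub
    (hasDerivAt_div_pow_mul hr (2 * m) 3 (h 0 (by omega)))).congr_deriv ?_
  simp only [quasiOne, quasiTwo]
  push_cast
  field_simp
  ring

lemma hasDerivAt_quasiTwo (hr : r ≠ 0) (h : ∀ j ≤ 4, HasDerivAt (F j) (F (j + 1) r) r) :
    HasDerivAt (fun r : ℝ => quasiTwo m r (F · r)) (quasiTwoDeriv m r (F · r)) r := by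
  have hr' : (r : ℂ) ≠ 0 := Complex.ofReal_ne_zero.2 hr
  refine ((((h 4 (by omega)).sub
    (hasDerivAt_div_pow_mul hr (2 * m) 2 (h 2 (by omega)))).add
    (hasDerivAt_div_pow_mul hr (4 * m) 3 (h 1 (by omega)))).add
    (hasDerivAt_div_pow_mul hr (m ^ 2 - 6 * m) 4 (h 0 (by omega)))).congr_deriv ?_
  simp only [quasiTwoDeriv]
  push_cast
  field_simp
  ring

lemma hasDerivAt_quasiTwoDeriv (hr : r ≠ 0) (h : ∀ j ≤ 5, HasDerivAt (F j) (F (j + 1) r) r) :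
    HasDerivAt (fun r : ℝ => quasiTwoDeriv m r (F · r))
      (m / r ^ 2 * quasiTwo m r (F · r) - quasiThree m r (F · r)) r := by
  have hr' : (r : ℂ) ≠ 0 := Complex.ofReal_ne_zero.2 hr
  refine (((((h 5 (by omega)).sub
    (hasDerivAt_div_pow_mul hr (2 * m) 2 (h 3 (by omega)))).add
    (hasDerivAt_div_pow_mul hr (8 * m) 3 (h 2 (by omega)))).add
    (hasDerivAt_div_pow_mul hr (m ^ 2 - 18 * m) 4 (h 1 (by omega)))).sub
    (hasDerivAt_div_pow_mul hr (4 * (m ^ 2 - 6 * m)) 5 (h 0 (by omega)))).congr_deriv ?_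
  simp only [quasiThree, quasiTwoDerivDeriv]
  push_cast
  field_simp
  ring

/-- Lagrange's identity, telescoped: the three Wronskian-like pairs contribute T³f·g − T²f·Tg,
T²f·Tg − Tf·T²g and Tf·T²g − f·T³g. -/
lemma hasDerivAt_cubeForm {G : ℕ → ℝ → ℂ} (hr : r ≠ 0)
    (hF : ∀ j ≤ 5, HasDerivAt (F j) (F (j + 1) r) r)
    (hG : ∀ j ≤ 5, HasDerivAt (G j) (G (j + 1) r) r) :
    HasDerivAt (fun r : ℝ => cubeForm m r (F · r) (G · r))
      (quasiThree m r (F · r) * G 0 r - F 0 r * quasiThree m r (G · r)) r := by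
  have hF' : ∀ n ≤ 5, ∀ j ≤ n, HasDerivAt (F j) (F (j + 1) r) r :=
    fun n hn j hj => hF j (hj.trans hn)
  have hG' : ∀ n ≤ 5, ∀ j ≤ n, HasDerivAt (G j) (G (j + 1) r) r :=
    fun n hn j hj => hG j (hj.trans hn)
  refine (((((((hasDerivAt_quasiTwoDeriv (m := m) hr hF).neg.mul (hG 0 (by omega))).add
    ((hasDerivAt_quasiTwo (m := m) hr (hF' 4 (by omega))).mul (hG 1 (by omega)))).sub
    ((hasDerivAt_quasiOneDeriv (m := m) hr (hF' 3 (by omega))).mul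
      (hasDerivAt_quasiOne (m := m) hr (hG' 2 (by omega))))).add
    ((hasDerivAt_quasiOne (m := m) hr (hF' 2 (by omega))).mul
      (hasDerivAt_quasiOneDeriv (m := m) hr (hG' 3 (by omega))))).sub
    ((hF 1 (by omega)).mul (hasDerivAt_quasiTwo (m := m) hr (hG' 4 (by omega))))).add
    ((hF 0 (by omega)).mul (hasDerivAt_quasiTwoDeriv (m := m) hr hG))).congr_deriv ?_
  simp only [quasiOne, zero_add, Pi.neg_apply]
  ring

/-- The form is homogeneous under dilation. After weighting the j-th derivative by rʲ, all
singularity sits in the factor r⁻⁵, so weighted errors of size o(r⁵) are harmless. -/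
lemma cubeForm_homogeneous {r : ℂ} (hr : r ≠ 0) (x y : ℕ → ℂ) :
    cubeForm m r x y = (r ^ 5)⁻¹ * cubeForm m 1 (fun j => r ^ j * x j) (fun j => r ^ j * y j) := by
  simp only [cubeForm, quasiOne, quasiOneDeriv, quasiTwo, quasiTwoDeriv]
  field_simp

/-- By bilinearity the difference is B(x − p, y) + B(p, y − q), and B is antisymmetric. Both terms
now have the small argument first, as `cubeForm_isLittleO` requires. -/
lemma cubeForm_sub (r : ℂ) (x y p q : ℕ → ℂ) :
    cubeForm m r x y - cubeForm m r p q =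
      cubeForm m r (fun j => x j - p j) y - cubeForm m r (fun j => y j - q j) p := by
  simp only [cubeForm, quasiOne, quasiOneDeriv, quasiTwo, quasiTwoDeriv]
  ring

open Asymptotics in
lemma cubeForm_isLittleO {α : Type*} {L : Filter α} {x y : α → ℕ → ℂ} {φ : α → ℝ}
    (hx : ∀ j ≤ 5, (fun t => x t j) =o[L] φ)
    (hy : ∀ j ≤ 5, (fun t => y t j) =O[L] fun _ => (1 : ℝ)) :
    (fun t => cubeForm m 1 (x t) (y t)) =o[L] φ := by
  have o1 : (fun t => quasiOne m 1 (x t)) =o[L] φ :=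
    (hx 2 (by omega)).neg_left.add ((hx 0 (by omega)).const_mul_left _)
  have o2 : (fun t => quasiOneDeriv m 1 (x t)) =o[L] φ :=
    ((hx 3 (by omega)).neg_left.add ((hx 1 (by omega)).const_mul_left _)).sub
      ((hx 0 (by omega)).const_mul_left _)
  have o3 : (fun t => quasiTwo m 1 (x t)) =o[L] φ :=
    (((hx 4 (by omega)).sub ((hx 2 (by omega)).const_mul_left _)).add
      ((hx 1 (by omega)).const_mul_left _)).add ((hx 0 (by omega)).const_mul_left _)
  have o4 : (fun t => quasiTwoDeriv m 1 (x t)) =o[L] φ :=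
    ((((hx 5 (by omega)).sub ((hx 3 (by omega)).const_mul_left _)).add
      ((hx 2 (by omega)).const_mul_left _)).add ((hx 1 (by omega)).const_mul_left _)).sub
      ((hx 0 (by omega)).const_mul_left _)
  have b1 : (fun t => quasiOne m 1 (y t)) =O[L] fun _ => (1 : ℝ) :=
    (hy 2 (by omega)).neg_left.add ((hy 0 (by omega)).const_mul_left _)
  have b2 : (fun t => quasiOneDeriv m 1 (y t)) =O[L] fun _ => (1 : ℝ) :=
    ((hy 3 (by omega)).neg_left.add ((hy 1 (by omega)).const_mul_left _)).sub
      ((hy 0 (by omega)).const_mul_left _)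
  have b3 : (fun t => quasiTwo m 1 (y t)) =O[L] fun _ => (1 : ℝ) :=
    (((hy 4 (by omega)).sub ((hy 2 (by omega)).const_mul_left _)).add
      ((hy 1 (by omega)).const_mul_left _)).add ((hy 0 (by omega)).const_mul_left _)
  have b4 : (fun t => quasiTwoDeriv m 1 (y t)) =O[L] fun _ => (1 : ℝ) :=
    ((((hy 5 (by omega)).sub ((hy 3 (by omega)).const_mul_left _)).add
      ((hy 2 (by omega)).const_mul_left _)).add ((hy 1 (by omega)).const_mul_left _)).sub
      ((hy 0 (by omega)).const_mul_left _)
  have h := (((((o4.neg_left.mul_isBigO (hy 0 (by omega))).add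
    (o3.mul_isBigO (hy 1 (by omega)))).sub (o2.mul_isBigO b1)).add (o1.mul_isBigO b2)).sub
    ((hx 1 (by omega)).mul_isBigO b3)).add ((hx 0 (by omega)).mul_isBigO b4)
  simpa only [mul_one, cubeForm] using h

/-- The value of the boundary form on polynomials with given derivatives at the origin. -/
lemma exists_cubeForm_jetPoly (m : ℂ) (c d : ℕ → ℂ) : ∃ K : ℝ → ℂ, Continuous K ∧
    ∀ r : ℝ, r ≠ 0 → cubeForm m r (fun j => jetPoly (fun i => c (j + i)) (6 - j) r)
      (fun j => jetPoly (fun i => d (j + i)) (6 - j) r) = (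
      ((-24) * m + (3) * m ^ 2) * c 0 * d 1 * (r : ℂ) ^ 1 +
      ((24) * m + (-3) * m ^ 2) * c 1 * d 0 * (r : ℂ) ^ 1 +
      ((-18) * m + (3) * m ^ 2) * c 0 * d 2 * (r : ℂ) ^ 2 +
      ((18) * m + (-3) * m ^ 2) * c 2 * d 0 * (r : ℂ) ^ 2 +
      ((-9) * m + (3/2) * m ^ 2) * c 0 * d 3 * (r : ℂ) ^ 3 +
      ((-3) * m + (3/2) * m ^ 2) * c 1 * d 2 * (r : ℂ) ^ 3 +
      ((3) * m + (-3/2) * m ^ 2) * c 2 * d 1 * (r : ℂ) ^ 3 +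
      ((9) * m + (-3/2) * m ^ 2) * c 3 * d 0 * (r : ℂ) ^ 3 +
      ((-4) * m + (1/2) * m ^ 2) * c 0 * d 4 * (r : ℂ) ^ 4 +
      ((-2) * m + (1) * m ^ 2) * c 1 * d 3 * (r : ℂ) ^ 4 +
      ((2) * m + (-1) * m ^ 2) * c 3 * d 1 * (r : ℂ) ^ 4 +
      ((4) * m + (-1/2) * m ^ 2) * c 4 * d 0 * (r : ℂ) ^ 4 +
      ((1) + (-3/2) * m + (1/8) * m ^ 2) * c 0 * d 5 * (r : ℂ) ^ 5 +
      ((-1) + (-3/2) * m + (3/8) * m ^ 2) * c 1 * d 4 * (r : ℂ) ^ 5 +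
      ((1) + (1/4) * m ^ 2) * c 2 * d 3 * (r : ℂ) ^ 5 +
      ((-1) + (-1/4) * m ^ 2) * c 3 * d 2 * (r : ℂ) ^ 5 +
      ((1) + (3/2) * m + (-3/8) * m ^ 2) * c 4 * d 1 * (r : ℂ) ^ 5 +
      ((-1) + (3/2) * m + (-1/8) * m ^ 2) * c 5 * d 0 * (r : ℂ) ^ 5) / (r : ℂ) ^ 5 + K r * r := by
  -- The product c_i d_j carries the power r^(i+j−5). The witness K collects the terms with i + j ≥
  -- 6, one power of r being split off; diagonal terms such as c₀d₀ vanish by antisymmetry.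
  refine ⟨fun r => (
      ((-4/5) * m + (1/10) * m ^ 2) * c 1 * d 5 * (r : ℂ) ^ 0 +
      ((-1/4) * m + (1/8) * m ^ 2) * c 2 * d 4 * (r : ℂ) ^ 0 +
      ((1/4) * m + (-1/8) * m ^ 2) * c 4 * d 2 * (r : ℂ) ^ 0 +
      ((4/5) * m + (-1/10) * m ^ 2) * c 5 * d 1 * (r : ℂ) ^ 0 +
      ((-9/40) * m + (3/80) * m ^ 2) * c 2 * d 5 * (r : ℂ) ^ 1 +
      ((-1/24) * m + (1/48) * m ^ 2) * c 3 * d 4 * (r : ℂ) ^ 1 +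
      ((1/24) * m + (-1/48) * m ^ 2) * c 4 * d 3 * (r : ℂ) ^ 1 +
      ((9/40) * m + (-3/80) * m ^ 2) * c 5 * d 2 * (r : ℂ) ^ 1 +
      ((-1/20) * m + (1/120) * m ^ 2) * c 3 * d 5 * (r : ℂ) ^ 2 +
      ((1/20) * m + (-1/120) * m ^ 2) * c 5 * d 3 * (r : ℂ) ^ 2 +
      ((-1/120) * m + (1/960) * m ^ 2) * c 4 * d 5 * (r : ℂ) ^ 3 +
      ((1/120) * m + (-1/960) * m ^ 2) * c 5 * d 4 * (r : ℂ) ^ 3), by fun_prop,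
    fun r hr => ?_⟩
  have hr' : (r : ℂ) ≠ 0 := Complex.ofReal_ne_zero.2 hr
  simp only [cubeForm, quasiOne, quasiOneDeriv, quasiTwo, quasiTwoDeriv, jetPoly,
    Finset.sum_range_succ, Finset.sum_range_zero, Nat.factorial, Nat.reduceSub, Nat.reduceAdd]
  push_cast
  field_simp
  ring

lemma radialOp_of_hasDerivAt {l : ℕ} {g g' : ℝ → ℂ} {g'' : ℂ} (hr : 0 < r)
    (h1 : ∀ s, 0 < s → HasDerivAt g (g' s) s) (h2 : HasDerivAt g' g'' r) :
    radialOp l g r = -g'' + (l : ℂ) * ((l : ℂ) + 1) / (r : ℂ) ^ 2 * g r := by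
  have e : deriv g =ᶠ[𝓝 r] g' := by
    filter_upwards [Ioi_mem_nhds hr] with s hs using (h1 s hs).deriv
  rw [radialOp, e.deriv_eq, h2.deriv]

lemma radialOp_eqOn_quasiOne (l : ℕ)
    (h : ∀ r, 0 < r → ∀ j ≤ 4, HasDerivAt (F j) (F (j + 1) r) r) :
    EqOn (radialOp l (F 0)) (fun r => quasiOne ((l : ℂ) * (l + 1)) r (F · r)) (Ioi 0) := by
  intro r hr
  exact radialOp_of_hasDerivAt hr (fun s hs => h s hs 0 (by omega)) (h r hr 1 (by omega))

lemma radialOp_radialOp_eqOn_quasiTwo (l : ℕ)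
    (h : ∀ r, 0 < r → ∀ j ≤ 4, HasDerivAt (F j) (F (j + 1) r) r) :
    EqOn (radialOp l (radialOp l (F 0))) (fun r => quasiTwo ((l : ℂ) * (l + 1)) r (F · r))
      (Ioi 0) := by
  refine (radialOp_congr (radialOp_eqOn_quasiOne l h)).trans fun r hr => ?_
  have e := radialOp_of_hasDerivAt (l := l) hr
    (fun s hs => hasDerivAt_quasiOne (m := (l : ℂ) * (l + 1)) (ne_of_gt hs)
      fun j hj => h s hs j (by omega))
    (hasDerivAt_quasiOneDeriv (m := (l : ℂ) * (l + 1)) (ne_of_gt hr) fun j hj => h r hr j (by omega))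
  refine e.trans ?_
  ring

/-- The sixth derivative of an H⁶ function exists only almost everywhere, so it is required at the
single point r, while the lower derivatives are required on the whole half-line. -/
lemma radialOpCube_eq_quasiThree (l : ℕ)
    (h : ∀ r, 0 < r → ∀ j ≤ 4, HasDerivAt (F j) (F (j + 1) r) r) (hr : 0 < r)
    (h5 : HasDerivAt (F 5) (F 6 r) r) :
    radialOpCube l (F 0) r = quasiThree ((l : ℂ) * (l + 1)) r (F · r) := by
  have h' : ∀ j ≤ 5, HasDerivAt (F j) (F (j + 1) r) r := by
    intro j hj
    rcases Nat.lt_or_ge j 5 with h1 | h1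
    · exact h r hr j (by omega)
    · obtain rfl : j = 5 := by omega
      exact h5
  have e1 : radialOpCube l (F 0) r = _ :=
    radialOp_congr (radialOp_radialOp_eqOn_quasiTwo l h) hr
  rw [e1]
  have e := radialOp_of_hasDerivAt (l := l) hr
    (fun s hs => hasDerivAt_quasiTwo (m := (l : ℂ) * (l + 1)) (ne_of_gt hs)
      fun j hj => h s hs j (by omega))
    (hasDerivAt_quasiTwoDeriv (m := (l : ℂ) * (l + 1)) (ne_of_gt hr) h')
  refine e.trans ?_
  ring

lemma tendsto_div_ofReal_pow_atTop (a : ℂ) {n : ℕ} (hn : n ≠ 0) :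
    Tendsto (fun r : ℝ => a / (r : ℂ) ^ n) atTop (𝓝 0) := by
  rw [tendsto_zero_iff_norm_tendsto_zero]
  have h : Tendsto (fun r : ℝ => ‖a‖ / r ^ n) atTop (𝓝 0) :=
    (tendsto_pow_atTop hn).const_div_atTop _
  refine h.congr' ?_
  filter_upwards [eventually_ge_atTop 0] with r hr
  rw [norm_div, norm_pow, Complex.norm_real, Real.norm_of_nonneg hr]

lemma tendsto_cubeForm_atTop {G : ℕ → ℝ → ℂ} (hF : ∀ j ≤ 5, Tendsto (F j) atTop (𝓝 0))
    (hG : ∀ j ≤ 5, Tendsto (G j) atTop (𝓝 0)) :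
    Tendsto (fun r : ℝ => cubeForm m r (F · r) (G · r)) atTop (𝓝 0) := by
  have d : ∀ {K : ℕ → ℝ → ℂ}, (∀ j ≤ 5, Tendsto (K j) atTop (𝓝 0)) → ∀ (a : ℂ) (n j : ℕ), n ≠ 0 →
      j ≤ 5 → Tendsto (fun r : ℝ => a / (r : ℂ) ^ n * K j r) atTop (𝓝 0) := by
    intro K hK a n j hn hj
    simpa using (tendsto_div_ofReal_pow_atTop a hn).mul (hK j hj)
  have q1 : ∀ {K : ℕ → ℝ → ℂ}, (∀ j ≤ 5, Tendsto (K j) atTop (𝓝 0)) →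
      Tendsto (fun r : ℝ => quasiOne m r (K · r)) atTop (𝓝 0) := by
    intro K hK
    simpa [quasiOne] using (hK 2 (by omega)).neg.add (d hK m 2 0 (by omega) (by omega))
  have q2 : ∀ {K : ℕ → ℝ → ℂ}, (∀ j ≤ 5, Tendsto (K j) atTop (𝓝 0)) →
      Tendsto (fun r : ℝ => quasiOneDeriv m r (K · r)) atTop (𝓝 0) := by
    intro K hK
    simpa [quasiOneDeriv] using ((hK 3 (by omega)).neg.add (d hK m 2 1 (by omega) (by omega))).sub
      (d hK (2 * m) 3 0 (by omega) (by omega))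
  have q3 : ∀ {K : ℕ → ℝ → ℂ}, (∀ j ≤ 5, Tendsto (K j) atTop (𝓝 0)) →
      Tendsto (fun r : ℝ => quasiTwo m r (K · r)) atTop (𝓝 0) := by
    intro K hK
    simpa [quasiTwo] using (((hK 4 (by omega)).sub (d hK (2 * m) 2 2 (by omega) (by omega))).add
      (d hK (4 * m) 3 1 (by omega) (by omega))).add
      (d hK (m ^ 2 - 6 * m) 4 0 (by omega) (by omega))
  have q4 : ∀ {K : ℕ → ℝ → ℂ}, (∀ j ≤ 5, Tendsto (K j) atTop (𝓝 0)) →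
      Tendsto (fun r : ℝ => quasiTwoDeriv m r (K · r)) atTop (𝓝 0) := by
    intro K hK
    simpa [quasiTwoDeriv] using ((((hK 5 (by omega)).sub (d hK (2 * m) 2 3 (by omega) (by omega))).add
      (d hK (8 * m) 3 2 (by omega) (by omega))).add
      (d hK (m ^ 2 - 18 * m) 4 1 (by omega) (by omega))).sub
      (d hK (4 * (m ^ 2 - 6 * m)) 5 0 (by omega) (by omega))
  simpa [cubeForm] using ((((((q4 hF).neg.mul (hG 0 (by omega))).add
    ((q3 hF).mul (hG 1 (by omega)))).sub ((q2 hF).mul (q1 hG))).add ((q1 hF).mul (q2 hG))).sub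
    ((hF 1 (by omega)).mul (q3 hG))).add ((hF 0 (by omega)).mul (q4 hG))

open Asymptotics in
/-- Near the origin the boundary form only depends on the Taylor polynomials. -/
lemma tendsto_cubeForm_zero {f g : ℝ → ℂ} (hf : IsSobolevSix f) (hg : IsSobolevSix g) :
    Tendsto (fun r : ℝ =>
      cubeForm m r (fun j => iteratedDerivWithin j f (Ici 0) r)
        (fun j => iteratedDerivWithin j g (Ici 0) r) -
      cubeForm m r
        (fun j => jetPoly (fun i => iteratedDerivWithin (j + i) f (Ici 0) 0) (6 - j) r)
        (fun j => jetPoly (fun i => iteratedDerivWithin (j + i) g (Ici 0) 0) (6 - j) r))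
      (𝓝[>] 0) (𝓝 0) := by
  -- The j-th derivative agrees with its Taylor polynomial up to o(r^(5−j)), so the weighted error
  -- is o(r⁵) for every j, which exactly balances the factor r⁻⁵.
  have err : ∀ {f : ℝ → ℂ}, IsSobolevSix f → ∀ j ≤ 5, (fun r : ℝ => (r : ℂ) ^ j *
      (iteratedDerivWithin j f (Ici 0) r -
        jetPoly (fun i => iteratedDerivWithin (j + i) f (Ici 0) 0) (6 - j) r)) =o[𝓝[>] 0]
        fun r : ℝ => r ^ 5 := by
    intro f hf j hj
    have h1 := (hf.taylor_zero (n := 5 - j) (j := j) (by omega)).mono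
      (nhdsWithin_mono 0 Ioi_subset_Ici_self)
    rw [show 5 - j + 1 = 6 - j by omega] at h1
    have h2 : (fun r : ℝ => (r : ℂ) ^ j) =O[𝓝[>] 0] fun r : ℝ => r ^ j :=
      IsBigO.of_bound 1 (Eventually.of_forall fun r => by simp)
    refine (h2.mul_isLittleO h1).congr_right fun r => ?_
    rw [← pow_add]
    congr 1
    omega
  have bd : ∀ {f : ℝ → ℂ}, IsSobolevSix f → ∀ j ≤ 5, (fun r : ℝ => (r : ℂ) ^ j *
      iteratedDerivWithin j f (Ici 0) r) =O[𝓝[>] 0] fun _ => (1 : ℝ) := by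
    intro f hf j hj
    have h1 : Tendsto (fun r : ℝ => (r : ℂ) ^ j * iteratedDerivWithin j f (Ici 0) r) (𝓝[>] 0)
        (𝓝 (((0 : ℝ) : ℂ) ^ j * iteratedDerivWithin j f (Ici 0) 0)) := by
      refine Tendsto.mul ?_ ?_
      · exact (Continuous.tendsto (by fun_prop) 0).mono_left nhdsWithin_le_nhds
      · exact (hf.continuousOn hj 0 (mem_Ici.2 le_rfl)).tendsto.mono_left
          (nhdsWithin_mono 0 Ioi_subset_Ici_self)
    exact h1.isBigO_one ℝ
  have bp : ∀ (f : ℝ → ℂ), ∀ j ≤ 5, (fun r : ℝ => (r : ℂ) ^ j *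
      jetPoly (fun i => iteratedDerivWithin (j + i) f (Ici 0) 0) (6 - j) r) =O[𝓝[>] 0]
        fun _ => (1 : ℝ) := by
    intro f j hj
    have h1 : Continuous fun r : ℝ => (r : ℂ) ^ j *
      jetPoly (fun i => iteratedDerivWithin (j + i) f (Ici 0) 0) (6 - j) r := by
      unfold jetPoly; fun_prop
    exact ((h1.tendsto 0).mono_left nhdsWithin_le_nhds).isBigO_one ℝ
  have h1 := (cubeForm_isLittleO (m := m) (err hf) (bd hg)).sub
    (cubeForm_isLittleO (m := m) (err hg) (bp f))
  have h2 : (fun r : ℝ => ((r : ℂ) ^ 5)⁻¹) =O[𝓝[>] 0] fun r : ℝ => (r ^ 5)⁻¹ :=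
    IsBigO.of_bound 1 (Eventually.of_forall fun r => by simp)
  have h3 := h2.mul_isLittleO h1
  rw [← isLittleO_one_iff ℝ]
  refine h3.congr' ?_ ?_
  · filter_upwards [self_mem_nhdsWithin] with r hr
    have hr' : (r : ℂ) ≠ 0 := Complex.ofReal_ne_zero.2 (ne_of_gt hr)
    symm
    rw [cubeForm_homogeneous hr', cubeForm_homogeneous (m := m) hr' (fun j => jetPoly _ _ _),
      ← mul_sub, cubeForm_sub]
    simp only [mul_sub]
  · filter_upwards [self_mem_nhdsWithin] with r hr
    exact inv_mul_cancel₀ (pow_ne_zero 5 (ne_of_gt hr))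

lemma ae_hasDerivAt_of_primitive {f h : ℝ → ℂ} (hh : MemLp h 2 halfLine)
    (hint : ∀ r : ℝ, 0 ≤ r → iteratedDerivWithin 5 f (Ici 0) r =
      iteratedDerivWithin 5 f (Ici 0) 0 + ∫ s in (0 : ℝ)..r, h s) :
    ∀ᵐ r, 0 < r → HasDerivAt (iteratedDerivWithin 5 f (Ici 0)) (h r) r := by
  have key : ∀ n : ℕ, ∀ᵐ r : ℝ, r ∈ Ioo (0 : ℝ) n →
      HasDerivAt (iteratedDerivWithin 5 f (Ici 0)) (h r) r := by
    intro n
    have h1 := (intervalIntegrable_of_memLp_halfLine hh (Nat.cast_nonneg n)).ae_hasDerivAt_integral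
    filter_upwards [h1] with r hr hrn
    have hu : r ∈ uIcc (0 : ℝ) n := by
      rw [uIcc_of_le (Nat.cast_nonneg n)]; exact Ioo_subset_Icc_self hrn
    refine ((hr hu 0 (by simp)).const_add (iteratedDerivWithin 5 f (Ici 0) 0)
      ).congr_of_eventuallyEq ?_
    filter_upwards [Ioi_mem_nhds hrn.1] with s hs using hint s (le_of_lt hs)
  filter_upwards [ae_all_iff.2 key] with r hr hr0
  obtain ⟨n, hn⟩ := exists_nat_gt r
  exact hr n ⟨hr0, hn⟩

/-- Since the fifth derivatives are only absolutely continuous, integrating the Lagrange identity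
needs this property. Staying at a > 0 keeps the coefficients m/rⁿ smooth. -/
lemma absolutelyContinuousOnInterval_cubeForm {G : ℕ → ℝ → ℂ} {a b : ℝ} (ha : 0 < a) (hab : a ≤ b)
    (hF : ∀ j ≤ 5, AbsolutelyContinuousOnInterval (F j) a b)
    (hG : ∀ j ≤ 5, AbsolutelyContinuousOnInterval (G j) a b) :
    AbsolutelyContinuousOnInterval (fun r : ℝ => cubeForm m r (F · r) (G · r)) a b := by
  have hp : ∀ (z : ℂ) (n : ℕ), AbsolutelyContinuousOnInterval (fun r : ℝ => z / (r : ℂ) ^ n) a b := by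
    intro z n
    refine ContDiffOn.absolutelyContinuousOnInterval ?_
    have hc : ContDiff ℝ 1 fun r : ℝ => (r : ℂ) ^ n := Complex.ofRealCLM.contDiff.pow n
    simp only [div_eq_mul_inv]
    refine contDiffOn_const.mul (hc.contDiffOn.inv fun r hr => ?_)
    rw [uIcc_of_le hab] at hr
    exact pow_ne_zero n (Complex.ofReal_ne_zero.2 (ne_of_gt (ha.trans_le hr.1)))
  have q1 : ∀ {K : ℕ → ℝ → ℂ}, (∀ j ≤ 5, AbsolutelyContinuousOnInterval (K j) a b) →
      AbsolutelyContinuousOnInterval (fun r : ℝ => quasiOne m r (K · r)) a b := fun hK =>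
    (hK 2 (by omega)).neg.add ((hp m 2).smul (hK 0 (by omega)))
  have q2 : ∀ {K : ℕ → ℝ → ℂ}, (∀ j ≤ 5, AbsolutelyContinuousOnInterval (K j) a b) →
      AbsolutelyContinuousOnInterval (fun r : ℝ => quasiOneDeriv m r (K · r)) a b := fun hK =>
    ((hK 3 (by omega)).neg.add ((hp m 2).smul (hK 1 (by omega)))).sub
      ((hp (2 * m) 3).smul (hK 0 (by omega)))
  have q3 : ∀ {K : ℕ → ℝ → ℂ}, (∀ j ≤ 5, AbsolutelyContinuousOnInterval (K j) a b) →
      AbsolutelyContinuousOnInterval (fun r : ℝ => quasiTwo m r (K · r)) a b := fun hK =>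
    (((hK 4 (by omega)).sub ((hp (2 * m) 2).smul (hK 2 (by omega)))).add
      ((hp (4 * m) 3).smul (hK 1 (by omega)))).add
      ((hp (m ^ 2 - 6 * m) 4).smul (hK 0 (by omega)))
  have q4 : ∀ {K : ℕ → ℝ → ℂ}, (∀ j ≤ 5, AbsolutelyContinuousOnInterval (K j) a b) →
      AbsolutelyContinuousOnInterval (fun r : ℝ => quasiTwoDeriv m r (K · r)) a b := fun hK =>
    ((((hK 5 (by omega)).sub ((hp (2 * m) 2).smul (hK 3 (by omega)))).add
      ((hp (8 * m) 3).smul (hK 2 (by omega)))).add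
      ((hp (m ^ 2 - 18 * m) 4).smul (hK 1 (by omega)))).sub
      ((hp (4 * (m ^ 2 - 6 * m)) 5).smul (hK 0 (by omega)))
  exact ((((((q4 hF).neg.smul (hG 0 (by omega))).add
    ((q3 hF).smul (hG 1 (by omega)))).sub ((q2 hF).smul (q1 hG))).add ((q1 hF).smul (q2 hG))).sub
    ((hF 1 (by omega)).smul (q3 hG))).add ((hF 0 (by omega)).smul (q4 hG))

lemma IsSobolevSix.absolutelyContinuousOnInterval {f : ℝ → ℂ} (hf : IsSobolevSix f) {a b : ℝ}
    (ha : 0 < a) (hab : a ≤ b) {j : ℕ} (hj : j ≤ 5) :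
    AbsolutelyContinuousOnInterval (iteratedDerivWithin j f (Ici 0)) a b := by
  rcases hj.lt_or_eq with hj | rfl
  · refine ContDiffOn.absolutelyContinuousOnInterval ?_
    have h1 := ((contDiffOn_nat_succ_iff_contDiffOn_one_iteratedDerivWithin (n := j)
      (uniqueDiffOn_Ici 0)).1 (hf.contDiffOn.of_le (by exact_mod_cast hj))).2
    refine h1.mono fun x hx => ?_
    rw [uIcc_of_le hab] at hx
    exact ha.le.trans hx.1
  · obtain ⟨h, hh, hint⟩ := hf.exists_sixth
    have hi : ∀ x, 0 ≤ x → IntervalIntegrable h volume 0 x := fun x hx =>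
      intervalIntegrable_of_memLp_halfLine hh hx
    have h1 := absolutelyContinuousOnInterval_primitive
      ((hi a ha.le).symm.trans (hi b (ha.le.trans hab)))
    have h2 : AbsolutelyContinuousOnInterval
        (fun _ : ℝ => iteratedDerivWithin 5 f (Ici 0) a) a b :=
      contDiffOn_const.absolutelyContinuousOnInterval
    refine (h2.add h1).congr_eqOn fun x hx => ?_
    rw [uIcc_of_le hab] at hx
    have hx0 : 0 ≤ x := ha.le.trans hx.1
    rw [Pi.add_apply, hint a ha.le, hint x hx0, add_assoc,
      intervalIntegral.integral_add_adjacent_intervals (hi a ha.le) ((hi a ha.le).symm.trans (hi x hx0))]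

/-- Green's formula for the cube of `-d²/dr² + l(l+1)/r²` without boundary terms. -/
lemma integral_radialOpCube_mul {l : ℕ} {f g : ℝ → ℂ} (hf : IsSobolevSix f) (hg : IsSobolevSix g)
    (hTf : MemLp (radialOpCube l f) 2 halfLine) (hTg : MemLp (radialOpCube l g) 2 halfLine)
    (h0 : Tendsto (fun r : ℝ => cubeForm ((l : ℂ) * (l + 1)) r
      (fun j => jetPoly (fun i => iteratedDerivWithin (j + i) f (Ici 0) 0) (6 - j) r)
      (fun j => jetPoly (fun i => iteratedDerivWithin (j + i) g (Ici 0) 0) (6 - j) r))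
      (𝓝[>] 0) (𝓝 0)) :
    ∫ r, radialOpCube l f r * g r ∂halfLine = ∫ r, f r * radialOpCube l g r ∂halfLine := by
  obtain ⟨h, hh, hint⟩ := hf.exists_sixth
  obtain ⟨k, hk, kint⟩ := hg.exists_sixth
  -- Entry 6 is the L² density, which is the derivative of entry 5 almost everywhere. The boundary
  -- form reads only the entries 0 to 5, so `hB` holds by definition.
  let F : ℕ → ℝ → ℂ := fun j => if j = 6 then h else iteratedDerivWithin j f (Ici 0)
  let G : ℕ → ℝ → ℂ := fun j => if j = 6 then k else iteratedDerivWithin j g (Ici 0)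
  let B : ℝ → ℂ := fun r => cubeForm ((l : ℂ) * (l + 1)) r (F · r) (G · r)
  have hB : ∀ r, B r = cubeForm ((l : ℂ) * (l + 1)) r
      (fun j => iteratedDerivWithin j f (Ici 0) r) (fun j => iteratedDerivWithin j g (Ici 0) r) :=
    fun r => rfl
  have hB0 : Tendsto B (𝓝[>] 0) (𝓝 0) := by
    have h1 := (tendsto_cubeForm_zero (m := (l : ℂ) * (l + 1)) hf hg).add h0
    rw [show B = _ from funext hB]
    simpa using h1
  have hBi : Tendsto B atTop (𝓝 0) :=
    tendsto_cubeForm_atTop (fun j hj => by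
      simpa [F, show j ≠ 6 by omega] using hf.tendsto_atTop hj) (fun j hj => by
      simpa [G, show j ≠ 6 by omega] using hg.tendsto_atTop hj)
  have hFd : ∀ r, 0 < r → ∀ j ≤ 4, HasDerivAt (F j) (F (j + 1) r) r := fun r hr j hj => by
    simpa [F, show j ≠ 6 by omega, show j ≠ 5 by omega] using hf.hasDerivAt (by omega) hr
  have hGd : ∀ r, 0 < r → ∀ j ≤ 4, HasDerivAt (G j) (G (j + 1) r) r := fun r hr j hj => by
    simpa [G, show j ≠ 6 by omega, show j ≠ 5 by omega] using hg.hasDerivAt (by omega) hr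
  let φ : ℝ → ℂ := fun r => radialOpCube l f r * g r - f r * radialOpCube l g r
  have i1 : Integrable (fun r => radialOpCube l f r * g r) halfLine := hTf.integrable_mul hg.memLp
  have i2 : Integrable (fun r => f r * radialOpCube l g r) halfLine := hf.memLp.integrable_mul hTg
  have hφ : IntegrableOn φ (Ioi 0) := i1.sub i2
  have hφi : ∀ x y, 0 ≤ x → x ≤ y → IntervalIntegrable φ volume x y := fun x y hx hxy => by
    rw [intervalIntegrable_iff_integrableOn_Ioc_of_le hxy]
    exact hφ.mono_set fun s hs => hx.trans_lt hs.1
  have hder : ∀ᵐ r, 0 < r → HasDerivAt B (φ r) r := by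
    filter_upwards [ae_hasDerivAt_of_primitive hh hint, ae_hasDerivAt_of_primitive hk kint] with r h1 h2 hr
    have hF5 : ∀ j ≤ 5, HasDerivAt (F j) (F (j + 1) r) r := fun j hj => by
      rcases hj.lt_or_eq with hj | rfl
      · exact hFd r hr j (by omega)
      · exact h1 hr
    have hG5 : ∀ j ≤ 5, HasDerivAt (G j) (G (j + 1) r) r := fun j hj => by
      rcases hj.lt_or_eq with hj | rfl
      · exact hGd r hr j (by omega)
      · exact h2 hr
    have e1 : radialOpCube l f r = quasiThree ((l : ℂ) * (l + 1)) r (F · r) := by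
      have := radialOpCube_eq_quasiThree (F := F) l hFd hr (h1 hr)
      simpa [F] using this
    have e2 : radialOpCube l g r = quasiThree ((l : ℂ) * (l + 1)) r (G · r) := by
      have := radialOpCube_eq_quasiThree (F := G) l hGd hr (h2 hr)
      simpa [G] using this
    refine (hasDerivAt_cubeForm (m := (l : ℂ) * (l + 1)) (ne_of_gt hr) hF5 hG5).congr_deriv ?_
    simp only [φ, e1, e2]
    simp [F, G]
  have hftc : ∀ a b, 0 < a → a ≤ b → ∫ r in a..b, φ r = B b - B a := by
    intro a b ha hab
    refine integral_eq_sub_of_absolutelyContinuous hab ?_ ?_ (hφi a b ha.le hab)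
    · refine absolutelyContinuousOnInterval_cubeForm ha hab (fun j hj => ?_) fun j hj => ?_
      · simpa [F, show j ≠ 6 by omega] using hf.absolutelyContinuousOnInterval ha hab hj
      · simpa [G, show j ≠ 6 by omega] using hg.absolutelyContinuousOnInterval ha hab hj
    · filter_upwards [hder] with r hr hrI using hr (ha.trans_le hrI.1)
  let J : ℝ → ℂ := fun r => ∫ s in (0 : ℝ)..r, φ s
  -- B − J is constant on (0, ∞). Its limit at 0 is 0 and its limit at ∞ is minus the integral of φ,
  -- so that integral vanishes.
  have hJ : ∀ r, 0 < r → B r - J r = B 1 - J 1 := by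
    have h1 : ∀ a b, 0 < a → a ≤ b → B b - J b = B a - J a := by
      intro a b ha hab
      have e1 := intervalIntegral.integral_add_adjacent_intervals (hφi 0 a le_rfl ha.le)
        (hφi a b ha.le hab)
      rw [hftc a b ha hab] at e1
      simp only [J]
      linear_combination e1
    intro r hr
    rcases le_total r 1 with h2 | h2
    · exact (h1 r 1 hr h2).symm
    · exact h1 1 r one_pos h2
  have hJ0 : Tendsto J (𝓝[>] 0) (𝓝 0) := by
    have h1 : ContinuousOn J (uIcc 0 1) := by
      refine intervalIntegral.continuousOn_primitive_interval ?_
      rw [uIcc_of_le zero_le_one, integrableOn_Icc_iff_integrableOn_Ioc]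
      exact hφ.mono_set Ioc_subset_Ioi_self
    have h2 := (h1 0 left_mem_uIcc).tendsto
    rw [uIcc_of_le zero_le_one, show J 0 = 0 from intervalIntegral.integral_same] at h2
    refine h2.mono_left ?_
    rw [← nhdsWithin_Ioc_eq_nhdsGT zero_lt_one]
    exact nhdsWithin_mono 0 Ioc_subset_Icc_self
  have hJi : Tendsto J atTop (𝓝 (∫ r in Ioi 0, φ r)) :=
    intervalIntegral_tendsto_integral_Ioi 0 hφ tendsto_id
  have c0 : B 1 - J 1 = 0 := by
    have h1 := hB0.sub hJ0
    rw [sub_zero] at h1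
    refine tendsto_nhds_unique (tendsto_const_nhds.congr' ?_) h1
    filter_upwards [self_mem_nhdsWithin] with r hr using (hJ r hr).symm
  have c1 : B 1 - J 1 = 0 - ∫ r in Ioi 0, φ r := by
    refine tendsto_nhds_unique (tendsto_const_nhds.congr' ?_) (hBi.sub hJi)
    filter_upwards [eventually_gt_atTop 0] with r hr using (hJ r hr).symm
  have h3 : ∫ r in Ioi 0, φ r = 0 := by
    rw [c0] at c1
    simpa using c1.symm
  rw [integral_sub i1 i2] at h3
  exact sub_eq_zero.1 h3

/-- Most terms of order at most 0 contain a vanishing derivative. Some disappear because of the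
value of m: c₁d₂ and c₁d₃ for m = 2, c₀d₂ for m = 6. The pairs c₂d₃ − c₃d₂ and c₀d₅ − c₅d₀ cancel by
the condition with κ. -/
lemma tendsto_cubeForm_of_boundarySpace {l ξ : ℕ} (hl : l = 1 ∨ l = 2) (hξ : ξ = 1 ∨ ξ = 2) {κ : ℝ}
    {c d : ℕ → ℂ} (hc : (fun j : Fin 6 => c j) ∈ boundarySpace l ξ κ)
    (hd : (fun j : Fin 6 => d j) ∈ boundarySpace l ξ κ) :
    Tendsto (fun r : ℝ => cubeForm ((l : ℂ) * (l + 1)) r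
      (fun j => jetPoly (fun i => c (j + i)) (6 - j) r)
      (fun j => jetPoly (fun i => d (j + i)) (6 - j) r)) (𝓝[>] 0) (𝓝 0) := by
  have key : ∃ K : ℝ → ℂ, Continuous K ∧ ∀ r : ℝ, r ≠ 0 → cubeForm ((l : ℂ) * (l + 1)) r
      (fun j => jetPoly (fun i => c (j + i)) (6 - j) r)
      (fun j => jetPoly (fun i => d (j + i)) (6 - j) r) = K r * r := by
    obtain ⟨K, hK, h⟩ := exists_cubeForm_jetPoly ((l : ℂ) * (l + 1)) c d
    refine ⟨K, hK, fun r hr => ?_⟩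
    · rw [h r hr, add_eq_right, div_eq_zero_iff]
      left
      rcases hl with rfl | rfl <;> rcases hξ with rfl | rfl
      · obtain ⟨c0, c1, c2⟩ : c 0 = 0 ∧ c 1 = 0 ∧ (κ : ℂ) * c 2 = c 3 := hc
        obtain ⟨d0, d1, d2⟩ : d 0 = 0 ∧ d 1 = 0 ∧ (κ : ℂ) * d 2 = d 3 := hd
        rw [c0, d0, c1, d1, ← c2, ← d2]
        push_cast
        ring
      · obtain ⟨c0, c1, c2⟩ : c 0 = 0 ∧ c 4 = 0 ∧ (κ : ℂ) * c 2 = c 3 := hc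
        obtain ⟨d0, d1, d2⟩ : d 0 = 0 ∧ d 4 = 0 ∧ (κ : ℂ) * d 2 = d 3 := hd
        rw [c0, d0, c1, d1, ← c2, ← d2]
        push_cast
        ring
      · obtain ⟨c0, c1, c2⟩ : c 0 = 0 ∧ c 1 = 0 ∧ (κ : ℂ) * c 2 = c 3 := hc
        obtain ⟨d0, d1, d2⟩ : d 0 = 0 ∧ d 1 = 0 ∧ (κ : ℂ) * d 2 = d 3 := hd
        rw [c0, d0, c1, d1, ← c2, ← d2]
        push_cast
        ring
      · obtain ⟨c0, c1, c2, c3⟩ : c 1 = 0 ∧ c 3 = 0 ∧ c 4 = 0 ∧ (κ : ℂ) ^ 5 * c 0 = c 5 := hc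
        obtain ⟨d0, d1, d2, d3⟩ : d 1 = 0 ∧ d 3 = 0 ∧ d 4 = 0 ∧ (κ : ℂ) ^ 5 * d 0 = d 5 := hd
        rw [c0, d0, c1, d1, c2, d2, ← c3, ← d3]
        push_cast
        ring
  obtain ⟨K, hK, h⟩ := key
  have h1 : Tendsto (fun r : ℝ => K r * (r : ℂ)) (𝓝[>] 0) (𝓝 (K 0 * ((0 : ℝ) : ℂ))) :=
    (Continuous.tendsto (by fun_prop) 0).mono_left nhdsWithin_le_nhds
  rw [Complex.ofReal_zero, mul_zero] at h1
  refine h1.congr' ?_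
  filter_upwards [self_mem_nhdsWithin] with r hr using (h r (ne_of_gt hr)).symm

end BoundaryForm

/-! ### Complex conjugation and symmetry of the operator. -/

section Symmetry

lemma iteratedDerivWithin_star (f : ℝ → ℂ) (j : ℕ) :
    iteratedDerivWithin j (fun r => star (f r)) (Ici 0) =
      fun r => star (iteratedDerivWithin j f (Ici 0) r) := by
  induction j with
  | zero => simp
  | succ j ih =>
    funext r
    rw [iteratedDerivWithin_succ, ih, iteratedDerivWithin_succ, derivWithin.star]

lemma MemLp.star_comp {f : ℝ → ℂ} {μ : Measure ℝ} (hf : MemLp f 2 μ) :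
    MemLp (fun r => star (f r)) 2 μ := by
  refine hf.congr_norm ?_ (Eventually.of_forall fun r => (norm_star _).symm)
  exact continuous_star.comp_aestronglyMeasurable hf.1

lemma IsSobolevSix.star {f : ℝ → ℂ} (hf : IsSobolevSix f) :
    IsSobolevSix fun r => star (f r) := by
  obtain ⟨h, hh, hint⟩ := hf.exists_sixth
  refine ⟨MemLp.star_comp hf.memLp, ?_, fun r => Star.star (h r), MemLp.star_comp hh,
    fun r hr => ?_⟩
  · exact Complex.conjCLE.contDiff.comp_contDiffOn hf.contDiffOn
  · rw [iteratedDerivWithin_star]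
    simp only [hint r hr, star_add]
    congr 1
    rw [intervalIntegral.integral_of_le hr, intervalIntegral.integral_of_le hr]
    exact integral_conj.symm

lemma radialOp_star (l : ℕ) (f : ℝ → ℂ) :
    radialOp l (fun r => star (f r)) = fun r => star (radialOp l f r) := by
  have h1 : deriv (fun r => star (f r)) = fun r => star (deriv f r) := by
    funext r; exact deriv.star
  funext r
  simp only [radialOp, h1]
  rw [deriv.star]
  simp

lemma radialOpCube_star (l : ℕ) (f : ℝ → ℂ) :
    radialOpCube l (fun r => star (f r)) = fun r => star (radialOpCube l f r) := by
  simp only [radialOpCube, Function.iterate_succ, Function.iterate_zero, Function.comp_apply, id,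
    radialOp_star]

lemma boundarySpace_star {l ξ : ℕ} {κ : ℝ} {c : Fin 6 → ℂ} (hc : c ∈ boundarySpace l ξ κ) :
    (fun j => star (c j)) ∈ boundarySpace l ξ κ := by
  unfold boundarySpace at hc ⊢
  split_ifs at hc ⊢
  · obtain ⟨c0, c1, c2⟩ := hc
    refine ⟨by simp [c0], by simp [c1], ?_⟩
    simp [← c2]
  · obtain ⟨c0, c1, c2⟩ := hc
    refine ⟨by simp [c0], by simp [c1], ?_⟩
    simp [← c2]
  · obtain ⟨c0, c1, c2, c3⟩ := hc
    refine ⟨by simp [c0], by simp [c1], by simp [c2], ?_⟩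
    simp [← c3]

/-- Green's formula is bilinear, so it is applied to the conjugate of f and to g. The boundary
conditions survive conjugation because κ is real. -/
lemma IsRadialPair.inner_eq {l ξ : ℕ} (hl : l = 1 ∨ l = 2) (hξ : ξ = 1 ∨ ξ = 2) {κ : ℝ}
    {u v u' v' : HalfLineL2} (h : IsRadialPair l ξ κ u v) (h' : IsRadialPair l ξ κ u' v') :
    inner ℂ v u' = inner ℂ u v' := by
  obtain ⟨f, hf, bf, uf, vf⟩ := h
  obtain ⟨g, hg, bg, ug, vg⟩ := h'
  have hTf : MemLp (radialOpCube l f) 2 halfLine := (memLp_congr_ae vf).1 (Lp.memLp v)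
  have hTg : MemLp (radialOpCube l g) 2 halfLine := (memLp_congr_ae vg).1 (Lp.memLp v')
  have bf' : (fun j : Fin 6 => iteratedDerivWithin j (fun r => star (f r)) (Ici 0) 0) ∈
      boundarySpace l ξ κ := by
    simp only [iteratedDerivWithin_star]
    exact boundarySpace_star bf
  have hlim := tendsto_cubeForm_of_boundarySpace hl hξ
    (c := fun i => iteratedDerivWithin i (fun r => star (f r)) (Ici 0) 0)
    (d := fun i => iteratedDerivWithin i g (Ici 0) 0) bf' bg
  have hTf' : MemLp (radialOpCube l fun r => star (f r)) 2 halfLine := by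
    rw [radialOpCube_star]; exact MemLp.star_comp hTf
  have key := integral_radialOpCube_mul hf.star hg hTf' hTg hlim
  rw [radialOpCube_star] at key
  rw [L2.inner_def, L2.inner_def]
  have e1 : ∫ r, inner ℂ (v r) (u' r) ∂halfLine =
      ∫ r, star (radialOpCube l f r) * g r ∂halfLine := by
    refine integral_congr_ae ?_
    filter_upwards [vf, ug] with r h1 h2
    rw [h1, h2, RCLike.inner_apply, mul_comm]
    rfl
  have e2 : ∫ r, inner ℂ (u r) (v' r) ∂halfLine =
      ∫ r, star (f r) * radialOpCube l g r ∂halfLine := by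
    refine integral_congr_ae ?_
    filter_upwards [uf, vg] with r h1 h2
    rw [h1, h2, RCLike.inner_apply, mul_comm]
    rfl
  rw [e1, e2, key]

lemma radialCubeOperator_isRadialPair (l ξ : ℕ) (κ : ℝ) (x : (radialCubeOperator l ξ κ).domain) :
    IsRadialPair l ξ κ x (radialCubeOperator l ξ κ x) := by
  have h := (radialCubeOperator l ξ κ).mem_graph x
  rwa [radialCubeOperator_graph] at h

lemma radialCubeOperator_symmetric {l ξ : ℕ} (hl : l = 1 ∨ l = 2) (hξ : ξ = 1 ∨ ξ = 2) (κ : ℝ)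
    (x y : (radialCubeOperator l ξ κ).domain) :
    inner ℂ (radialCubeOperator l ξ κ x) (y : HalfLineL2) =
      inner ℂ (x : HalfLineL2) (radialCubeOperator l ξ κ y) :=
  (radialCubeOperator_isRadialPair l ξ κ x).inner_eq hl hξ (radialCubeOperator_isRadialPair l ξ κ y)

lemma IsRadialPair.exists_domain {l ξ : ℕ} {κ : ℝ} {u v : HalfLineL2}
    (h : IsRadialPair l ξ κ u v) :
    ∃ x : (radialCubeOperator l ξ κ).domain, (x : HalfLineL2) = u ∧
      radialCubeOperator l ξ κ x = v := by
  have h1 : (u, v) ∈ (radialCubeOperator l ξ κ).graph := by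
    rw [radialCubeOperator_graph]; exact h
  exact (LinearPMap.mem_graph_iff _).1 h1

end Symmetry

/-! ### The operator intertwining T with −d²/dr². -/

section Darboux

open scoped ContDiff

/-- The first-order (`l = 1`) or second-order (`l = 2`) operator intertwining `-d²/dr²` with
`-d²/dr² + l(l+1)/r²`. -/
def darboux (l : ℕ) (w : ℝ → ℂ) : ℝ → ℂ := fun r =>
  if l = 1 then deriv w r - w r / r
  else deriv (deriv w) r - 3 * deriv w r / r + 3 * w r / (r : ℂ) ^ 2

lemma ContDiff.hasDerivAt_deriv {w : ℝ → ℂ} (hw : ContDiff ℝ ∞ w) (r : ℝ) :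
    HasDerivAt w (deriv w r) r :=
  ((hw.differentiable (by simp)) r).hasDerivAt

lemma ContDiff.deriv_infty {w : ℝ → ℂ} (hw : ContDiff ℝ ∞ w) : ContDiff ℝ ∞ (deriv w) :=
  (contDiff_infty_iff_deriv.1 hw).2

lemma ContDiff.iteratedDeriv_infty {w : ℝ → ℂ} (hw : ContDiff ℝ ∞ w) (n : ℕ) :
    ContDiff ℝ ∞ (iteratedDeriv n w) := by
  induction n with
  | zero => simpa using hw
  | succ n ih => rw [iteratedDeriv_succ]; exact ih.deriv_infty

lemma ContDiff.hasDerivAt_iteratedDeriv {w : ℝ → ℂ} (hw : ContDiff ℝ ∞ w) (n : ℕ) (r : ℝ) :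
    HasDerivAt (iteratedDeriv n w) (iteratedDeriv (n + 1) w r) r := by
  rw [iteratedDeriv_succ]
  exact (hw.iteratedDeriv_infty n).hasDerivAt_deriv r

lemma darboux_congr {l : ℕ} {v w : ℝ → ℂ} {s : Set ℝ} (hs : IsOpen s) (h : EqOn v w s) :
    EqOn (darboux l v) (darboux l w) s := by
  intro r hr
  have h1 : v =ᶠ[𝓝 r] w := h.eventuallyEq_of_mem (hs.mem_nhds hr)
  simp only [darboux, h hr, h1.deriv_eq, h1.deriv.deriv_eq]

/-- Here D is (d/dr − 1/r) for l = 1 and (d/dr − 2/r)(d/dr − 1/r) for l = 2, and each factor (d/dr −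
l/r) raises the angular momentum from l − 1 to l. The proof is a direct computation. -/
lemma radialOp_darboux {l : ℕ} (hl : l = 1 ∨ l = 2) {w : ℝ → ℂ} (hw : ContDiff ℝ ∞ w) :
    EqOn (radialOp l (darboux l w)) (darboux l (-deriv (deriv w))) (Ioi 0) := by
  have h0 := hw.hasDerivAt_deriv
  have h1 := hw.deriv_infty.hasDerivAt_deriv
  have h2 := hw.deriv_infty.deriv_infty.hasDerivAt_deriv
  have h3 := hw.deriv_infty.deriv_infty.deriv_infty.hasDerivAt_deriv
  have e1 : deriv (-deriv (deriv w)) = -deriv (deriv (deriv w)) := by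
    funext r; rw [deriv.neg]; rfl
  have e2 : deriv (-deriv (deriv (deriv w))) = -deriv (deriv (deriv (deriv w))) := by
    funext r; rw [deriv.neg]; rfl
  intro r hr
  have hr' : (r : ℂ) ≠ 0 := Complex.ofReal_ne_zero.2 (ne_of_gt hr)
  rcases hl with rfl | rfl
  · have d0 : darboux 1 w = fun r => deriv w r - 1 / (r : ℂ) ^ 1 * w r := by
      funext r; simp only [darboux, if_true]; ring
    have d1 : ∀ s : ℝ, 0 < s → HasDerivAt (darboux 1 w)
        (deriv (deriv w) s - (1 / (s : ℂ) ^ 1 * deriv w s - 1 / (s : ℂ) ^ 2 * w s)) s := by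
      intro s hs
      rw [d0]
      refine ((h1 s).sub (hasDerivAt_div_pow_mul (ne_of_gt hs) 1 1 (h0 s))).congr_deriv ?_
      push_cast; ring
    have d2 : HasDerivAt (fun s : ℝ => deriv (deriv w) s - (1 / (s : ℂ) ^ 1 * deriv w s -
        1 / (s : ℂ) ^ 2 * w s)) _ r :=
      (h2 r).sub ((hasDerivAt_div_pow_mul (ne_of_gt hr) 1 1 (h1 r)).sub
        (hasDerivAt_div_pow_mul (ne_of_gt hr) 1 2 (h0 r)))
    rw [radialOp_of_hasDerivAt hr d1 d2, d0]
    simp only [darboux, if_true, e1, Pi.neg_apply]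
    push_cast
    field_simp
    ring
  · have d0 : darboux 2 w = fun r => deriv (deriv w) r - 3 / (r : ℂ) ^ 1 * deriv w r +
        3 / (r : ℂ) ^ 2 * w r := by
      funext r; simp only [darboux]; norm_num; ring
    have d1 : ∀ s : ℝ, 0 < s → HasDerivAt (darboux 2 w)
        (deriv (deriv (deriv w)) s - 3 / (s : ℂ) ^ 1 * deriv (deriv w) s +
          6 / (s : ℂ) ^ 2 * deriv w s - 6 / (s : ℂ) ^ 3 * w s) s := by
      intro s hs
      rw [d0]
      refine (((h2 s).sub (hasDerivAt_div_pow_mul (ne_of_gt hs) 3 1 (h1 s))).add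
        (hasDerivAt_div_pow_mul (ne_of_gt hs) 3 2 (h0 s))).congr_deriv ?_
      push_cast; ring
    have d2 : HasDerivAt (fun s : ℝ => deriv (deriv (deriv w)) s -
        3 / (s : ℂ) ^ 1 * deriv (deriv w) s +
          6 / (s : ℂ) ^ 2 * deriv w s - 6 / (s : ℂ) ^ 3 * w s) _ r :=
      (((h3 r).sub (hasDerivAt_div_pow_mul (ne_of_gt hr) 3 1 (h2 r))).add
        (hasDerivAt_div_pow_mul (ne_of_gt hr) 6 2 (h1 r))).sub
        (hasDerivAt_div_pow_mul (ne_of_gt hr) 6 3 (h0 r))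
    rw [radialOp_of_hasDerivAt hr d1 d2, d0]
    simp only [darboux, e1, e2, Pi.neg_apply]
    norm_num
    field_simp
    ring

lemma radialOp_radialOp_darboux {l : ℕ} (hl : l = 1 ∨ l = 2) {w : ℝ → ℂ} (hw : ContDiff ℝ ∞ w) :
    EqOn (radialOp l (radialOp l (darboux l w))) (darboux l (iteratedDeriv 4 w)) (Ioi 0) := by
  have h1 : ContDiff ℝ ∞ (-deriv (deriv w)) := hw.deriv_infty.deriv_infty.neg
  have e : -deriv (deriv (-deriv (deriv w))) = iteratedDeriv 4 w := by
    have e1 : deriv (-deriv (deriv w)) = -deriv (deriv (deriv w)) := by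
      funext r; rw [deriv.neg]; rfl
    have e2 : deriv (-deriv (deriv (deriv w))) = -deriv (deriv (deriv (deriv w))) := by
      funext r; rw [deriv.neg]; rfl
    rw [e1, e2, neg_neg, iteratedDeriv_eq_iterate]
    rfl
  rw [← e]
  exact (radialOp_congr (radialOp_darboux hl hw)).trans (radialOp_darboux hl h1)

lemma radialOpCube_darboux {l : ℕ} (hl : l = 1 ∨ l = 2) {w : ℝ → ℂ} (hw : ContDiff ℝ ∞ w) :
    EqOn (radialOpCube l (darboux l w)) (darboux l (-iteratedDeriv 6 w)) (Ioi 0) := by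
  have h := (radialOp_congr (l := l) (radialOp_radialOp_darboux hl hw)).trans
    (radialOp_darboux hl (hw.iteratedDeriv_infty 4))
  have e : deriv (deriv (iteratedDeriv 4 w)) = iteratedDeriv 6 w := by
    rw [← iteratedDeriv_succ, ← iteratedDeriv_succ]
  rwa [e] at h

end Darboux

/-! ### Test functions on (0, ∞). -/

section TestFunctions

open scoped ContDiff

/-- Smooth functions supported in a compact interval `[a, b]` of `(0, ∞)`. -/
structure IsTestOn (a b : ℝ) (g : ℝ → ℂ) : Prop where
  pos : 0 < a
  le : a ≤ b
  smooth : ContDiff ℝ ∞ g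
  eq_zero : ∀ r, r ∉ Icc a b → g r = 0

/-- Division by `r` of a smooth function vanishing on a half-line `(-∞, a)` with `a > 0`. -/
lemma contDiff_div_ofReal {φ : ℝ → ℂ} {a : ℝ} (ha : 0 < a) (hφ : ContDiff ℝ ∞ φ)
    (h0 : ∀ r < a, φ r = 0) : ContDiff ℝ ∞ fun r : ℝ => φ r / (r : ℂ) := by
  rw [contDiff_iff_contDiffAt]
  intro r
  rcases lt_or_ge r a with hr | hr
  · have h1 : (fun r : ℝ => φ r / (r : ℂ)) =ᶠ[𝓝 r] fun _ => 0 := by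
      filter_upwards [Iio_mem_nhds hr] with s hs
      rw [h0 s hs, zero_div]
    exact contDiffAt_const.congr_of_eventuallyEq h1
  · have h1 : ContDiffAt ℝ ∞ (fun r : ℝ => (r : ℂ)) r := Complex.ofRealCLM.contDiff.contDiffAt
    simp only [div_eq_mul_inv]
    exact hφ.contDiffAt.mul (h1.inv (Complex.ofReal_ne_zero.2 (ne_of_gt (ha.trans_le hr))))

variable {a b : ℝ} {g h : ℝ → ℂ}

lemma IsTestOn.deriv (hg : IsTestOn a b g) : IsTestOn a b (deriv g) := by
  refine ⟨hg.pos, hg.le, hg.smooth.deriv_infty, fun r hr => ?_⟩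
  have h1 : g =ᶠ[𝓝 r] fun _ => 0 := by
    filter_upwards [isClosed_Icc.isOpen_compl.mem_nhds hr] with s hs using hg.eq_zero s hs
  rw [h1.deriv_eq, deriv_const]

lemma IsTestOn.iteratedDeriv (hg : IsTestOn a b g) (n : ℕ) : IsTestOn a b (iteratedDeriv n g) := by
  induction n with
  | zero => simpa using hg
  | succ n ih => rw [iteratedDeriv_succ]; exact ih.deriv

lemma IsTestOn.div (hg : IsTestOn a b g) : IsTestOn a b fun r => g r / (r : ℂ) :=
  ⟨hg.pos, hg.le, contDiff_div_ofReal hg.pos hg.smooth fun r hr =>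
    hg.eq_zero r fun h => absurd h.1 (not_le.2 hr), fun r hr => by rw [hg.eq_zero r hr, zero_div]⟩

lemma IsTestOn.add (hg : IsTestOn a b g) (hh : IsTestOn a b h) :
    IsTestOn a b fun r => g r + h r :=
  ⟨hg.pos, hg.le, hg.smooth.add hh.smooth, fun r hr => by
    rw [hg.eq_zero r hr, hh.eq_zero r hr, add_zero]⟩

lemma IsTestOn.const_mul (hg : IsTestOn a b g) (c : ℂ) : IsTestOn a b fun r => c * g r :=
  ⟨hg.pos, hg.le, contDiff_const.mul hg.smooth, fun r hr => by rw [hg.eq_zero r hr, mul_zero]⟩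

lemma IsTestOn.zero (ha : 0 < a) (hab : a ≤ b) : IsTestOn a b fun _ => 0 :=
  ⟨ha, hab, contDiff_const, fun _ _ => rfl⟩

lemma IsTestOn.darboux (hg : IsTestOn a b g) (l : ℕ) : IsTestOn a b (darboux l g) := by
  by_cases hl : l = 1
  · have h1 := hg.deriv.add (hg.div.const_mul (-1))
    have e : _root_.darboux l g = fun r => _root_.deriv g r + -1 * (g r / (r : ℂ)) := by
      funext r; simp only [_root_.darboux, hl, if_true]; ring
    rwa [e]
  · have h1 := (hg.deriv.deriv.add (hg.deriv.div.const_mul (-3))).add (hg.div.div.const_mul 3)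
    have e : _root_.darboux l g = fun r => _root_.deriv (_root_.deriv g) r +
        -3 * (_root_.deriv g r / (r : ℂ)) + 3 * (g r / (r : ℂ) / (r : ℂ)) := by
      funext r
      simp only [_root_.darboux, hl, if_false]
      rw [div_div, ← sq]
      ring
    rwa [e]

/-- On test functions, `T_l³` factors through the intertwining operator. -/
lemma IsTestOn.exists_radialOpCube_eq_darboux {l : ℕ} (hl : l = 1 ∨ l = 2) (hg : IsTestOn a b g) :
    ∃ g₀, IsTestOn a b g₀ ∧ EqOn (radialOpCube l g) (_root_.darboux l g₀) (Ioi 0) := by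
  have h0 := hg.smooth.hasDerivAt_deriv
  have h1 := hg.smooth.deriv_infty.hasDerivAt_deriv
  have h2 := hg.smooth.deriv_infty.deriv_infty.hasDerivAt_deriv
  have h3 := hg.smooth.deriv_infty.deriv_infty.deriv_infty.hasDerivAt_deriv
  rcases hl with rfl | rfl
  -- This is q = D*g, with D* the formal adjoint. Since T = D D* for l = 1, T³g = T²(Dq) = D q⁽⁴⁾.
  · let q : ℝ → ℂ := fun r => (-1) * (_root_.deriv g r + g r / (r : ℂ))
    have hq : IsTestOn a b q := (hg.deriv.add hg.div).const_mul (-1)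
    refine ⟨_, hq.iteratedDeriv 4, ?_⟩
    refine EqOn.trans ?_ (radialOp_radialOp_darboux (Or.inl rfl) hq.smooth)
    refine radialOp_congr (radialOp_congr ?_)
    intro r hr
    have hr' : (r : ℂ) ≠ 0 := Complex.ofReal_ne_zero.2 (ne_of_gt hr)
    have d1 : HasDerivAt q (-1 * (_root_.deriv (_root_.deriv g) r +
        (1 / (r : ℂ) ^ 1 * _root_.deriv g r - (1 : ℕ) * 1 / (r : ℂ) ^ (1 + 1) * g r))) r := by
      have e : q = fun r : ℝ => -1 * (_root_.deriv g r + 1 / (r : ℂ) ^ 1 * g r) := by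
        funext r; simp only [q]; ring
      rw [e]
      exact ((h1 r).add (hasDerivAt_div_pow_mul (ne_of_gt hr) 1 1 (h0 r))).const_mul (-1)
    simp only [_root_.darboux, if_true, radialOp, d1.deriv, q]
    push_cast
    field_simp
    ring
  -- Again q = D*g. For l = 2 the factorization is T² = D D*, so T³g = T(Dq) = D(−q″).
  · let q : ℝ → ℂ := fun r => _root_.deriv (_root_.deriv g) r + 3 * (_root_.deriv g r / (r : ℂ))
    have hq : IsTestOn a b q := hg.deriv.deriv.add (hg.deriv.div.const_mul 3)
    refine ⟨_, (hq.deriv.deriv).const_mul (-1), ?_⟩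
    have hfun : (fun r => -1 * _root_.deriv (_root_.deriv q) r) =
        -_root_.deriv (_root_.deriv q) := by
      funext r; simp
    rw [hfun]
    refine EqOn.trans ?_ (radialOp_darboux (Or.inr rfl) hq.smooth)
    refine radialOp_congr ?_
    have hF := radialOp_radialOp_eqOn_quasiTwo (F := fun j => _root_.iteratedDeriv j g) 2
      fun r _ j _ => hg.smooth.hasDerivAt_iteratedDeriv j r
    rw [iteratedDeriv_zero] at hF
    refine hF.trans ?_
    intro r hr
    have hr' : (r : ℂ) ≠ 0 := Complex.ofReal_ne_zero.2 (ne_of_gt hr)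
    have e : q = fun r : ℝ => _root_.deriv (_root_.deriv g) r + 3 / (r : ℂ) ^ 1 * _root_.deriv g r := by
      funext r; simp only [q]; ring
    have d1 : ∀ s : ℝ, 0 < s → HasDerivAt q (_root_.deriv (_root_.deriv (_root_.deriv g)) s +
        (3 / (s : ℂ) ^ 1 * _root_.deriv (_root_.deriv g) s - 3 / (s : ℂ) ^ 2 * _root_.deriv g s)) s := by
      intro s hs
      rw [e]
      refine ((h2 s).add (hasDerivAt_div_pow_mul (ne_of_gt hs) 3 1 (h1 s))).congr_deriv ?_
      push_cast; ring
    have d2 : HasDerivAt (fun s : ℝ => _root_.deriv (_root_.deriv (_root_.deriv g)) s +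
        (3 / (s : ℂ) ^ 1 * _root_.deriv (_root_.deriv g) s - 3 / (s : ℂ) ^ 2 * _root_.deriv g s)) _ r :=
      (h3 r).add ((hasDerivAt_div_pow_mul (ne_of_gt hr) 3 1 (h2 r)).sub
        (hasDerivAt_div_pow_mul (ne_of_gt hr) 3 2 (h1 r)))
    have e1 : _root_.deriv q =ᶠ[𝓝 r] fun s : ℝ => _root_.deriv (_root_.deriv (_root_.deriv g)) s +
        (3 / (s : ℂ) ^ 1 * _root_.deriv (_root_.deriv g) s -
          3 / (s : ℂ) ^ 2 * _root_.deriv g s) := by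
      filter_upwards [Ioi_mem_nhds hr] with s hs using (d1 s hs).deriv
    simp only [_root_.darboux, e1.deriv_eq, d2.deriv, (d1 r hr).deriv, quasiTwo,
      iteratedDeriv_eq_iterate, Function.iterate_succ, Function.iterate_zero, Function.comp_apply, id]
    simp only [q]
    norm_num
    field_simp
    ring

end TestFunctions

/-! ### Exponential sums and their independence. -/

section Exponentials

open scoped ContDiff

/-- The exponential sum `∑ a_j e^{k_j r}`. -/
def expSum {n : ℕ} (k a : Fin n → ℂ) (r : ℝ) : ℂ := ∑ j, a j * Complex.exp (k j * r)

variable {n : ℕ} {k a : Fin n → ℂ}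

lemma hasDerivAt_cexp_mul (z : ℂ) (r : ℝ) :
    HasDerivAt (fun r : ℝ => Complex.exp (z * r)) (z * Complex.exp (z * r)) r := by
  have h1 : HasDerivAt (fun w : ℂ => Complex.exp (z * w)) (z * Complex.exp (z * r)) (r : ℂ) := by
    simpa [mul_comm] using ((hasDerivAt_id (r : ℂ)).const_mul z).cexp
  exact h1.comp_ofReal

lemma hasDerivAt_expSum (r : ℝ) :
    HasDerivAt (expSum k a) (expSum k (fun j => a j * k j) r) r := by
  refine (HasDerivAt.fun_sum fun j _ => (hasDerivAt_cexp_mul (k j) r).const_mul (a j)).congr_deriv ?_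
  exact Finset.sum_congr rfl fun j _ => by ring

lemma deriv_expSum : deriv (expSum k a) = expSum k fun j => a j * k j :=
  funext fun r => (hasDerivAt_expSum r).deriv

lemma iteratedDeriv_expSum (m : ℕ) :
    iteratedDeriv m (expSum k a) = expSum k fun j => a j * k j ^ m := by
  induction m with
  | zero => simp
  | succ m ih =>
    rw [iteratedDeriv_succ, ih, deriv_expSum]
    congr 1
    funext j
    ring

lemma contDiff_expSum : ContDiff ℝ ∞ (expSum k a) := by
  unfold expSum
  have : ∀ j, ContDiff ℝ ∞ fun r : ℝ => Complex.exp (k j * r) := fun j =>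
    (contDiff_const.mul Complex.ofRealCLM.contDiff).cexp
  exact ContDiff.sum fun j _ => contDiff_const.mul (this j)

/-- Exponentials with distinct non-zero exponents stay linearly independent after applying the
intertwining operator. -/
lemma eq_zero_of_darboux_expSum {l : ℕ} (hl : l = 1 ∨ l = 2) (hk : Function.Injective k)
    (hk0 : ∀ j, k j ≠ 0) (h : EqOn (darboux l (expSum k a)) 0 (Ioi 0)) : a = 0 := by
  have hd : ∀ m r, HasDerivAt (expSum k fun j => a j * k j ^ m)
      (expSum k (fun j => a j * k j ^ (m + 1)) r) r := by
    intro m r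
    refine (hasDerivAt_expSum r).congr_deriv ?_
    simp only [pow_succ, mul_assoc]
  have hz : ∀ {f f' : ℝ → ℂ}, (∀ r, HasDerivAt f (f' r) r) → EqOn f 0 (Ioi 0) →
      EqOn f' 0 (Ioi 0) := by
    intro f f' hf h0 r hr
    have h1 : f =ᶠ[𝓝 r] fun _ => 0 := h0.eventuallyEq_of_mem (Ioi_mem_nhds hr)
    rw [← (hf r).deriv, h1.deriv_eq, deriv_const]
    rfl
  let W : ℕ → ℝ → ℂ := fun m => expSum k fun j => a j * k j ^ m
  have hW : ∀ m r, HasDerivAt (W m) (W (m + 1) r) r := hd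
  have hW0 : expSum k a = W 0 := by simp [W]
  have hr1 : ∀ r : ℝ, HasDerivAt (fun r : ℝ => (r : ℂ)) 1 r := fun r =>
    (hasDerivAt_id (r : ℂ)).comp_ofReal
  -- The kernel of D is spanned by r for l = 1 and by r, r³ for l = 2, so the fourth derivative of
  -- the exponential sum vanishes. It is reached by clearing denominators and differentiating,
  -- without solving the equation.
  have h4 : EqOn (W 4) 0 (Ioi 0) := by
    have e1 : deriv (W 0) = W 1 := funext fun r => (hW 0 r).deriv
    have e2 : deriv (W 1) = W 2 := funext fun r => (hW 1 r).deriv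
    rcases hl with rfl | rfl
    · have z0 : EqOn (fun r : ℝ => (r : ℂ) * W 1 r - W 0 r) 0 (Ioi 0) := by
        intro r hr
        have h1 := h hr
        have hr' : (r : ℂ) ≠ 0 := Complex.ofReal_ne_zero.2 (ne_of_gt hr)
        simp only [darboux, if_true, hW0, e1, Pi.zero_apply] at h1
        field_simp at h1
        simp only [Pi.zero_apply]
        linear_combination h1
      have z1 := hz (fun r => ((hr1 r).mul (hW 1 r)).sub (hW 0 r)) z0
      have z2 : EqOn (W 2) 0 (Ioi 0) := by
        intro r hr
        have h1 := z1 hr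
        have hr' : (r : ℂ) ≠ 0 := Complex.ofReal_ne_zero.2 (ne_of_gt hr)
        simp only [one_mul, Pi.zero_apply, zero_add, add_sub_cancel_left, mul_eq_zero] at h1
        exact h1.resolve_left hr'
      exact hz (hW 3) (hz (hW 2) z2)
    · have z0 : EqOn (fun r : ℝ => (r : ℂ) * ((r : ℂ) * W 2 r) - 3 * ((r : ℂ) * W 1 r) + 3 * W 0 r)
          0 (Ioi 0) := by
        intro r hr
        have h1 := h hr
        have hr' : (r : ℂ) ≠ 0 := Complex.ofReal_ne_zero.2 (ne_of_gt hr)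
        simp only [darboux, hW0, e1, e2, Pi.zero_apply] at h1
        norm_num at h1
        field_simp at h1
        simp only [Pi.zero_apply]
        linear_combination h1
      have z1 := hz (fun r => (((hr1 r).mul ((hr1 r).mul (hW 2 r))).sub
        (((hr1 r).mul (hW 1 r)).const_mul 3)).add ((hW 0 r).const_mul 3)) z0
      have z1' : EqOn (fun r : ℝ => (r : ℂ) * W 3 r - W 2 r) 0 (Ioi 0) := by
        intro r hr
        have h1 := z1 hr
        have hr' : (r : ℂ) ≠ 0 := Complex.ofReal_ne_zero.2 (ne_of_gt hr)
        simp only [Pi.zero_apply, zero_add, Pi.mul_apply] at h1 ⊢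
        refine (mul_eq_zero.1 (?_ : (r : ℂ) * _ = 0)).resolve_left hr'
        linear_combination h1
      have z2 := hz (fun r => ((hr1 r).mul (hW 3 r)).sub (hW 2 r)) z1'
      intro r hr
      have h1 := z2 hr
      have hr' : (r : ℂ) ≠ 0 := Complex.ofReal_ne_zero.2 (ne_of_gt hr)
      simp only [one_mul, Pi.zero_apply, add_sub_cancel_left, mul_eq_zero] at h1
      exact h1.resolve_left hr'
  have hall : ∀ m, EqOn (W (4 + m)) 0 (Ioi 0) := by
    intro m
    induction m with
    | zero => exact h4
    | succ m ih => exact hz (hW (4 + m)) ih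
  -- All derivatives of order at least 4 vanish at r = 1, which is a Vandermonde system. Its
  -- unknowns contain k_j⁴, and this is why the exponents must be non-zero.
  have hv := Matrix.eq_zero_of_forall_pow_sum_mul_pow_eq_zero (f := k)
    (v := fun j => a j * k j ^ 4 * Complex.exp (k j * (1 : ℝ))) hk fun i => by
      have h1 := hall i (mem_Ioi.2 one_pos)
      simp only [W, expSum, Pi.zero_apply] at h1
      rw [← h1]
      refine Finset.sum_congr rfl fun j _ => ?_
      rw [pow_add]
      ring
  funext j
  have h1 := congrFun hv j
  simp only [Pi.zero_apply, mul_eq_zero, Complex.exp_ne_zero, or_false] at h1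
  exact h1.resolve_right (pow_ne_zero 4 (hk0 j))

/-- The sum extends to an entire function vanishing at 0, so its slope at 0 is entire as well. -/
lemma exists_contDiff_expSum_eq_mul (h : ∑ j, a j = 0) :
    ∃ G : ℝ → ℂ, ContDiff ℝ ∞ G ∧ ∀ r, expSum k a r = r * G r := by
  let W : ℂ → ℂ := fun z => ∑ j, a j * Complex.exp (k j * z)
  have hW : Differentiable ℂ W := by
    unfold W; fun_prop
  have hW0 : W 0 = 0 := by simpa [W] using h
  have hD : Differentiable ℂ (dslope W 0) := by
    rw [← differentiableOn_univ]
    exact (Complex.differentiableOn_dslope univ_mem).2 hW.differentiableOn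
  have hC : ContDiff ℂ ∞ (dslope W 0) := hD.contDiff
  refine ⟨fun r => dslope W 0 r, (hC.restrict_scalars ℝ).comp Complex.ofRealCLM.contDiff,
    fun r => ?_⟩
  have h1 := sub_smul_dslope W 0 (r : ℂ)
  rw [hW0, sub_zero, sub_zero, smul_eq_mul] at h1
  exact h1.symm

end Exponentials

/-! ### Exponentially decaying functions and membership in H⁶. -/

section Decay

/-- Linear combinations of the functions `e^{zr} / r^n` with `Re z < 0`. -/
inductive ExpDecaying : (ℝ → ℂ) → Prop
  | exp_div (z : ℂ) (hz : z.re < 0) (n : ℕ) :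
      ExpDecaying fun r => Complex.exp (z * r) / (r : ℂ) ^ n
  | add {f g : ℝ → ℂ} (hf : ExpDecaying f) (hg : ExpDecaying g) : ExpDecaying fun r => f r + g r
  | const_mul {f : ℝ → ℂ} (c : ℂ) (hf : ExpDecaying f) : ExpDecaying fun r => c * f r

lemma ExpDecaying.zero : ExpDecaying fun _ => 0 := by
  have h := ExpDecaying.const_mul 0 (ExpDecaying.exp_div (-1) (by norm_num) 0)
  simpa using h

lemma ExpDecaying.sum {ι : Type*} (s : Finset ι) {f : ι → ℝ → ℂ}
    (h : ∀ i ∈ s, ExpDecaying (f i)) : ExpDecaying fun r => ∑ i ∈ s, f i r := by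
  classical
  induction s using Finset.induction_on with
  | empty => simpa using ExpDecaying.zero
  | insert i s hi ih =>
    simp only [Finset.sum_insert hi]
    exact (h i (by simp)).add (ih fun j hj => h j (by simp [hj]))

/-- The class is stable under differentiation, so square integrability at infinity passes to the
sixth derivative. -/
lemma ExpDecaying.exists_hasDerivAt {f : ℝ → ℂ} (hf : ExpDecaying f) :
    ∃ f' : ℝ → ℂ, ExpDecaying f' ∧ ∀ r, 0 < r → HasDerivAt f (f' r) r := by
  induction hf with
  | exp_div z hz n =>
    refine ⟨_, (ExpDecaying.const_mul z (.exp_div z hz n)).add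
      (.const_mul (-n) (.exp_div z hz (n + 1))), fun r hr => ?_⟩
    have h1 := hasDerivAt_div_pow_mul (ne_of_gt hr) 1 n (hasDerivAt_cexp_mul z r)
    have e : (fun r : ℝ => Complex.exp (z * r) / (r : ℂ) ^ n) =
        fun r : ℝ => 1 / (r : ℂ) ^ n * Complex.exp (z * r) := by
      funext r; ring
    rw [e]
    refine h1.congr_deriv ?_
    ring
  | add _ _ ihf ihg =>
    obtain ⟨f', hf', h1⟩ := ihf
    obtain ⟨g', hg', h2⟩ := ihg
    exact ⟨_, hf'.add hg', fun r hr => (h1 r hr).add (h2 r hr)⟩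
  | const_mul c _ ih =>
    obtain ⟨f', hf', h1⟩ := ih
    exact ⟨_, hf'.const_mul c, fun r hr => (h1 r hr).const_mul c⟩

lemma ExpDecaying.memLp {f : ℝ → ℂ} (hf : ExpDecaying f) {b : ℝ} (hb : 0 < b) :
    MemLp f 2 (volume.restrict (Ioi b)) := by
  induction hf with
  | exp_div z hz n =>
    have hm : AEStronglyMeasurable (fun r : ℝ => Complex.exp (z * r) / (r : ℂ) ^ n)
        (volume.restrict (Ioi b)) := by
      refine ContinuousOn.aestronglyMeasurable ?_ measurableSet_Ioi
      refine ContinuousOn.div (by fun_prop) (by fun_prop) fun r hr => ?_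
      exact pow_ne_zero n (Complex.ofReal_ne_zero.2 (ne_of_gt (hb.trans hr)))
    rw [memLp_two_iff_integrable_sq_norm hm]
    have hi : IntegrableOn (fun r : ℝ => ((b ^ n)⁻¹) ^ 2 * Real.exp (2 * z.re * r)) (Ioi b) :=
      (integrableOn_exp_mul_Ioi (by linarith) b).const_mul _
    refine Integrable.mono' hi (hm.norm.pow 2) ?_
    filter_upwards [ae_restrict_mem measurableSet_Ioi] with r hr
    have hr0 : 0 < r := hb.trans hr
    rw [norm_pow, norm_norm, norm_div, norm_pow, Complex.norm_real, Real.norm_of_nonneg hr0.le,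
      Complex.norm_exp, Complex.re_mul_ofReal, div_eq_mul_inv, mul_pow, mul_comm]
    have e : Real.exp (z.re * r) ^ 2 = Real.exp (2 * z.re * r) := by
      rw [← Real.exp_nat_mul]; congr 1; push_cast; ring
    rw [e]
    gcongr
    exact hr.le
  | add _ _ ihf ihg => exact ihf.add ihg
  | const_mul c _ ih => exact ih.const_mul c

open scoped ContDiff

lemma ExpDecaying.iteratedDeriv {f g : ℝ → ℂ} (hg : ExpDecaying g) {b : ℝ} (hb : 0 < b)
    (h : EqOn f g (Ioi b)) (n : ℕ) :
    ∃ g' : ℝ → ℂ, ExpDecaying g' ∧ EqOn (iteratedDeriv n f) g' (Ioi b) := by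
  induction n with
  | zero => exact ⟨g, hg, by simpa using h⟩
  | succ n ih =>
    obtain ⟨g₁, hg₁, h1⟩ := ih
    obtain ⟨g₂, hg₂, h2⟩ := hg₁.exists_hasDerivAt
    refine ⟨g₂, hg₂, fun r hr => ?_⟩
    rw [iteratedDeriv_succ, (h1.eventuallyEq_of_mem (Ioi_mem_nhds hr)).deriv_eq]
    exact (h2 r (hb.trans hr)).deriv

lemma memLp_halfLine_of_eqOn {f g : ℝ → ℂ} (hf : Continuous f) (hg : ExpDecaying g) {b : ℝ}
    (hb : 0 < b) (h : EqOn f g (Ioi b)) : MemLp f 2 halfLine := by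
  have h1 : IntegrableOn (fun r => ‖f r‖ ^ 2) (Ioi b) := by
    refine (memLp_two_iff_integrable_sq_norm hf.aestronglyMeasurable).1 ?_
    refine (memLp_congr_ae ?_).1 (hg.memLp hb)
    filter_upwards [ae_restrict_mem measurableSet_Ioi] with r hr using (h hr).symm
  have h2 : IntegrableOn (fun r => ‖f r‖ ^ 2) (Ioc 0 b) :=
    ((by fun_prop : Continuous fun r => ‖f r‖ ^ 2).integrableOn_Icc).mono_set Ioc_subset_Icc_self
  rw [memLp_two_iff_integrable_sq_norm hf.aestronglyMeasurable]
  have h3 := h2.union h1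
  rwa [Ioc_union_Ioi_eq_Ioi hb.le] at h3

lemma iteratedDerivWithin_Ici_of_contDiff {f : ℝ → ℂ} (hf : ContDiff ℝ ∞ f) (j : ℕ) {r : ℝ}
    (hr : 0 ≤ r) : iteratedDerivWithin j f (Ici 0) r = _root_.iteratedDeriv j f r :=
  iteratedDerivWithin_eq_iteratedDeriv (uniqueDiffOn_Ici 0)
    (hf.contDiffAt.of_le (by exact_mod_cast le_top)) hr

lemma isSobolevSix_of_contDiff {f : ℝ → ℂ} (hf : ContDiff ℝ ∞ f) (h0 : MemLp f 2 halfLine)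
    (h6 : MemLp (_root_.iteratedDeriv 6 f) 2 halfLine) : IsSobolevSix f := by
  refine ⟨h0, (by exact_mod_cast (contDiff_infty.1 hf 5).contDiffOn), _root_.iteratedDeriv 6 f, h6,
    fun r hr => ?_⟩
  rw [iteratedDerivWithin_Ici_of_contDiff hf 5 hr, iteratedDerivWithin_Ici_of_contDiff hf 5 le_rfl,
    intervalIntegral.integral_eq_sub_of_hasDerivAt
      (fun x _ => hf.hasDerivAt_iteratedDeriv 5 x)
      ((hf.iteratedDeriv_infty 6).continuous.intervalIntegrable _ _)]
  ring

lemma isSobolevSix_of_expDecaying {f g : ℝ → ℂ} (hf : ContDiff ℝ ∞ f) (hg : ExpDecaying g) {b : ℝ}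
    (hb : 0 < b) (h : EqOn f g (Ioi b)) : IsSobolevSix f := by
  obtain ⟨g', hg', h'⟩ := hg.iteratedDeriv hb h 6
  exact isSobolevSix_of_contDiff hf (memLp_halfLine_of_eqOn hf.continuous hg hb h)
    (memLp_halfLine_of_eqOn (hf.iteratedDeriv_infty 6).continuous hg' hb h')

end Decay

/-! ### Variation of constants for −w⁽⁶⁾ + cw = g, and jets at the origin. -/

section Resolvent

open scoped ContDiff

/-- The convolution solution of `w' = z w + g` with `w(0) = 0`. -/
def duhamel (z : ℂ) (g : ℝ → ℂ) (r : ℝ) : ℂ :=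
  Complex.exp (z * r) * ∫ s in (0 : ℝ)..r, Complex.exp (-z * s) * g s

variable {a₀ b₀ : ℝ} {g : ℝ → ℂ}

lemma hasDerivAt_duhamel (hg : Continuous g) (z : ℂ) (r : ℝ) :
    HasDerivAt (duhamel z g) (z * duhamel z g r + g r) r := by
  have hc : Continuous fun s : ℝ => Complex.exp (-z * s) * g s := by fun_prop
  have h1 := hc.integral_hasStrictDerivAt 0 r
  refine ((hasDerivAt_cexp_mul z r).mul h1.hasDerivAt).congr_deriv ?_
  rw [← mul_assoc, ← Complex.exp_add]
  simp only [duhamel]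
  rw [show z * r + -z * r = 0 by ring, Complex.exp_zero]
  ring

/-- Bootstrapping: the differential equation expresses the derivative through the function itself
and the smooth g. -/
lemma contDiff_duhamel (hg : ContDiff ℝ ∞ g) (z : ℂ) : ContDiff ℝ ∞ (duhamel z g) := by
  rw [contDiff_infty]
  intro n
  induction n with
  | zero =>
    exact contDiff_zero.2 (continuous_iff_continuousAt.2 fun r =>
      (hasDerivAt_duhamel hg.continuous z r).continuousAt)
  | succ n ih =>
    have h1 : deriv (duhamel z g) = fun r => z * duhamel z g r + g r :=
      funext fun r => (hasDerivAt_duhamel hg.continuous z r).deriv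
    have h2 : ContDiff ℝ ((n : WithTop ℕ∞) + 1) (duhamel z g) := by
      rw [contDiff_succ_iff_deriv]
      refine ⟨fun r => (hasDerivAt_duhamel hg.continuous z r).differentiableAt, by simp, ?_⟩
      rw [h1]
      exact (contDiff_const.mul ih).add (contDiff_infty.1 hg n)
    exact_mod_cast h2

lemma IsTestOn.duhamel_eq_zero (hg : IsTestOn a₀ b₀ g) (z : ℂ) {r : ℝ} (hr : r < a₀) :
    duhamel z g r = 0 := by
  rw [duhamel, intervalIntegral.integral_zero_ae, mul_zero]
  refine Eventually.of_forall fun s hs => ?_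
  rw [hg.eq_zero s, mul_zero]
  intro h
  have h1 : s ≤ max 0 r := hs.2
  rcases le_max_iff.1 h1 with h2 | h2
  · linarith [h.1, hg.pos]
  · linarith [h.1]

lemma IsTestOn.duhamel_eq_exp (hg : IsTestOn a₀ b₀ g) (z : ℂ) {r : ℝ} (hr : b₀ < r) :
    duhamel z g r =
      (∫ s in (0 : ℝ)..b₀, Complex.exp (-z * s) * g s) * Complex.exp (z * r) := by
  have hc : Continuous fun s : ℝ => Complex.exp (-z * s) * g s := by
    have := hg.smooth.continuous
    fun_prop
  rw [duhamel, ← intervalIntegral.integral_add_adjacent_intervals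
    (hc.intervalIntegrable 0 b₀) (hc.intervalIntegrable b₀ r)]
  have h0 : ∫ s in b₀..r, Complex.exp (-z * s) * g s = 0 := by
    refine intervalIntegral.integral_zero_ae (Eventually.of_forall fun s hs => ?_)
    rw [uIoc_of_le hr.le] at hs
    rw [hg.eq_zero s fun h => absurd h.2 (not_le.2 hs.1), mul_zero]
  rw [h0, add_zero, mul_comm]

/-- A solution of `-w⁽⁶⁾ + c w = g`, where the `k_j` are the sixth roots of `c`. -/
def duhamelSum (k β : Fin 6 → ℂ) (g : ℝ → ℂ) (r : ℝ) : ℂ := ∑ j, β j * duhamel (k j) g r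

variable {k β : Fin 6 → ℂ}

lemma contDiff_duhamelSum (hg : ContDiff ℝ ∞ g) : ContDiff ℝ ∞ (duhamelSum k β g) :=
  ContDiff.sum fun j _ => contDiff_const.mul (contDiff_duhamel hg (k j))

lemma deriv_duhamelSum (hg : Continuous g) :
    deriv (duhamelSum k β g) =
      fun r => duhamelSum k (fun j => β j * k j) g r + (∑ j, β j) * g r := by
  funext r
  have h1 : HasDerivAt (duhamelSum k β g) (∑ j, β j * (k j * duhamel (k j) g r + g r)) r :=
    HasDerivAt.fun_sum fun j _ => (hasDerivAt_duhamel hg (k j) r).const_mul (β j)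
  rw [h1.deriv, duhamelSum, Finset.sum_mul, ← Finset.sum_add_distrib]
  exact Finset.sum_congr rfl fun j _ => by ring

/-- Differentiating the m-th derivative produces the extra term (∑ β_j k_jᵐ) g. These terms vanish
for m < 5, and m = 5 supplies −g. -/
lemma iteratedDeriv_six_duhamelSum (hg : Continuous g) {c : ℂ} (hk : ∀ j, k j ^ 6 = c)
    (hβ : ∀ m < 5, ∑ j, β j * k j ^ m = 0) (hβ5 : ∑ j, β j * k j ^ 5 = -1) :
    iteratedDeriv 6 (duhamelSum k β g) = fun r => c * duhamelSum k β g r - g r := by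
  have h1 : ∀ m ≤ 5, iteratedDeriv m (duhamelSum k β g) =
      duhamelSum k (fun j => β j * k j ^ m) g := by
    intro m hm
    induction m with
    | zero => simp
    | succ m ih =>
      rw [iteratedDeriv_succ, ih (by omega), deriv_duhamelSum hg, hβ m (by omega)]
      funext r
      simp only [zero_mul, add_zero, pow_succ, mul_assoc]
  rw [iteratedDeriv_succ, h1 5 le_rfl, deriv_duhamelSum hg, hβ5]
  funext r
  have h2 : duhamelSum k (fun j => β j * k j ^ 5 * k j) g r = c * duhamelSum k β g r := by
    rw [duhamelSum, duhamelSum, Finset.mul_sum]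
    refine Finset.sum_congr rfl fun j _ => ?_
    rw [mul_assoc (β j), ← pow_succ, hk]
    ring
  rw [h2]
  ring

/-- The vectors of coefficients for `duhamelSum` exist by inverting a Vandermonde matrix. -/
lemma exists_duhamel_coeff (hk : Function.Injective k) :
    ∃ β : Fin 6 → ℂ, (∀ m < 5, ∑ j, β j * k j ^ m = 0) ∧ ∑ j, β j * k j ^ 5 = -1 := by
  let M : (Fin 6 → ℂ) →ₗ[ℂ] (Fin 6 → ℂ) :=
    LinearMap.pi fun i => ∑ j, (k j ^ (i : ℕ)) • LinearMap.proj j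
  have hM : ∀ v i, M v i = ∑ j, v j * k j ^ (i : ℕ) := by
    intro v i
    simp [M, mul_comm]
  have hinj : Function.Injective M := by
    rw [← LinearMap.ker_eq_bot, LinearMap.ker_eq_bot']
    intro v hv
    exact Matrix.eq_zero_of_forall_pow_sum_mul_pow_eq_zero hk fun i => by
      rw [← hM, hv]; rfl
  obtain ⟨β, hβ⟩ := LinearMap.injective_iff_surjective.1 hinj
    (fun i => if i = 5 then -1 else 0)
  refine ⟨β, fun m hm => ?_, ?_⟩
  · have h1 := congrFun hβ ⟨m, by omega⟩
    rw [hM] at h1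
    rw [h1, if_neg]
    intro h
    have := congrArg Fin.val h
    simp at this
    omega
  · have h1 := congrFun hβ 5
    rw [hM, if_pos rfl] at h1
    exact h1

/-- The Taylor coefficients at the origin of `darboux l w` in terms of those of `w`. -/
def darbouxJet (l : ℕ) (s : ℕ → ℂ) (j : ℕ) : ℂ :=
  if l = 1 then (j : ℂ) * (s (j + 1) / (j + 1)) else ((j : ℂ) - 1) * (s (j + 2) / (j + 2))

lemma iteratedDeriv_ofReal_mul {H : ℝ → ℂ} (hH : ContDiff ℝ ∞ H) (j : ℕ) :
    iteratedDeriv j (fun r : ℝ => (r : ℂ) * H r) =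
      fun r : ℝ => (r : ℂ) * iteratedDeriv j H r + j * iteratedDeriv (j - 1) H r := by
  have hr1 : ∀ r : ℝ, HasDerivAt (fun r : ℝ => (r : ℂ)) 1 r := fun r =>
    (hasDerivAt_id (r : ℂ)).comp_ofReal
  induction j with
  | zero => simp
  | succ j ih =>
    funext r
    rw [iteratedDeriv_succ, ih]
    have h1 := ((hr1 r).mul (hH.hasDerivAt_iteratedDeriv j r)).add
      ((hH.hasDerivAt_iteratedDeriv (j - 1) r).const_mul (j : ℂ))
    refine h1.deriv.trans ?_
    -- For j = 0 the truncated index j − 1 is harmless, as its term has the factor j = 0.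
    rcases j with _ | j
    · simp; ring
    · simp only [Nat.add_sub_cancel]
      push_cast
      ring

/-- If `w = r G`, then `darboux l w` extends smoothly to the origin. -/
lemma exists_contDiff_eq_darboux {l : ℕ} (hl : l = 1 ∨ l = 2) {w G : ℝ → ℂ} (hG : ContDiff ℝ ∞ G)
    (hw : ∀ r, w r = r * G r) :
    ∃ f : ℝ → ℂ, ContDiff ℝ ∞ f ∧ EqOn f (darboux l w) (Ioi 0) ∧
      ∀ j, iteratedDeriv j f 0 = darbouxJet l (fun i => iteratedDeriv i w 0) j := by
  have hw' : w = fun r : ℝ => (r : ℂ) * G r := funext hw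
  have hr1 : ∀ r : ℝ, HasDerivAt (fun r : ℝ => (r : ℂ)) 1 r := fun r =>
    (hasDerivAt_id (r : ℂ)).comp_ofReal
  have hr0 : ContDiff ℝ ∞ fun r : ℝ => (r : ℂ) := Complex.ofRealCLM.contDiff
  have hG' := hG.deriv_infty
  have hG'' := hG'.deriv_infty
  have e1 : deriv w = fun r : ℝ => G r + r * deriv G r := by
    funext r
    rw [hw']
    refine ((hr1 r).mul (hG.hasDerivAt_deriv r)).deriv.trans ?_
    ring
  have e2 : deriv (deriv w) = fun r : ℝ => 2 * deriv G r + r * deriv (deriv G) r := by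
    funext r
    rw [e1]
    refine ((hG.hasDerivAt_deriv r).add ((hr1 r).mul (hG'.hasDerivAt_deriv r))).deriv.trans ?_
    ring
  have hs : ∀ j, iteratedDeriv (j + 1) w 0 / ((j : ℂ) + 1) = iteratedDeriv j G 0 := by
    intro j
    rw [hw', iteratedDeriv_ofReal_mul hG]
    have : (j : ℂ) + 1 ≠ 0 := by exact_mod_cast j.succ_ne_zero
    simp only [Complex.ofReal_zero, zero_mul, zero_add, Nat.add_sub_cancel]
    push_cast
    field_simp
  rcases hl with rfl | rfl
  -- For l = 1, w′ − w/r = rG′: the singular term cancels.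
  · refine ⟨fun r => r * deriv G r, hr0.mul hG', fun r hr => ?_, fun j => ?_⟩
    · have hr' : (r : ℂ) ≠ 0 := Complex.ofReal_ne_zero.2 (ne_of_gt hr)
      simp only [darboux, if_true, e1, hw r]
      field_simp
      ring
    · rw [iteratedDeriv_ofReal_mul hG']
      simp only [darbouxJet, if_true, hs, Complex.ofReal_zero, zero_mul, zero_add]
      rcases j with _ | j
      · simp
      · simp only [Nat.add_sub_cancel, iteratedDeriv_succ']
  -- For l = 2 the singular terms cancel too, leaving rG″ − G′.
  · refine ⟨fun r => r * deriv (deriv G) r - deriv G r, (hr0.mul hG'').sub hG', fun r hr => ?_,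
      fun j => ?_⟩
    · have hr' : (r : ℂ) ≠ 0 := Complex.ofReal_ne_zero.2 (ne_of_gt hr)
      simp only [darboux]
      rw [e2, e1, hw r]
      norm_num
      field_simp
      ring
    · have e : (fun r : ℝ => (r : ℂ) * deriv (deriv G) r - deriv G r) =
          (fun r : ℝ => (r : ℂ) * deriv (deriv G) r) - deriv G := rfl
      rw [e, iteratedDeriv_sub ((hr0.mul hG'').contDiffAt.of_le (by exact_mod_cast le_top))
        (hG'.contDiffAt.of_le (by exact_mod_cast le_top)), iteratedDeriv_ofReal_mul hG'']
      have hs' : iteratedDeriv (j + 2) w 0 / ((j : ℂ) + 2) = iteratedDeriv (j + 1) G 0 := by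
        have := hs (j + 1)
        push_cast at this
        rwa [add_assoc (j : ℂ), one_add_one_eq_two] at this
      have hd : darbouxJet 2 (fun i => iteratedDeriv i w 0) j =
          ((j : ℂ) - 1) * iteratedDeriv (j + 1) G 0 := by
        rw [← hs']; simp [darbouxJet]
      rw [hd, iteratedDeriv_succ']
      rcases j with _ | j
      · simp
      · have h1 : iteratedDeriv (j + 1) (deriv G) 0 = iteratedDeriv j (deriv (deriv G)) 0 := by
          rw [iteratedDeriv_succ']
        simp only [Complex.ofReal_zero, zero_mul, zero_add, Nat.add_sub_cancel, h1]
        push_cast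
        ring

/-- The two boundary conditions that are not automatic for functions `darboux l w`. -/
def boundaryPair (l ξ : ℕ) (κ : ℝ) (x : ℕ → ℂ) : Fin 2 → ℂ :=
  if ξ = 1 then ![if l = 1 then x 1 else x 0, κ * x 2 - x 3]
  else if l = 1 then ![x 4, κ * x 2 - x 3] else ![x 3, (κ : ℂ) ^ 5 * x 0 - x 5]

/-- The remaining conditions are automatic: entry 0 of the jet has the factor j = 0 for l = 1, entry
1 has the factor j − 1 = 0 for l = 2, and for l = 2 entry 4 is a multiple of s 6. -/
lemma mem_boundarySpace_of_boundaryPair {l ξ : ℕ} (hl : l = 1 ∨ l = 2) (hξ : ξ = 1 ∨ ξ = 2) {κ : ℝ}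
    {s : ℕ → ℂ} (h6 : s 6 = 0) (h : boundaryPair l ξ κ (darbouxJet l s) = 0) :
    (fun j : Fin 6 => darbouxJet l s j) ∈ boundarySpace l ξ κ := by
  have h0 := congrFun h 0
  have h1 := congrFun h 1
  rcases hl with rfl | rfl <;> rcases hξ with rfl | rfl
  · exact ⟨by simp [darbouxJet], by simpa [boundaryPair] using h0,
      sub_eq_zero.1 (by simpa [boundaryPair] using h1)⟩
  · exact ⟨by simp [darbouxJet], by simpa [boundaryPair] using h0,
      sub_eq_zero.1 (by simpa [boundaryPair] using h1)⟩
  · exact ⟨by simpa [boundaryPair] using h0, by simp [darbouxJet],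
      sub_eq_zero.1 (by simpa [boundaryPair] using h1)⟩
  · exact ⟨by simp [darbouxJet], by simpa [boundaryPair] using h0, by simp [darbouxJet, h6],
      sub_eq_zero.1 (by simpa [boundaryPair] using h1)⟩

end Resolvent

/-! ### Solving (T³ + c)f = Dg with the boundary conditions. -/

section Solution

open scoped ContDiff

lemma darbouxJet_add (l : ℕ) (s t : ℕ → ℂ) :
    darbouxJet l (s + t) = darbouxJet l s + darbouxJet l t := by
  funext j
  simp only [darbouxJet, Pi.add_apply]
  split_ifs <;> ring

lemma darbouxJet_smul (l : ℕ) (c : ℂ) (s : ℕ → ℂ) :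
    darbouxJet l (c • s) = c • darbouxJet l s := by
  funext j
  simp only [darbouxJet, Pi.smul_apply, smul_eq_mul]
  split_ifs <;> ring

lemma boundaryPair_add (l ξ : ℕ) (κ : ℝ) (x y : ℕ → ℂ) :
    boundaryPair l ξ κ (x + y) = boundaryPair l ξ κ x + boundaryPair l ξ κ y := by
  simp only [boundaryPair, Pi.add_apply]
  split_ifs <;> (ext i; fin_cases i) <;> simp <;> ring

lemma boundaryPair_smul (l ξ : ℕ) (κ : ℝ) (c : ℂ) (x : ℕ → ℂ) :
    boundaryPair l ξ κ (c • x) = c • boundaryPair l ξ κ x := by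
  simp only [boundaryPair, Pi.smul_apply, smul_eq_mul]
  split_ifs <;> (ext i; fin_cases i) <;> simp <;> ring

/-- The power sums `∑ a_j k_j^m`, which are the derivatives of `expSum k a` at the origin. -/
def powerSums (k : Fin 6 → ℂ) : (Fin 6 → ℂ) →ₗ[ℂ] (ℕ → ℂ) :=
  LinearMap.pi fun m => ∑ j, (k j ^ m) • LinearMap.proj j

lemma powerSums_apply (k a : Fin 6 → ℂ) (m : ℕ) : powerSums k a m = ∑ j, a j * k j ^ m := by
  simp [powerSums, mul_comm]

lemma iteratedDeriv_expSum_zero (k a : Fin 6 → ℂ) (m : ℕ) :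
    iteratedDeriv m (expSum k a) 0 = powerSums k a m := by
  rw [iteratedDeriv_expSum, powerSums_apply]
  simp [expSum]

/-- The boundary conditions at the origin and at infinity for `darboux l (expSum k a)`. -/
def boundaryMap (l ξ : ℕ) (κ : ℝ) (k : Fin 6 → ℂ) : (Fin 6 → ℂ) →ₗ[ℂ] (Fin 6 → ℂ) where
  toFun a := ![powerSums k a 0, boundaryPair l ξ κ (darbouxJet l (powerSums k a)) 0,
    boundaryPair l ξ κ (darbouxJet l (powerSums k a)) 1, a 0, a 1, a 2]
  map_add' a b := by
    rw [map_add, darbouxJet_add, boundaryPair_add]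
    ext i; fin_cases i <;> simp
  map_smul' c a := by
    rw [map_smul, darbouxJet_smul, boundaryPair_smul]
    ext i; fin_cases i <;> simp

lemma expDecaying_expSum_div {n : ℕ} {k e : Fin n → ℂ} (h : ∀ j, e j = 0 ∨ (k j).re < 0) (m : ℕ) :
    ExpDecaying fun r => expSum k e r / (r : ℂ) ^ m := by
  have h1 : (fun r : ℝ => expSum k e r / (r : ℂ) ^ m) =
      fun r : ℝ => ∑ j, e j * (Complex.exp (k j * r) / (r : ℂ) ^ m) := by
    funext r
    rw [expSum, Finset.sum_div]
    exact Finset.sum_congr rfl fun j _ => by ring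
  rw [h1]
  refine ExpDecaying.sum _ fun j _ => ?_
  rcases h j with h0 | h0
  · simpa [h0] using ExpDecaying.zero
  · exact .const_mul _ (.exp_div _ h0 m)

lemma expDecaying_darboux_expSum {n : ℕ} {k e : Fin n → ℂ} (h : ∀ j, e j = 0 ∨ (k j).re < 0)
    (l : ℕ) : ExpDecaying (darboux l (expSum k e)) := by
  have h' : ∀ j, e j * k j = 0 ∨ (k j).re < 0 := fun j => (h j).imp_left fun h => by simp [h]
  have h'' : ∀ j, e j * k j * k j = 0 ∨ (k j).re < 0 := fun j =>
    (h' j).imp_left fun h => by simp [h]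
  have e0 : darboux l (expSum k e) = fun r : ℝ =>
      if l = 1 then expSum k (fun j => e j * k j) r / (r : ℂ) ^ 0 + -1 * (expSum k e r / (r : ℂ) ^ 1)
      else expSum k (fun j => e j * k j * k j) r / (r : ℂ) ^ 0 +
        -3 * (expSum k (fun j => e j * k j) r / (r : ℂ) ^ 1) + 3 * (expSum k e r / (r : ℂ) ^ 2) := by
    funext r
    simp only [darboux, deriv_expSum]
    split_ifs <;> ring
  rw [e0]
  by_cases hl : l = 1
  · simp only [hl, if_true]
    exact (expDecaying_expSum_div h' 0).add (.const_mul _ (expDecaying_expSum_div h 1))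
  · simp only [hl, if_false]
    exact ((expDecaying_expSum_div h'' 0).add (.const_mul _ (expDecaying_expSum_div h' 1))).add
      (.const_mul _ (expDecaying_expSum_div h 2))

lemma darboux_sub_const_mul {u v : ℝ → ℂ} (l : ℕ) (hu : ContDiff ℝ ∞ u) (hv : ContDiff ℝ ∞ v)
    (c : ℂ) : darboux l (fun r => u r - c * v r) = fun r => darboux l u r - c * darboux l v r := by
  have e1 : ∀ {u v : ℝ → ℂ}, ContDiff ℝ ∞ u → ContDiff ℝ ∞ v →
      deriv (fun r => u r - c * v r) = fun r => deriv u r - c * deriv v r := fun hu hv =>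
    funext fun r => ((hu.hasDerivAt_deriv r).sub ((hv.hasDerivAt_deriv r).const_mul c)).deriv
  funext r
  simp only [darboux, e1 hu hv, e1 hu.deriv_infty hv.deriv_infty]
  split_ifs <;> ring

variable {a₀ b₀ : ℝ} {g : ℝ → ℂ} {k β a : Fin 6 → ℂ} {c : ℂ}

/-- The solution is the smooth extension of Dw to the origin, with w the Duhamel sum plus the
exponentials. In `ha`, entry 0 makes w vanish at 0 so that Dw extends, entries 1 and 2 are the
boundary conditions, and entries 3 to 5 cancel beyond b₀ the exponentials k₀, k₁, k₂ of the Duhamel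
sum, whose decay is not assumed. -/
lemma exists_solution {l ξ : ℕ} (hl : l = 1 ∨ l = 2) (hξ : ξ = 1 ∨ ξ = 2) {κ : ℝ}
    (hk : ∀ j, k j ^ 6 = c) (hre : ∀ j : Fin 6, 3 ≤ (j : ℕ) → (k j).re < 0)
    (hβ : ∀ m < 5, ∑ j, β j * k j ^ m = 0) (hβ5 : ∑ j, β j * k j ^ 5 = -1)
    (hg : IsTestOn a₀ b₀ g)
    (ha : boundaryMap l ξ κ k a =
      ![0, 0, 0, -(β 0 * ∫ s in (0 : ℝ)..b₀, Complex.exp (-k 0 * s) * g s),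
        -(β 1 * ∫ s in (0 : ℝ)..b₀, Complex.exp (-k 1 * s) * g s),
        -(β 2 * ∫ s in (0 : ℝ)..b₀, Complex.exp (-k 2 * s) * g s)]) :
    ∃ f : ℝ → ℂ, IsSobolevSix f ∧ boundaryJet f ∈ boundarySpace l ξ κ ∧
      EqOn f (darboux l fun r => duhamelSum k β g r + expSum k a r) (Ioi 0) ∧
      EqOn (radialOpCube l f) (fun r => darboux l g r - c * f r) (Ioi 0) := by
  set w : ℝ → ℂ := fun r => duhamelSum k β g r + expSum k a r with hw
  have hD : ContDiff ℝ ∞ (duhamelSum k β g) := contDiff_duhamelSum hg.smooth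
  have hE : ContDiff ℝ ∞ (expSum k a) := contDiff_expSum
  have hws : ContDiff ℝ ∞ w := hD.add hE
  have hD0 : ∀ r < a₀, duhamelSum k β g r = 0 := fun r hr =>
    Finset.sum_eq_zero fun j _ => by rw [hg.duhamel_eq_zero _ hr, mul_zero]
  have hsum : ∑ j, a j = 0 := by
    have := congrFun ha 0
    simpa [boundaryMap, powerSums_apply] using this
  obtain ⟨G, hG, hGe⟩ := exists_contDiff_expSum_eq_mul (k := k) hsum
  obtain ⟨f, hf, hfe, hfj⟩ := exists_contDiff_eq_darboux hl (w := w)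
    (G := fun r => duhamelSum k β g r / r + G r)
    ((contDiff_div_ofReal hg.pos hD hD0).add hG) (fun r => by
      simp only [hw, hGe]
      rcases eq_or_ne r 0 with rfl | hr
      · simp [hD0 0 hg.pos]
      · have : (r : ℂ) ≠ 0 := Complex.ofReal_ne_zero.2 hr
        field_simp)
  -- The Duhamel part vanishes near the origin, since g is supported in [a₀, b₀] with a₀ > 0.
  have hjet : (fun i => iteratedDeriv i w 0) = powerSums k a := by
    funext i
    rw [← iteratedDeriv_expSum_zero]
    refine Filter.EventuallyEq.iteratedDeriv_eq i ?_
    filter_upwards [Iio_mem_nhds hg.pos] with r hr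
    simp only [hw, hD0 r hr, zero_add]
  -- As k_j⁶ = c for all j, this sum is c ∑ a_j = 0.
  have h6 : powerSums k a 6 = 0 := by
    simp [powerSums_apply, hk, ← Finset.sum_mul, hsum]
  have hinf : EqOn f (darboux l (expSum k fun j =>
      β j * (∫ s in (0 : ℝ)..b₀, Complex.exp (-k j * s) * g s) + a j)) (Ioi b₀) := by
    have h1 : EqOn w (expSum k fun j =>
        β j * (∫ s in (0 : ℝ)..b₀, Complex.exp (-k j * s) * g s) + a j) (Ioi b₀) := by
      intro r hr
      simp only [hw, duhamelSum, expSum, ← Finset.sum_add_distrib]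
      refine Finset.sum_congr rfl fun j _ => ?_
      rw [hg.duhamel_eq_exp _ hr]
      ring
    refine EqOn.trans (hfe.mono (Ioi_subset_Ioi ?_)) (darboux_congr isOpen_Ioi h1)
    linarith [hg.pos, hg.le]
  refine ⟨f, ?_, ?_, hfe, ?_⟩
  · refine isSobolevSix_of_expDecaying hf (expDecaying_darboux_expSum (fun j => ?_) l)
      (hg.pos.trans_le hg.le) hinf
    by_cases hj : 3 ≤ (j : ℕ)
    · exact Or.inr (hre j hj)
    · left
      have h3 := congrFun ha 3
      have h4 := congrFun ha 4
      have h5 := congrFun ha 5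
      simp only [boundaryMap, LinearMap.coe_mk, AddHom.coe_mk] at h3 h4 h5
      fin_cases j
      · exact add_eq_zero_iff_neg_eq.2 h3.symm
      · exact add_eq_zero_iff_neg_eq.2 h4.symm
      · exact add_eq_zero_iff_neg_eq.2 h5.symm
      all_goals simp at hj
  · have h1 : boundaryJet f = fun j : Fin 6 => darbouxJet l (powerSums k a) j := by
      funext j
      rw [boundaryJet, iteratedDerivWithin_Ici_of_contDiff hf _ le_rfl, hfj, hjet]
    rw [h1]
    refine mem_boundarySpace_of_boundaryPair hl hξ h6 ?_
    have h1 := congrFun ha 1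
    have h2 := congrFun ha 2
    simp only [boundaryMap, LinearMap.coe_mk, AddHom.coe_mk] at h1 h2
    ext i
    fin_cases i
    · exact h1
    · exact h2
  · have h1 : -iteratedDeriv 6 w = fun r => g r - c * w r := by
      funext r
      have e : w = duhamelSum k β g + expSum k a := rfl
      rw [Pi.neg_apply, e, iteratedDeriv_add (hD.contDiffAt.of_le (by norm_cast))
        (hE.contDiffAt.of_le (by norm_cast)),
        iteratedDeriv_six_duhamelSum hg.smooth.continuous hk hβ hβ5, iteratedDeriv_expSum]
      simp only [hk, Pi.add_apply, expSum, mul_add, Finset.mul_sum]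
      have : ∀ j, a j * c * Complex.exp (k j * r) = c * (a j * Complex.exp (k j * r)) := fun j => by
        ring
      simp only [this]
      ring
    intro r hr
    rw [radialOpCube_congr hfe hr, radialOpCube_darboux hl hws hr, h1,
      darboux_sub_const_mul l hg.smooth hws]
    simp only [hfe hr]

end Solution

/-! ### Density of the domain and of the range of A + c. -/

section Density

open scoped ContDiff

variable {a₀ b₀ : ℝ} {g : ℝ → ℂ}

lemma IsTestOn.isSobolevSix (hg : IsTestOn a₀ b₀ g) : IsSobolevSix g :=
  isSobolevSix_of_expDecaying hg.smooth ExpDecaying.zero (hg.pos.trans_le hg.le) fun r hr =>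
    hg.eq_zero r fun h => absurd h.2 (not_le.2 hr)

lemma IsTestOn.boundaryJet_eq_zero (hg : IsTestOn a₀ b₀ g) : boundaryJet g = 0 := by
  have h1 : g =ᶠ[𝓝 0] fun _ => 0 := by
    filter_upwards [Iio_mem_nhds hg.pos] with r hr using
      hg.eq_zero r fun h => absurd h.1 (not_le.2 hr)
  funext j
  rw [boundaryJet, iteratedDerivWithin_Ici_of_contDiff hg.smooth _ le_rfl, h1.iteratedDeriv_eq]
  simp

lemma IsSobolevSix.exists_domain {l ξ : ℕ} {κ : ℝ} {f h : ℝ → ℂ} (hf : IsSobolevSix f)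
    (hb : boundaryJet f ∈ boundarySpace l ξ κ) (hh : MemLp h 2 halfLine)
    (he : EqOn (radialOpCube l f) h (Ioi 0)) :
    ∃ x : (radialCubeOperator l ξ κ).domain, (x : HalfLineL2) = hf.memLp.toLp f ∧
      radialCubeOperator l ξ κ x = hh.toLp h := by
  refine IsRadialPair.exists_domain ⟨f, hf, hb, hf.memLp.coeFn_toLp, ?_⟩
  filter_upwards [hh.coeFn_toLp, ae_restrict_mem measurableSet_Ioi] with r h1 h2
  rw [h1, he h2]

/-- The six sixth roots `k_j` of `c`, those with negative real part last. -/
structure IsSixthRoots (c : ℂ) (k : Fin 6 → ℂ) : Prop where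
  im_ne_zero : c.im ≠ 0
  injective : Function.Injective k
  pow_eq : ∀ j, k j ^ 6 = c
  re_neg : ∀ j : Fin 6, 3 ≤ (j : ℕ) → (k j).re < 0

variable {k : Fin 6 → ℂ} {c : ℂ} {l ξ : ℕ}

lemma IsSixthRoots.ne_zero (hk : IsSixthRoots c k) (j : Fin 6) : k j ≠ 0 := by
  intro h
  apply hk.im_ne_zero
  rw [← hk.pow_eq j, h]
  simp

/-- A kernel vector yields, with g = 0, an element f of the domain with A f = −c f. Symmetry and Im
c ≠ 0 force f = 0, and independence of the exponentials under D then gives a = 0. No determinant has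
to be computed. -/
lemma IsSixthRoots.boundaryMap_injective (hk : IsSixthRoots c k) (hl : l = 1 ∨ l = 2)
    (hξ : ξ = 1 ∨ ξ = 2) (κ : ℝ) : Function.Injective (boundaryMap l ξ κ k) := by
  rw [← LinearMap.ker_eq_bot, LinearMap.ker_eq_bot']
  intro a ha
  obtain ⟨β, hβ, hβ5⟩ := exists_duhamel_coeff hk.injective
  obtain ⟨f, hf, hb, hfe, hT⟩ := exists_solution (β := β) hl hξ hk.pow_eq hk.re_neg hβ hβ5
    (IsTestOn.zero one_pos le_rfl) (ha.trans (by ext i; fin_cases i <;> simp))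
  have hT' : EqOn (radialOpCube l f) (fun r => (-c) * f r) (Ioi 0) := by
    intro r hr
    rw [hT hr]
    simp [darboux]
  obtain ⟨x, hx, hAx⟩ := hf.exists_domain hb (hf.memLp.const_mul (-c)) hT'
  have h1 := abs_im_mul_norm_le_of_symmetric (radialCubeOperator_symmetric hl hξ κ) c x
  have h2 : radialCubeOperator l ξ κ x + c • (x : HalfLineL2) = 0 := by
    rw [hx, hAx]
    have : (hf.memLp.const_mul (-c)).toLp (fun r => (-c) * f r) = (-c) • hf.memLp.toLp f :=
      MemLp.toLp_const_smul (-c) hf.memLp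
    rw [this, neg_smul, neg_add_cancel]
  rw [h2, norm_zero] at h1
  have h3 : (x : HalfLineL2) = 0 := by
    have := abs_pos.2 hk.im_ne_zero
    exact norm_le_zero_iff.1 (nonpos_of_mul_nonpos_right h1 this)
  have h4 : f =ᵐ[halfLine] 0 := by
    have h5 := hf.memLp.coeFn_toLp
    rw [← hx, h3] at h5
    exact h5.symm.trans (Lp.coeFn_zero _ _ _)
  have h6 : EqOn f 0 (Ioi 0) :=
    Measure.eqOn_open_of_ae_eq h4 isOpen_Ioi
      (hf.contDiffOn.continuousOn.mono Ioi_subset_Ici_self) continuousOn_const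
  refine eq_zero_of_darboux_expSum hl hk.injective hk.ne_zero (EqOn.trans ?_ h6)
  have h7 : expSum k a = fun r => duhamelSum k β (fun _ => 0) r + expSum k a r := by
    funext r
    simp [duhamelSum, duhamel]
  rw [h7]
  exact hfe.symm

/-- The range of `T_l³ + c` contains the image of all test functions under the intertwining
operator. -/
lemma IsSixthRoots.exists_shift_eq_darboux (hk : IsSixthRoots c k) (hl : l = 1 ∨ l = 2)
    (hξ : ξ = 1 ∨ ξ = 2) (κ : ℝ) (hg : IsTestOn a₀ b₀ g) :
    ∃ x : (radialCubeOperator l ξ κ).domain,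
      radialCubeOperator l ξ κ x + c • (x : HalfLineL2) =
        (hg.darboux l).isSobolevSix.memLp.toLp (darboux l g) := by
  obtain ⟨β, hβ, hβ5⟩ := exists_duhamel_coeff hk.injective
  -- Six equations in six unknowns: uniqueness gives existence.
  obtain ⟨a, ha⟩ := LinearMap.injective_iff_surjective.1 (hk.boundaryMap_injective hl hξ κ)
    ![0, 0, 0, -(β 0 * ∫ s in (0 : ℝ)..b₀, Complex.exp (-k 0 * s) * g s),
      -(β 1 * ∫ s in (0 : ℝ)..b₀, Complex.exp (-k 1 * s) * g s),
      -(β 2 * ∫ s in (0 : ℝ)..b₀, Complex.exp (-k 2 * s) * g s)]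
  obtain ⟨f, hf, hb, -, hT⟩ := exists_solution hl hξ hk.pow_eq hk.re_neg hβ hβ5 hg ha
  have hd := (hg.darboux l).isSobolevSix.memLp
  obtain ⟨x, hx, hAx⟩ := hf.exists_domain hb (hd.sub (hf.memLp.const_mul c)) hT
  refine ⟨x, ?_⟩
  have h1 : (hf.memLp.const_mul c).toLp (fun r => c * f r) = c • hf.memLp.toLp f :=
    MemLp.toLp_const_smul c hf.memLp
  rw [hx, hAx, MemLp.toLp_sub hd (hf.memLp.const_mul c), h1, sub_add_cancel]

/-- The fundamental lemma of the calculus of variations for the conjugate of y. A compact support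
inside (0, ∞) lies in an interval [a, b] with a > 0, given by its infimum and supremum. -/
lemma eq_zero_of_inner_test_eq_zero {y : HalfLineL2}
    (h : ∀ (a b : ℝ) (g : ℝ → ℂ) (hg : IsTestOn a b g),
      inner ℂ y (hg.isSobolevSix.memLp.toLp g) = 0) : y = 0 := by
  have hy : LocallyIntegrableOn (fun r => (starRingEnd ℂ) (y r)) (Ioi 0) volume := by
    have hm : MemLp (fun r => (starRingEnd ℂ) (y r)) 2 halfLine :=
      (Lp.memLp y).star
    exact locallyIntegrableOn_of_locallyIntegrable_restrict (hm.locallyIntegrable (by norm_num))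
  have h0 := isOpen_Ioi.ae_eq_zero_of_integral_contDiff_smul_eq_zero hy fun φ hφ hc hs => by
    obtain ⟨a, b, ha, hab, hsub⟩ : ∃ a b : ℝ, 0 < a ∧ a ≤ b ∧ tsupport φ ⊆ Icc a b := by
      rcases (tsupport φ).eq_empty_or_nonempty with he | hne
      · exact ⟨1, 1, one_pos, le_rfl, by simp [he]⟩
      · have hcp : IsCompact (tsupport φ) := hc
        exact ⟨sInf (tsupport φ), sSup (tsupport φ), hs (hcp.sInf_mem hne),
          csInf_le_csSup hne hcp.bddBelow hcp.bddAbove, fun r hr =>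
            ⟨csInf_le hcp.bddBelow hr, le_csSup hcp.bddAbove hr⟩⟩
    have hg : IsTestOn a b fun r => (φ r : ℂ) :=
      ⟨ha, hab, Complex.ofRealCLM.contDiff.comp hφ, fun r hr => by
        rw [image_eq_zero_of_notMem_tsupport fun h => hr (hsub h), Complex.ofReal_zero]⟩
    have h1 := h a b _ hg
    rw [L2.inner_def] at h1
    have h2 : ∫ r, φ r • (starRingEnd ℂ) (y r) = ∫ r in Ioi 0, φ r • (starRingEnd ℂ) (y r) := by
      refine (setIntegral_eq_integral_of_forall_compl_eq_zero fun r hr => ?_).symm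
      rw [image_eq_zero_of_notMem_tsupport fun h => hr (hs h), zero_smul]
    rw [h2, ← h1]
    refine integral_congr_ae ?_
    filter_upwards [hg.isSobolevSix.memLp.coeFn_toLp] with r hr
    rw [hr, RCLike.inner_apply, Complex.real_smul]
  refine Lp.ext ?_
  filter_upwards [ae_restrict_of_ae h0, ae_restrict_mem measurableSet_Ioi,
    Lp.coeFn_zero ℂ 2 halfLine] with r h1 h2 h3
  rw [h3]
  simpa using h1 h2

lemma IsTestOn.exists_domain (hl : l = 1 ∨ l = 2) (ξ : ℕ) (κ : ℝ) (hg : IsTestOn a₀ b₀ g) :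
    ∃ (x : (radialCubeOperator l ξ κ).domain) (g₀ : ℝ → ℂ) (h₀ : IsTestOn a₀ b₀ g₀),
      (x : HalfLineL2) = hg.isSobolevSix.memLp.toLp g ∧
      radialCubeOperator l ξ κ x = (h₀.darboux l).isSobolevSix.memLp.toLp (_root_.darboux l g₀) := by
  obtain ⟨g₀, h₀, he⟩ := hg.exists_radialOpCube_eq_darboux hl
  obtain ⟨x, hx, hAx⟩ := hg.isSobolevSix.exists_domain (ξ := ξ) (κ := κ)
    (by rw [hg.boundaryJet_eq_zero]; exact Submodule.zero_mem _)
    (h₀.darboux l).isSobolevSix.memLp he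
  exact ⟨x, g₀, h₀, hx, hAx⟩

/-- The range of `T_l³ + c` is dense for non-real `c`. -/
lemma IsSixthRoots.eq_zero_of_inner_shift_eq_zero (hk : IsSixthRoots c k) (hl : l = 1 ∨ l = 2)
    (hξ : ξ = 1 ∨ ξ = 2) (κ : ℝ) {y : HalfLineL2}
    (h : ∀ x : (radialCubeOperator l ξ κ).domain,
      inner ℂ y (radialCubeOperator l ξ κ x + c • (x : HalfLineL2)) = 0) : y = 0 := by
  refine eq_zero_of_inner_test_eq_zero fun a b g hg => ?_
  obtain ⟨x, g₀, h₀, hx, hAx⟩ := hg.exists_domain hl ξ κ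
  -- T³g = Dg₀ itself lies in the range of A + c, so y is orthogonal to it, and only c⟨y, g⟩ = 0
  -- remains.
  obtain ⟨x', hx'⟩ := hk.exists_shift_eq_darboux hl hξ κ h₀
  have h1 := h x
  rw [inner_add_right, hAx, ← hx', h x', zero_add, inner_smul_right] at h1
  rw [← hx]
  refine (mul_eq_zero.1 h1).resolve_left fun hc => hk.im_ne_zero ?_
  rw [hc, Complex.zero_im]

lemma dense_radialCubeOperator_domain (hl : l = 1 ∨ l = 2) (ξ : ℕ) (κ : ℝ) :
    Dense ((radialCubeOperator l ξ κ).domain : Set HalfLineL2) := by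
  rw [Submodule.dense_iff_topologicalClosure_eq_top, Submodule.topologicalClosure_eq_top_iff,
    Submodule.eq_bot_iff]
  intro y hy
  refine eq_zero_of_inner_test_eq_zero fun a b g hg => ?_
  obtain ⟨x, -, -, hx, -⟩ := hg.exists_domain hl ξ κ
  rw [← hx]
  exact Submodule.inner_left_of_mem_orthogonal x.2 hy

end Density

/-! ### The sixth roots of ±iρ⁶. -/

section Roots

open scoped ContDiff

lemma phase_add (s t : ℝ) : phase (s + t) = phase s * phase t := by
  rw [phase, phase, phase, ← Complex.exp_add]
  push_cast
  ring_nf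

lemma phase_re (t : ℝ) : (phase t).re = Real.cos t := by
  rw [phase, mul_comm, Complex.exp_ofReal_mul_I_re]

lemma norm_phase (t : ℝ) : ‖phase t‖ = 1 := by
  rw [phase, mul_comm, Complex.norm_exp_ofReal_mul_I]

/-- The sixth roots of `σ i ρ⁶` for `σ = ±1`. -/
def sixthRoot (σ ρ : ℝ) (j : Fin 6) : ℂ :=
  ρ * phase (σ * (Real.pi / 12) - Real.pi / 3 + j * (Real.pi / 3))

/-- The angles start at σπ/12 − π/3, whose sixfold is σπ/2 modulo 2π, and increase by π/3. With this
start the angles with j = 3, 4, 5 lie strictly between π/2 and 3π/2. -/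
lemma isSixthRoots_sixthRoot {σ ρ : ℝ} (hσ : σ = 1 ∨ σ = -1) (hρ : 0 < ρ) :
    IsSixthRoots (σ * Complex.I * (ρ : ℂ) ^ 6) (sixthRoot σ ρ) := by
  have hπ := Real.pi_pos
  have hω : ∀ j : ℕ, phase (j * (Real.pi / 3)) = Complex.exp (2 * Real.pi * Complex.I / 6) ^ j := by
    intro j
    rw [phase, ← Complex.exp_nat_mul]
    push_cast
    ring_nf
  have hprim : IsPrimitiveRoot (Complex.exp (2 * Real.pi * Complex.I / 6)) 6 := by
    simpa using Complex.isPrimitiveRoot_exp 6 (by norm_num)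
  have hne : ∀ t, phase t ≠ 0 := fun t => Complex.exp_ne_zero _
  have hρ' : (ρ : ℂ) ≠ 0 := Complex.ofReal_ne_zero.2 hρ.ne'
  refine ⟨?_, fun i j hij => ?_, fun j => ?_, fun j hj => ?_⟩
  · have h1 : ((σ : ℂ) * Complex.I * (ρ : ℂ) ^ 6).im = σ * ρ ^ 6 := by
      rw [mul_right_comm, ← Complex.ofReal_pow, ← Complex.ofReal_mul, Complex.im_ofReal_mul, Complex.I_im, mul_one]
    rw [h1]
    have : σ ≠ 0 := by rcases hσ with rfl | rfl <;> norm_num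
    positivity
  · simp only [sixthRoot, phase_add _ (_ * _)] at hij
    have h1 := mul_left_cancel₀ (hne _) (mul_left_cancel₀ hρ' hij)
    rw [hω, hω] at h1
    exact Fin.ext (hprim.pow_inj i.2 j.2 h1)
  · have h1 : phase (j * (Real.pi / 3)) ^ 6 = 1 := by
      rw [hω, ← pow_mul, mul_comm (j : ℕ), pow_mul, hprim.pow_eq_one, one_pow]
    have h2 : phase (σ * (Real.pi / 12) - Real.pi / 3) ^ 6 = σ * Complex.I := by
      have h3 : phase (σ * (Real.pi / 12) - Real.pi / 3) ^ 6 =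
          Complex.exp (σ * (Real.pi / 2 * Complex.I) - 2 * Real.pi * Complex.I) := by
        rw [phase, ← Complex.exp_nat_mul]
        push_cast
        ring_nf
      rw [h3, Complex.exp_sub, Complex.exp_two_pi_mul_I, div_one]
      rcases hσ with rfl | rfl
      · simp [Complex.exp_pi_div_two_mul_I]
      · simp [Complex.exp_neg, Complex.exp_pi_div_two_mul_I]
    rw [sixthRoot, phase_add, mul_pow, mul_pow, h1, h2]
    ring
  · rw [sixthRoot, Complex.re_ofReal_mul, phase_re]
    refine mul_neg_of_pos_of_neg hρ (Real.cos_neg_of_pi_div_two_lt_of_lt ?_ ?_)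
    · have : (3 : ℝ) ≤ j := by exact_mod_cast hj
      rcases hσ with rfl | rfl <;> nlinarith
    · have : ((j : ℕ) : ℝ) ≤ 5 := by exact_mod_cast (by omega : (j : ℕ) ≤ 5)
      rcases hσ with rfl | rfl <;> nlinarith

end Roots

/-! ### Linear independence of q¹ and q². -/

section Deficiency

open scoped ContDiff

lemma besselD_eqOn_darboux {l : ℕ} (hl : l = 1 ∨ l = 2) {w : ℝ → ℂ} (hw : ContDiff ℝ ∞ w) :
    EqOn (besselD l w) (darboux l w) (Ioi 0) := by
  have h0 := hw.hasDerivAt_deriv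
  have h1 := hw.deriv_infty.hasDerivAt_deriv
  have d1 : ∀ s : ℝ, 0 < s → HasDerivAt (fun t : ℝ => w t / (t : ℂ))
      (1 / (s : ℂ) ^ 1 * deriv w s - 1 / (s : ℂ) ^ 2 * w s) s := by
    intro s hs
    have e : (fun t : ℝ => w t / (t : ℂ)) = fun t : ℝ => 1 / (t : ℂ) ^ 1 * w t := by
      funext t; ring
    rw [e]
    refine (hasDerivAt_div_pow_mul (ne_of_gt hs) 1 1 (h0 s)).congr_deriv ?_
    push_cast; ring
  intro r hr
  have hr' : (r : ℂ) ≠ 0 := Complex.ofReal_ne_zero.2 (ne_of_gt hr)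
  rcases hl with rfl | rfl
  · simp only [besselD, darboux, if_true, Function.iterate_one, (d1 r hr).deriv]
    field_simp
  · have e1 : (fun t : ℝ => 1 / (t : ℂ) * deriv (fun t : ℝ => w t / (t : ℂ)) t) =ᶠ[𝓝 r]
        fun t : ℝ => 1 / (t : ℂ) ^ 2 * deriv w t - 1 / (t : ℂ) ^ 3 * w t := by
      filter_upwards [Ioi_mem_nhds hr] with s hs
      rw [(d1 s hs).deriv]
      ring
    have d2 : HasDerivAt (fun t : ℝ => 1 / (t : ℂ) ^ 2 * deriv w t - 1 / (t : ℂ) ^ 3 * w t) _ r :=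
      (hasDerivAt_div_pow_mul (ne_of_gt hr) 1 2 (h1 r)).sub
        (hasDerivAt_div_pow_mul (ne_of_gt hr) 1 3 (h0 r))
    simp only [besselD, darboux, Function.iterate_succ, Function.iterate_zero, Function.comp_apply,
      id, e1.deriv_eq, d2.deriv]
    norm_num
    field_simp
    ring

lemma continuousOn_darboux {l : ℕ} {w : ℝ → ℂ} (hw : ContDiff ℝ ∞ w) :
    ContinuousOn (darboux l w) (Ioi 0) := by
  have c0 := hw.continuous
  have c1 := hw.deriv_infty.continuous
  have c2 := hw.deriv_infty.deriv_infty.continuous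
  have hr : ∀ r ∈ Ioi (0 : ℝ), (r : ℂ) ≠ 0 := fun r hr => Complex.ofReal_ne_zero.2 (ne_of_gt hr)
  unfold darboux
  split_ifs
  · exact c1.continuousOn.sub (c0.continuousOn.div (by fun_prop) hr)
  · refine (c2.continuousOn.sub (ContinuousOn.div (by fun_prop) (by fun_prop) hr)).add
      (ContinuousOn.div (by fun_prop) (by fun_prop) fun r h => pow_ne_zero 2 (hr r h))

lemma expSum_lin {n : ℕ} (k a b : Fin n → ℂ) (α β : ℂ) (r : ℝ) :
    expSum k (fun j => α * a j + β * b j) r = α * expSum k a r + β * expSum k b r := by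
  simp only [expSum, Finset.mul_sum, ← Finset.sum_add_distrib]
  exact Finset.sum_congr rfl fun j _ => by ring

lemma darboux_expSum_lin {n : ℕ} (l : ℕ) (k a b : Fin n → ℂ) (α β : ℂ) (r : ℝ) :
    darboux l (expSum k fun j => α * a j + β * b j) r =
      α * darboux l (expSum k a) r + β * darboux l (expSum k b) r := by
  simp only [darboux, deriv_expSum, add_mul, mul_assoc, expSum_lin]
  split_ifs <;> ring

/-- The exponents of the functions `q¹` and `q²`. -/
def deficiencyExponent (σ ρ : ℝ) : Fin 3 → ℂ :=
  ![phase (-σ * (3 * Real.pi / 4)) * ρ, -phase (-σ * (Real.pi / 12)) * ρ,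
    -phase (-σ * (5 * Real.pi / 12)) * ρ]

lemma deficiencyCombination_eqOn {l : ℕ} (hl : l = 1 ∨ l = 2) (σ ρ : ℝ) (a b c : ℂ) :
    EqOn (deficiencyCombination l σ ρ a b c)
      (darboux l (expSum (deficiencyExponent σ ρ) ![a, b, c])) (Ioi 0) := by
  have h : (fun r : ℝ =>
      a * Complex.exp (phase (-σ * (3 * Real.pi / 4)) * ρ * r) +
      b * Complex.exp (-phase (-σ * (Real.pi / 12)) * ρ * r) +
      c * Complex.exp (-phase (-σ * (5 * Real.pi / 12)) * ρ * r)) =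
      expSum (deficiencyExponent σ ρ) ![a, b, c] := by
    funext r
    simp [expSum, deficiencyExponent, Fin.sum_univ_three]
  rw [deficiencyCombination, h]
  exact besselD_eqOn_darboux hl contDiff_expSum

lemma deficiencyExponent_re {σ : ℝ} (hσ : σ = 1 ∨ σ = -1) (ρ : ℝ) (j : Fin 3) :
    (deficiencyExponent σ ρ j).re = -![Real.cos (Real.pi / 4), Real.cos (Real.pi / 12),
      Real.cos (5 * Real.pi / 12)] j * ρ := by
  have hc : ∀ t, Real.cos (-σ * t) = Real.cos t := by
    intro t
    rcases hσ with rfl | rfl <;> simp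
  have h1 : Real.cos (3 * Real.pi / 4) = -Real.cos (Real.pi / 4) := by
    rw [← Real.cos_pi_sub]
    ring_nf
  fin_cases j <;> simp only [deficiencyExponent] <;>
    simp [phase_re, hc, h1, -neg_mul]

/-- The real parts already separate the exponents from each other and from 0, because 0 < cos(5π/12)
< cos(π/4) < cos(π/12). -/
lemma deficiencyExponent_injective_and_ne_zero {σ ρ : ℝ} (hσ : σ = 1 ∨ σ = -1) (hρ : 0 < ρ) :
    Function.Injective (deficiencyExponent σ ρ) ∧ ∀ j, deficiencyExponent σ ρ j ≠ 0 := by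
  have hπ := Real.pi_pos
  have c1 : Real.cos (Real.pi / 4) < Real.cos (Real.pi / 12) :=
    Real.cos_lt_cos_of_nonneg_of_le_pi (by positivity) (by linarith) (by linarith)
  have c2 : Real.cos (5 * Real.pi / 12) < Real.cos (Real.pi / 4) :=
    Real.cos_lt_cos_of_nonneg_of_le_pi (by positivity) (by linarith) (by linarith)
  have c3 : 0 < Real.cos (5 * Real.pi / 12) :=
    Real.cos_pos_of_mem_Ioo ⟨by linarith, by linarith⟩
  rw [Real.cos_pi_div_four] at c1 c2
  refine ⟨fun i j hij => ?_, fun j hj => ?_⟩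
  · have h1 := congrArg Complex.re hij
    rw [deficiencyExponent_re hσ, deficiencyExponent_re hσ] at h1
    have h2 := neg_injective (mul_right_cancel₀ hρ.ne' h1)
    fin_cases i <;> fin_cases j <;> simp at h2 ⊢ <;> linarith
  · have h1 := congrArg Complex.re hj
    rw [deficiencyExponent_re hσ, Complex.zero_re] at h1
    have h2 := neg_eq_zero.1 ((mul_eq_zero.1 h1).resolve_right hρ.ne')
    fin_cases j <;> simp at h2 <;> linarith

/-- The functions `q¹` and `q²` are linearly independent. -/
lemma eq_zero_of_deficiency_ae_eq_zero {l : ℕ} (hl : l = 1 ∨ l = 2) {σ ρ : ℝ}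
    (hσ : σ = 1 ∨ σ = -1) (hρ : 0 < ρ) {α β : ℂ}
    (h : (fun r => α * deficiencyOne l σ ρ r + β * deficiencyTwo l σ ρ r) =ᵐ[halfLine] 0) :
    α = 0 ∧ β = 0 := by
  obtain ⟨hinj, hne⟩ := deficiencyExponent_injective_and_ne_zero hσ hρ
  let a : Fin 3 → ℂ := ![1, phase (-σ * (2 * Real.pi / 3)), phase (σ * (2 * Real.pi / 3))]
  let b : Fin 3 → ℂ := ![phase (-σ * (5 * Real.pi / 6)), (Real.sqrt 3 : ℂ),
    phase (σ * (5 * Real.pi / 6))]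
  have h1 : darboux l (expSum (deficiencyExponent σ ρ) fun j => α * a j + β * b j)
      =ᵐ[halfLine] 0 := by
    filter_upwards [h, ae_restrict_mem measurableSet_Ioi] with r hr hr0
    rw [darboux_expSum_lin, ← deficiencyCombination_eqOn hl σ ρ _ _ _ hr0,
      ← deficiencyCombination_eqOn hl σ ρ _ _ _ hr0]
    exact hr
  have h2 := Measure.eqOn_open_of_ae_eq h1 isOpen_Ioi (continuousOn_darboux contDiff_expSum)
    continuousOn_const
  have h3 := eq_zero_of_darboux_expSum hl hinj hne h2
  have e0 : α * 1 + β * phase (-σ * (5 * Real.pi / 6)) = 0 := congrFun h3 0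
  have e1 : α * phase (-σ * (2 * Real.pi / 3)) + β * (Real.sqrt 3 : ℂ) = 0 := congrFun h3 1
  -- Eliminating α from the first two coefficients leaves β times the difference of √3 and a number
  -- of modulus 1, and this difference is not zero.
  have hβ : β = 0 := by
    have e2 : β * ((Real.sqrt 3 : ℂ) -
        phase (-σ * (5 * Real.pi / 6)) * phase (-σ * (2 * Real.pi / 3))) = 0 := by
      linear_combination e1 - phase (-σ * (2 * Real.pi / 3)) * e0
    refine (mul_eq_zero.1 e2).resolve_right fun e3 => ?_
    have e4 := congrArg norm (sub_eq_zero.1 e3)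
    rw [norm_mul, norm_phase, norm_phase, mul_one, Complex.norm_real, Real.norm_eq_abs,
      abs_of_nonneg (Real.sqrt_nonneg 3), Real.sqrt_eq_one] at e4
    norm_num at e4
  refine ⟨?_, hβ⟩
  simpa [hβ] using e0

end Deficiency

end

theorem mainTheorem1 (l ξ : ℕ) (hl : l = 1 ∨ l = 2) (hξ : ξ = 1 ∨ ξ = 2) (κ : ℝ) :
    IsEssentiallySelfAdjoint (radialCubeOperator l ξ κ) ∧
    ∀ σ : ℝ, (σ = 1 ∨ σ = -1) → ∀ ρ : ℝ, 0 < ρ →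
      (∀ y : (shiftOperator (radialCubeOperator l ξ κ)
          ((σ : ℂ) * Complex.I * (ρ : ℂ) ^ 6)).adjoint.domain,
        (shiftOperator (radialCubeOperator l ξ κ)
          ((σ : ℂ) * Complex.I * (ρ : ℂ) ^ 6)).adjoint y = 0 → y = 0) ∧
      ∀ α β : ℂ, (α ≠ 0 ∨ β ≠ 0) →
        ¬ ∃ y : (shiftOperator (radialCubeOperator l ξ κ)
            ((σ : ℂ) * Complex.I * (ρ : ℂ) ^ 6)).adjoint.domain,
          (y : HalfLineL2) =ᵐ[halfLine]
              (fun r => α * deficiencyOne l σ ρ r + β * deficiencyTwo l σ ρ r) ∧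
            (shiftOperator (radialCubeOperator l ξ κ)
              ((σ : ℂ) * Complex.I * (ρ : ℂ) ^ 6)).adjoint y = 0 := by
  have hd := dense_radialCubeOperator_domain hl ξ κ
  refine ⟨isEssentiallySelfAdjoint_of_range hd (radialCubeOperator_symmetric hl hξ κ)
    (fun y hy => ?_) (fun y hy => ?_), fun σ hσ ρ hρ => ?_⟩
  -- With ρ = 1 the constant σiρ⁶ is ±i, as the criterion requires.
  · have hk := isSixthRoots_sixthRoot (Or.inl rfl) one_pos
    norm_num at hk
    exact hk.eq_zero_of_inner_shift_eq_zero hl hξ κ hy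
  · have hk := isSixthRoots_sixthRoot (Or.inr rfl) one_pos
    norm_num at hk
    exact hk.eq_zero_of_inner_shift_eq_zero hl hξ κ hy
  · have key : ∀ y : (shiftOperator (radialCubeOperator l ξ κ)
          ((σ : ℂ) * Complex.I * (ρ : ℂ) ^ 6)).adjoint.domain,
        (shiftOperator (radialCubeOperator l ξ κ)
          ((σ : ℂ) * Complex.I * (ρ : ℂ) ^ 6)).adjoint y = 0 → y = 0 := fun y hy =>
      Subtype.ext ((isSixthRoots_sixthRoot hσ hρ).eq_zero_of_inner_shift_eq_zero hl hξ κ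
        (inner_shift_eq_zero hd _ y hy))
    refine ⟨key, ?_⟩
    rintro α β hαβ ⟨y, hy, hy0⟩
    -- The kernel is trivial, so the combination vanishes almost everywhere and independence gives α
    -- = β = 0.
    rw [key y hy0] at hy
    obtain ⟨rfl, rfl⟩ := eq_zero_of_deficiency_ae_eq_zero hl hσ hρ
      (hy.symm.trans (Lp.coeFn_zero ℂ 2 halfLine))
    simp at hαβ
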